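/- **Conventions.** Terms are built over a signature of fixed-arity function symbols and a countably infinite set of variables; substitutions have finite domain; rules are identified modulo renaming of variables. A TRS is a finite set of rewrite rules $l\to r$ ($l$ not a variable, $\mathcal V(r)\subseteq\mathcal V(l)$). It is *linear* (*left-linear*) if in every $l$ and $r$ (every $l$) each variable occurs at most once. $\to_{\mathcal R}$ is the rewrite relation, $\gets_{\mathcal R}$ its inverse, $\stackrel{=}{\to},\stackrel{*}{\to}$ denote the reflexive and the reflexive-transitive closure, and $\circ$ is composition of relations (left one first). We write $s\rightrightarrows_{V,\mathcal R}t$ if $t$ is obtained from $s$ by simultaneously contracting $\mathcal R$-redexes at the (finitely many, possibly no) pairwise parallel positions in $V$; $s\rightrightarrows_{\mathcal R}t$ if this holds for some $V$; and $\leftleftarrows$ for the inverses. $\mathcal R$ is *reversible* if $s\to_{\mathcal R}t$ implies $t\stackrel{*}{\to}_{\mathcal R}s$; *terminating* if there is no infinite chain of $\to_{\mathcal R}$; *terminating relative to* $\mathcal Q$ if there is no infinite chain of $\to_{\mathcal R}\circ\stackrel{*}{\to}_{\mathcal Q}$. For a set $U$ of positions, $\mathcal V_U(t)$ is the set of variables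 of the subterms $t/p$, $p\in U$. Put $\mathcal P^{-1}=\{r\to l\mid l\to r\in\mathcal P\}$ and $\mathcal P^{\pm}=\mathcal P\cup\mathcal P^{-1}$. $\mathrm{CP}(\mathcal R,\mathcal Q)$ is the set of critical pairs $\langle l_2[r_1]_p\sigma,\ r_2\sigma\rangle$, where $l_1\to r_1\in\mathcal R$ and $l_2\to r_2\in\mathcal Q$ are renamed to be variable-disjoint, $l_2/p$ is not a variable, and $\sigma$ is a most general unifier of $l_1$ and $l_2/p$; the case $p=\epsilon$ is excluded if the two rules are identical modulo renaming. $\mathrm{PCP}_{in}(\mathcal R,\mathcal Q)$ is the set of inner parallel critical pairs $\langle l'[r_1,\dots,r_n]_{p_1,\dots,p_n}\sigma,\ r'\sigma\rangle_X$, where $n\ge1$, $l_i\to r_i\in\mathcal R$ and $l'\to r'\in\mathcal Q$ are renamed to be mutually variable-disjoint, $p_1,\dots,p_n\neq\epsilon$ are parallel positions of $l'$ with $l'/p_i$ not a variable, $\sigma$ is a most general unifier of $\{l_i\approx l'/p_i\mid 1\le i\le n\}$, and $X=\mathcal V_{\{p_1,\dots,p_n\}}(l'\sigma)$. **Criteria.**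 Each criterion *applies* to a TRS $\mathcal R$ if $\mathcal R$ can be partitioned into disjoint TRSs $\mathcal S$ and $\mathcal P$, with $\mathcal P$ reversible, such that the respective conditions below hold. * (Lin-RT) $\mathcal S$ is linear, and for some $\mathcal P'\subseteq\mathcal P^{\pm}$, $\mathcal S$ is terminating relative to $\mathcal P'$ and (i) $\mathrm{CP}(\mathcal S,\mathcal S)\subseteq{\stackrel{*}{\to}}_{\mathcal S\cup\mathcal P'}\circ{\stackrel{=}{\gets}}_{\mathcal P^{\pm}}\circ{\stackrel{*}{\gets}}_{\mathcal S\cup\mathcal P'}$, (ii) $\mathrm{CP}(\mathcal P^{\pm},\mathcal S)\subseteq({\stackrel{=}{\gets}}_{\mathcal P^{\pm}}\circ{\stackrel{*}{\gets}}_{\mathcal S\cup\mathcal P'})\cup({\to}_{\mathcal S}\circ{\stackrel{*}{\to}}_{\mathcal S\cup\mathcal P'}\circ{\stackrel{=}{\gets}}_{\mathcal P^{\pm}}\circ{\stackrel{*}{\gets}}_{\mathcal S\cup\mathcal P'})$, (iii) $\mathrm{CP}(\mathcal S,\mathcal P^{\pm})\subseteq({\stackrel{*}{\to}}_{\mathcal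 S\cup\mathcal P'}\circ{\stackrel{=}{\to}}_{\mathcal P^{\pm}})\cup({\stackrel{*}{\to}}_{\mathcal S\cup\mathcal P'}\circ{\stackrel{=}{\to}}_{\mathcal P^{\pm}}\circ{\stackrel{*}{\gets}}_{\mathcal S\cup\mathcal P'}\circ{\gets}_{\mathcal S})$. * (Lin) $\mathcal S$ is linear and terminating, $\mathrm{CP}(\mathcal S,\mathcal S)$ and $\mathrm{CP}(\mathcal P^{\pm},\mathcal S)$ are contained in ${\stackrel{*}{\to}}_{\mathcal S}\circ{\stackrel{=}{\gets}}_{\mathcal P^{\pm}}\circ{\stackrel{*}{\gets}}_{\mathcal S}$, and $\mathrm{CP}(\mathcal S,\mathcal P^{\pm})\subseteq{\stackrel{*}{\to}}_{\mathcal S}\circ{\stackrel{=}{\to}}_{\mathcal P^{\pm}}\circ{\stackrel{*}{\gets}}_{\mathcal S}$. * (PCP-RT) $\mathcal S$ is left-linear, and for some $\mathcal P'\subseteq\mathcal P^{\pm}$, $\mathcal S$ is terminating relative to $\mathcal P'$ and (i) $\mathrm{CP}(\mathcal S,\mathcal S)\subseteq{\stackrel{*}{\to}}_{\mathcal S\cup\mathcal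 P'}\circ{\leftleftarrows}_{\mathcal P^{\pm}}\circ{\stackrel{*}{\gets}}_{\mathcal S\cup\mathcal P'}$, (ii) for every $\langle u,v\rangle_X\in\mathrm{PCP}_{in}(\mathcal P^{\pm},\mathcal S)$ there are $u'$ and $V$ with $\mathcal V_V(u')\subseteq X$ such that $u=u'$ or $u\to_{\mathcal S}\circ\stackrel{*}{\to}_{\mathcal S\cup\mathcal P'}u'$, and $u'\leftleftarrows_{V,\mathcal P^{\pm}}\circ\stackrel{*}{\gets}_{\mathcal S\cup\mathcal P'}v$, (iii) $\mathrm{CP}(\mathcal S,\mathcal P^{\pm})\subseteq({\stackrel{*}{\to}}_{\mathcal S\cup\mathcal P'}\circ{\rightrightarrows}_{\mathcal P^{\pm}})\cup({\stackrel{*}{\to}}_{\mathcal S\cup\mathcal P'}\circ{\rightrightarrows}_{\mathcal P^{\pm}}\circ{\stackrel{*}{\gets}}_{\mathcal S\cup\mathcal P'}\circ{\gets}_{\mathcal S})$. * (PCP) $\mathcal S$ is left-linear and terminating, $\mathrm{CP}(\mathcal S,\mathcal S)\subseteq{\stackrel{*}{\to}}_{\mathcal S}\circ{\leftleftarrows}_{\mathcal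 P^{\pm}}\circ{\stackrel{*}{\gets}}_{\mathcal S}$; for every $\langle u,v\rangle_X\in\mathrm{PCP}_{in}(\mathcal P^{\pm},\mathcal S)$ there are $u'$ and $V$ with $\mathcal V_V(u')\subseteq X$ and $u\stackrel{*}{\to}_{\mathcal S}u'\leftleftarrows_{V,\mathcal P^{\pm}}\circ\stackrel{*}{\gets}_{\mathcal S}v$; and $\mathrm{CP}(\mathcal S,\mathcal P^{\pm})\subseteq{\stackrel{*}{\to}}_{\mathcal S}\circ{\rightrightarrows}_{\mathcal P^{\pm}}\circ{\stackrel{*}{\gets}}_{\mathcal S}$. Two criteria are *incomparable* if each of them applies to some TRS to which the other does not apply. **Example TRSs.** Over $0,\mathsf s,+,\mathsf{dbl}$ let $(\mathsf{add}_1)\ 0+y\to y$, $(\mathsf{add}_2)\ \mathsf s(x)+y\to\mathsf s(x+y)$, $(\mathsf{add}_3)\ x+0\to x$, $(\mathsf{add}_4)\ x+\mathsf s(y)\to\mathsf s(x+y)$, $(\mathsf{add}_5)\ x+\mathsf s(y)\to\mathsf s(x)+y$, $(C)\ x+y\to y+x$, $(A)\ (x+y)+z\to x+(y+z)$, $(\mathsf{dbl})\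 \mathsf{dbl}(x)\to x+x$, $(\mathsf{ss}_1)\ \mathsf s(x)\to\mathsf s(\mathsf s(x))$, $(\mathsf{ss}_2)\ \mathsf s(\mathsf s(x))\to\mathsf s(x)$, and $$\mathcal R_3=\{\mathsf{add}_1,\mathsf{add}_2,\mathsf{add}_3,\mathsf{add}_4,C,A\},\quad \mathcal R_4=\mathcal R_3\cup\{\mathsf{dbl}\},\quad \mathcal R_5=\mathcal R_3\cup\{\mathsf{ss}_1,\mathsf{ss}_2\},$$ $$\mathcal R_6=\{\mathsf{add}_1,\mathsf{add}_2,\mathsf{add}_3,\mathsf{add}_5,C,A,\mathsf{dbl}\},\quad \mathcal R_7=\mathcal R_4\cup\mathcal R_5.$$ Over $\mathsf f$ (binary), $\mathsf g,\mathsf h$ (unary) let $\mathcal R_8$ consist of $\mathsf f(\mathsf g(x),\mathsf g(y))\to\mathsf f(\mathsf g(x),\mathsf h(y))$, $\mathsf f(\mathsf h(x),\mathsf g(y))\to\mathsf f(\mathsf g(x),\mathsf g(y))$, $\mathsf f(\mathsf g(x),\mathsf h(y))\to\mathsf f(x,y)$, $\mathsf f(\mathsf h(x),\mathsf h(y))\to\mathsf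 f(y,x)$, $\mathsf f(x,y)\to\mathsf f(y,x)$, $\mathsf g(x)\to\mathsf h(x)$, $\mathsf h(x)\to\mathsf g(x)$. **Theorem (incomparability of the criteria).** (1) (Lin) and (PCP-RT) are incomparable. (2) (PCP) and (Lin-RT) are incomparable. (3) (Lin-RT) and (PCP-RT) are incomparable. (4) (Lin) and (PCP) are incomparable. This is witnessed by the TRSs $\mathcal R_3,\dots,\mathcal R_8$, which are located as follows: all four criteria apply to $\mathcal R_3$; to each of $\mathcal R_4$ and $\mathcal R_6$ exactly (PCP) and (PCP-RT) apply; to $\mathcal R_5$ exactly (Lin), (Lin-RT) and (PCP-RT) apply; to $\mathcal R_7$ exactly (PCP-RT) applies; to $\mathcal R_8$ exactly (Lin) and (Lin-RT) apply. -/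

import Mathlib

namespace Rewriting

/-! ## Terms, positions, substitutions

Terms over a signature are Mathlib's first-order terms `L.Term ℕ`, with the natural numbers as the
(countably infinite) set of variables; only the function symbols of `L` are used. -/

/-- Positions are finite sequences of argument indices; the arguments of a function symbol are
counted from `0`, and `[]` is the root. -/
abbrev Pos := List ℕ

/-- Two positions are parallel if neither is a prefix of the other. -/
def Parallel (p q : Pos) : Prop := ¬ p <+: q ∧ ¬ q <+: p

section Terms

variable {L : FirstOrder.Language.{0, 0}}

/-- The subterm `t/p`; it is `none` if `p` is not a position of `t`. -/
def subtermAt : L.Term ℕ → Pos → Option (L.Term ℕ)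
  | t, [] => some t
  | .var _, _ :: _ => none
  | @FirstOrder.Language.Term.func _ _ n _ ts, i :: p => if h : i < n then subtermAt (ts ⟨i, h⟩) p else none

/-- Simultaneous replacement: the subterm of `t` at an (outermost) position `p` with
`g p = some s` is replaced by `s`. -/
def replacePar : L.Term ℕ → (Pos → Option (L.Term ℕ)) → L.Term ℕ
  | .var x, g => (g []).getD (.var x)
  | .func f ts, g => (g []).getD (.func f fun i => replacePar (ts i) fun p => g (i.val :: p))

/-- `t[s]_p`. -/
def replaceAt (t : L.Term ℕ) (p : Pos) (s : L.Term ℕ) : L.Term ℕ :=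
  replacePar t fun q => if q = p then some s else none

/-- `t[s p]_{p ∈ U}` for a finite set `U` of (parallel) positions. -/
def replaceOn (t : L.Term ℕ) (U : Finset Pos) (s : Pos → L.Term ℕ) : L.Term ℕ :=
  replacePar t fun p => if p ∈ U then some (s p) else none

/-- The variables that occur in `t` in a subterm `t/p` with `p ∈ U`. -/
def varsAt (U : Finset Pos) (t : L.Term ℕ) : Set ℕ :=
  {x | ∃ p ∈ U, ∃ u, subtermAt t p = some u ∧ x ∈ u.varFinset}

def IsVar (t : L.Term ℕ) : Prop := ∃ x, t = .var x

/-- Every variable occurs at most once. -/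
def IsLinearTerm (t : L.Term ℕ) : Prop :=
  ∀ x p q, subtermAt t p = some (.var x) → subtermAt t q = some (.var x) → p = q

/-- Substitutions have finite domain; they act on terms by `Term.subst`. -/
def IsSubst (σ : ℕ → L.Term ℕ) : Prop := {x | σ x ≠ .var x}.Finite

/-- `σ` unifies all the equations in `E`. -/
def IsUnifier (E : Set (L.Term ℕ × L.Term ℕ)) (σ : ℕ → L.Term ℕ) : Prop :=
  ∀ e ∈ E, e.1.subst σ = e.2.subst σ

/-- `σ` is a most general unifier of `E`. -/
def IsMGU (E : Set (L.Term ℕ × L.Term ℕ)) (σ : ℕ → L.Term ℕ) : Prop :=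
  IsSubst σ ∧ IsUnifier E σ ∧
    ∀ τ, IsSubst τ → IsUnifier E τ → ∃ δ, IsSubst δ ∧ ∀ x, τ x = (σ x).subst δ

end Terms

/-! ## Rules and term rewriting systems -/

/-- A directed equation `lhs ≈ rhs`; see `Rule.IsRewriteRule`. -/
structure Rule (L : FirstOrder.Language.{0, 0}) where
  lhs : L.Term ℕ
  rhs : L.Term ℕ

section Systems

variable {L : FirstOrder.Language.{0, 0}}

/-- The left-hand side is not a variable, and all variables of the right-hand side occur in it. -/
def Rule.IsRewriteRule (ρ : Rule L) : Prop :=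
  ¬ IsVar ρ.lhs ∧ ρ.rhs.varFinset ⊆ ρ.lhs.varFinset

def Rule.vars (ρ : Rule L) : Finset ℕ := ρ.lhs.varFinset ∪ ρ.rhs.varFinset

/-- The two rules are identical modulo a renaming of variables. -/
def Rule.IsVariant (ρ τ : Rule L) : Prop :=
  ∃ π : Equiv.Perm ℕ, τ.lhs = ρ.lhs.relabel π ∧ τ.rhs = ρ.rhs.relabel π

def Rule.inv (ρ : Rule L) : Rule L := ⟨ρ.rhs, ρ.lhs⟩

/-- A term rewriting system is a finite set of rewrite rules. -/
def IsTRS (R : Set (Rule L)) : Prop := R.Finite ∧ ∀ ρ ∈ R, ρ.IsRewriteRule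

/-- `R ∪ R⁻¹`. -/
def sym (R : Set (Rule L)) : Set (Rule L) := R ∪ Rule.inv '' R

def LeftLinear (R : Set (Rule L)) : Prop := ∀ ρ ∈ R, IsLinearTerm ρ.lhs

def Linear (R : Set (Rule L)) : Prop := ∀ ρ ∈ R, IsLinearTerm ρ.lhs ∧ IsLinearTerm ρ.rhs

/-- The rewrite relation of `R`. -/
def Step (R : Set (Rule L)) (s t : L.Term ℕ) : Prop :=
  ∃ ρ ∈ R, ∃ (p : Pos) (θ : ℕ → L.Term ℕ), IsSubst θ ∧
    subtermAt s p = some (ρ.lhs.subst θ) ∧ t = replaceAt s p (ρ.rhs.subst θ)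

/-- Reflexive-transitive closure of the rewrite relation. -/
def Steps (R : Set (Rule L)) : L.Term ℕ → L.Term ℕ → Prop := Relation.ReflTransGen (Step R)

/-- Reflexive closure of the rewrite relation. -/
def StepEq (R : Set (Rule L)) : L.Term ℕ → L.Term ℕ → Prop := Relation.ReflGen (Step R)

/-- The parallel rewrite step from `s` to `t` that contracts the redexes of `s` at the
parallel positions in `V`. -/
def ParStepAt (R : Set (Rule L)) (V : Finset Pos) (s t : L.Term ℕ) : Prop :=
  (V : Set Pos).Pairwise Parallel ∧
    ∃ (ρ : Pos → Rule L) (θ : Pos → ℕ → L.Term ℕ),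
      (∀ p ∈ V, ρ p ∈ R ∧ IsSubst (θ p) ∧ subtermAt s p = some ((ρ p).lhs.subst (θ p))) ∧
      t = replaceOn s V fun p => (ρ p).rhs.subst (θ p)

/-- A parallel rewrite step. -/
def ParStep (R : Set (Rule L)) (s t : L.Term ℕ) : Prop := ∃ V, ParStepAt R V s t

/-- There is no infinite chain `a 0 → a 1 → ⋯`. -/
def NoInfiniteChain {α : Type*} (r : α → α → Prop) : Prop :=
  ¬ ∃ a : ℕ → α, ∀ n, r (a n) (a (n + 1))

def Terminating (R : Set (Rule L)) : Prop := NoInfiniteChain (Step R)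

/-- `R` is terminating relative to `P`. -/
def TerminatingRel (R P : Set (Rule L)) : Prop :=
  NoInfiniteChain (Relation.Comp (Step R) (Steps P))

/-- Every rewrite step can be undone by finitely many rewrite steps. -/
def Reversible (R : Set (Rule L)) : Prop := ∀ s t, Step R s t → Steps R t s

/-! ## Critical pairs -/

/-- The critical pairs obtained by overlaps of a rule from `R` on a rule from `Q`.
The rules `τ₁`, `τ₂` are variable-disjoint variants of the given rules. A rule is not overlapped
with itself (up to renaming) at the root. -/
def CP (R Q : Set (Rule L)) : Set (L.Term ℕ × L.Term ℕ) :=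
  {c | ∃ ρ₁ ∈ R, ∃ ρ₂ ∈ Q, ∃ τ₁ τ₂ : Rule L,
    ρ₁.IsVariant τ₁ ∧ ρ₂.IsVariant τ₂ ∧ Disjoint τ₁.vars τ₂.vars ∧
    ∃ (p : Pos) (w : L.Term ℕ) (σ : ℕ → L.Term ℕ),
      subtermAt τ₂.lhs p = some w ∧ ¬ IsVar w ∧
      ¬ (p = [] ∧ ρ₁.IsVariant ρ₂) ∧
      IsMGU {(τ₁.lhs, w)} σ ∧
      c = ((replaceAt τ₂.lhs p τ₁.rhs).subst σ, τ₂.rhs.subst σ)}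

/-- The inner parallel critical pairs `⟨u, v⟩_X`, as triples `(u, v, X)`, obtained by
parallel-overlaps of rules from `R` (the variants `τ p`, at the non-root parallel positions
`p ∈ U`) on a rule from `Q` (the variant `τ₀`). -/
def PCPIn (R Q : Set (Rule L)) : Set (L.Term ℕ × L.Term ℕ × Set ℕ) :=
  {c | ∃ ρ₀ ∈ Q, ∃ τ₀ : Rule L, ρ₀.IsVariant τ₀ ∧
    ∃ (U : Finset Pos) (τ : Pos → Rule L) (w : Pos → L.Term ℕ) (σ : ℕ → L.Term ℕ),
      U.Nonempty ∧ [] ∉ U ∧ (U : Set Pos).Pairwise Parallel ∧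
      (∀ p ∈ U, (∃ ρ ∈ R, ρ.IsVariant (τ p)) ∧ Disjoint (τ p).vars τ₀.vars ∧
        subtermAt τ₀.lhs p = some (w p) ∧ ¬ IsVar (w p)) ∧
      (∀ p ∈ U, ∀ q ∈ U, p ≠ q → Disjoint (τ p).vars (τ q).vars) ∧
      IsMGU {e | ∃ p ∈ U, e = ((τ p).lhs, w p)} σ ∧
      c = ((replaceOn τ₀.lhs U fun p => (τ p).rhs).subst σ, τ₀.rhs.subst σ,
        varsAt U (τ₀.lhs.subst σ))}

/-- All the pairs in `C` belong to the relation `r`. -/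
def PairsIn (C : Set (L.Term ℕ × L.Term ℕ)) (r : L.Term ℕ → L.Term ℕ → Prop) : Prop :=
  ∀ c ∈ C, r c.1 c.2

/-! ## The four confluence criteria

`flip r` is the inverse of the relation `r`, `Relation.Comp r s` the composition (first `r`, then `s`), and
`r ⊔ s` the union of two relations. In each criterion `S` is the terminating part and `P` the
reversible part of the system. -/


/-- The hypotheses of the criterion for linear `S`, with relative termination. -/
structure LinearRTConditions (S P P₀ : Set (Rule L)) : Prop where
  linear : Linear S
  reversible : Reversible P
  subset : P₀ ⊆ sym P
  terminating : TerminatingRel S P₀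
  cp_S_S : PairsIn (CP S S)
    (Relation.Comp (Steps (S ∪ P₀))
      (Relation.Comp (flip (StepEq (sym P))) (flip (Steps (S ∪ P₀)))))
  cp_P_S : PairsIn (CP (sym P) S)
    (Relation.Comp (flip (StepEq (sym P))) (flip (Steps (S ∪ P₀))) ⊔
      Relation.Comp (Step S) (Relation.Comp (Steps (S ∪ P₀))
        (Relation.Comp (flip (StepEq (sym P))) (flip (Steps (S ∪ P₀))))))
  cp_S_P : PairsIn (CP S (sym P))
    (Relation.Comp (Steps (S ∪ P₀)) (StepEq (sym P)) ⊔
      Relation.Comp (Steps (S ∪ P₀)) (Relation.Comp (StepEq (sym P))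
        (Relation.Comp (flip (Steps (S ∪ P₀))) (flip (Step S)))))

/-- The hypotheses of the criterion for linear `S`, without relative termination. -/
structure LinearConditions (S P : Set (Rule L)) : Prop where
  linear : Linear S
  reversible : Reversible P
  terminating : Terminating S
  cp_S_S : PairsIn (CP S S)
    (Relation.Comp (Steps S) (Relation.Comp (flip (StepEq (sym P))) (flip (Steps S))))
  cp_P_S : PairsIn (CP (sym P) S)
    (Relation.Comp (Steps S) (Relation.Comp (flip (StepEq (sym P))) (flip (Steps S))))
  cp_S_P : PairsIn (CP S (sym P))
    (Relation.Comp (Steps S) (Relation.Comp (StepEq (sym P)) (flip (Steps S))))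

/-- The hypotheses of the criterion based on parallel critical pairs, with relative
termination. -/
structure PCPRTConditions (S P P₀ : Set (Rule L)) : Prop where
  leftLinear : LeftLinear S
  reversible : Reversible P
  subset : P₀ ⊆ sym P
  terminating : TerminatingRel S P₀
  cp_S_S : PairsIn (CP S S)
    (Relation.Comp (Steps (S ∪ P₀))
      (Relation.Comp (flip (ParStep (sym P))) (flip (Steps (S ∪ P₀)))))
  pcp_P_S : ∀ u v X, (u, v, X) ∈ PCPIn (sym P) S →
    ∃ (V : Finset Pos) (a b : L.Term ℕ),
      (u = a ∨ Relation.Comp (Step S) (Steps (S ∪ P₀)) u a) ∧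
      ParStepAt (sym P) V b a ∧ Steps (S ∪ P₀) v b ∧ varsAt V a ⊆ X
  cp_S_P : PairsIn (CP S (sym P))
    (Relation.Comp (Steps (S ∪ P₀)) (ParStep (sym P)) ⊔
      Relation.Comp (Steps (S ∪ P₀)) (Relation.Comp (ParStep (sym P))
        (Relation.Comp (flip (Steps (S ∪ P₀))) (flip (Step S)))))

/-- The hypotheses of the criterion based on parallel critical pairs, without relative
termination. -/
structure PCPConditions (S P : Set (Rule L)) : Prop where
  leftLinear : LeftLinear S
  reversible : Reversible P
  terminating : Terminating S
  cp_S_S : PairsIn (CP S S)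
    (Relation.Comp (Steps S) (Relation.Comp (flip (ParStep (sym P))) (flip (Steps S))))
  pcp_P_S : ∀ u v X, (u, v, X) ∈ PCPIn (sym P) S →
    ∃ (V : Finset Pos) (a b : L.Term ℕ),
      Steps S u a ∧ ParStepAt (sym P) V b a ∧ Steps S v b ∧ varsAt V a ⊆ X
  cp_S_P : PairsIn (CP S (sym P))
    (Relation.Comp (Steps S) (Relation.Comp (ParStep (sym P)) (flip (Steps S))))

/-- `R` is partitioned into `S` and `P`; as rules are identified modulo renaming, no rule is
put into both parts. -/
def IsPartition (R S P : Set (Rule L)) : Prop :=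
  S ∪ P = R ∧ ∀ ρ ∈ S, ∀ τ ∈ P, ¬ ρ.IsVariant τ

end Systems

/-- A confluence criterion, given by the rewriting systems to which it applies. -/
abbrev Criterion := ∀ L : FirstOrder.Language.{0, 0}, Set (Rule L) → Prop

def LinearRT : Criterion := fun _ R =>
  ∃ S P P₀, IsPartition R S P ∧ LinearRTConditions S P P₀

def LinearNoRT : Criterion := fun _ R =>
  ∃ S P, IsPartition R S P ∧ LinearConditions S P

def PCPRT : Criterion := fun _ R =>
  ∃ S P P₀, IsPartition R S P ∧ PCPRTConditions S P P₀

def PCPNoRT : Criterion := fun _ R =>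
  ∃ S P, IsPartition R S P ∧ PCPConditions S P

/-- Each of the two criteria applies to some TRS to which the other does not apply. -/
def Incomparable (C D : Criterion) : Prop :=
  (∃ (L : FirstOrder.Language.{0, 0}) (R : Set (Rule L)), IsTRS R ∧ C L R ∧ ¬ D L R) ∧
  (∃ (L : FirstOrder.Language.{0, 0}) (R : Set (Rule L)), IsTRS R ∧ D L R ∧ ¬ C L R)

/-! ## The example systems -/

/-- The function symbols `0`, `s`, `dbl`, `+`. -/
inductive ArithFn : ℕ → Type
  | zero : ArithFn 0
  | succ : ArithFn 1
  | dbl : ArithFn 1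
  | plus : ArithFn 2

def arith : FirstOrder.Language.{0, 0} := ⟨ArithFn, fun _ => Empty⟩

namespace Arith

def O : arith.Term ℕ := .func (L := arith) ArithFn.zero ![]
def s (t : arith.Term ℕ) : arith.Term ℕ := .func (L := arith) ArithFn.succ ![t]
def dbl (t : arith.Term ℕ) : arith.Term ℕ := .func (L := arith) ArithFn.dbl ![t]
def plus (t u : arith.Term ℕ) : arith.Term ℕ := .func (L := arith) ArithFn.plus ![t, u]
def x : arith.Term ℕ := .var 0
def y : arith.Term ℕ := .var 1
def z : arith.Term ℕ := .var 2

def add₁ : Rule arith := ⟨plus O y, y⟩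
def add₂ : Rule arith := ⟨plus (s x) y, s (plus x y)⟩
def add₃ : Rule arith := ⟨plus x O, x⟩
def add₄ : Rule arith := ⟨plus x (s y), s (plus x y)⟩
def add₅ : Rule arith := ⟨plus x (s y), plus (s x) y⟩
def commR : Rule arith := ⟨plus x y, plus y x⟩
def assocR : Rule arith := ⟨plus (plus x y) z, plus x (plus y z)⟩
def double : Rule arith := ⟨dbl x, plus x x⟩
def ss₁ : Rule arith := ⟨s x, s (s x)⟩
def ss₂ : Rule arith := ⟨s (s x), s x⟩

end Arith

open Arith in
def R₃ : Set (Rule arith) := {add₁, add₂, commR, assocR, add₃, add₄}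

open Arith in
def R₄ : Set (Rule arith) := R₃ ∪ {double}

open Arith in
def R₅ : Set (Rule arith) := R₃ ∪ {ss₁, ss₂}

open Arith in
def R₆ : Set (Rule arith) := {add₁, add₂, add₃, commR, assocR, double, add₅}

def R₇ : Set (Rule arith) := R₄ ∪ R₅

/-- The function symbols `f`, `g`, `h`. -/
inductive LoopFn : ℕ → Type
  | f : LoopFn 2
  | g : LoopFn 1
  | h : LoopFn 1

def loop : FirstOrder.Language.{0, 0} := ⟨LoopFn, fun _ => Empty⟩

namespace Loop

def f (t u : loop.Term ℕ) : loop.Term ℕ := .func (L := loop) LoopFn.f ![t, u]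
def g (t : loop.Term ℕ) : loop.Term ℕ := .func (L := loop) LoopFn.g ![t]
def h (t : loop.Term ℕ) : loop.Term ℕ := .func (L := loop) LoopFn.h ![t]
def x : loop.Term ℕ := .var 0
def y : loop.Term ℕ := .var 1

end Loop

open Loop in
def R₈ : Set (Rule loop) :=
  {⟨f (g x) (g y), f (g x) (h y)⟩,
   ⟨f (h x) (g y), f (g x) (g y)⟩,
   ⟨f (g x) (h y), f x y⟩,
   ⟨f (h x) (h y), f y x⟩,
   ⟨f x y, f y x⟩,
   ⟨g x, h x⟩,
   ⟨h x, g x⟩}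

end Rewriting

namespace Rewriting

section Generic

variable {L : FirstOrder.Language.{0, 0}}

open FirstOrder.Language (Term)

/-! ## Subterms, replacement and substitution -/

/-! The criteria without relative termination imply those with it: take `P₀ = ∅`
(`LinearConditions.toRT`, `PCPConditions.toRT`). Hence successes are established in the stronger
form where possible, and failures of (Lin) follow from failures of (Lin-RT); likewise failure of
(PCP) for `R₈` follows from failure of (PCP-RT).

For the successes, a critical pair is weakened to an instance under an arbitrary unifier
(`overlap_of_mem_CP`, `overlap_of_mem_PCPIn`), so no most general unifier has to be computed. In the
arithmetical systems, `S` holds the rules for addition and doubling, and `P` holds commutativity,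
associativity and possibly both `ss` rules. Addition erases `O` and moves `s` outwards, so the two
sides of every critical pair reduce to terms that are equal or differ by one step of `sym P`
(`JoinMod`). Inner parallel overlaps exist only if the `ss` rules are present; for them (PCP-RT)
uses `P₀ = {ss₂}`, which decreases the same weight as `S` and collapses `s (s t)` to `s t`. In `R₈`,
any `f` applied to two terms headed by `g` or `h` reduces to the `f` of their arguments, up to
order, and the swap rule absorbs the order.

The failures rest on three obstructions, each valid for every partition. Doubling: its right-hand
side is not linear, so it cannot lie in `S`; in `P` it is not reversible, since `x + x` rewrites
only to itself (`not_linearRT`). The `ss` rules: termination and reversibility force them into `P`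
and `add₂` into `S`. The pair of `s (s x) + y` and `s (x + y)` can then be closed only by a
contraction that touches `y`, which lies outside the overlapped variables (`not_pcpNoRT`). The
system `R₈`: simultaneous overlaps on both arguments of `f` force `ruleHG` and `ruleGG` into `S`.
Then any rule in `P₀` creates a cycle, so `P₀ = ∅`, and one further inner overlap violates the
variable condition (`not_pcpRT_R₈`). -/

theorem func_inj {n : ℕ} {f : L.Functions n} {ts us : Fin n → L.Term ℕ}
    (h : (Term.func f ts : L.Term ℕ) = .func f us) : ts = us := by
  injection h

@[simp] theorem subtermAt_nil (t : L.Term ℕ) : subtermAt t [] = some t := by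
  cases t <;> rfl

@[simp] theorem subtermAt_var_cons (x i : ℕ) (p : Pos) :
    subtermAt (.var x : L.Term ℕ) (i :: p) = none := rfl

theorem subtermAt_func_cons {n : ℕ} (f : L.Functions n) (ts : Fin n → L.Term ℕ) (i : ℕ) (p : Pos) :
    subtermAt (.func f ts) (i :: p) = if h : i < n then subtermAt (ts ⟨i, h⟩) p else none := rfl

theorem subtermAt_func_fin {n : ℕ} (f : L.Functions n) (ts : Fin n → L.Term ℕ) (i : Fin n)
    (p : Pos) : subtermAt (.func f ts) (i.val :: p) = subtermAt (ts i) p := by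
  simp [subtermAt_func_cons]

theorem exists_of_subtermAt_func_cons {n : ℕ} {f : L.Functions n} {ts : Fin n → L.Term ℕ} {i : ℕ}
    {p : Pos} {w : L.Term ℕ} (h : subtermAt (.func f ts) (i :: p) = some w) :
    ∃ j : Fin n, j.val = i ∧ subtermAt (ts j) p = some w := by
  rw [subtermAt_func_cons] at h
  split_ifs at h with hi
  exact ⟨⟨i, hi⟩, rfl, h⟩

theorem replacePar_of_nil {t v : L.Term ℕ} {g : Pos → Option (L.Term ℕ)} (h : g [] = some v) :
    replacePar t g = v := by
  cases t <;> simp [replacePar, h]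

theorem replacePar_func {n : ℕ} {f : L.Functions n} {ts : Fin n → L.Term ℕ}
    {g : Pos → Option (L.Term ℕ)} (h : g [] = none) :
    replacePar (.func f ts) g = .func f fun i => replacePar (ts i) fun p => g (i.val :: p) := by
  simp [replacePar, h]

theorem replacePar_none (t : L.Term ℕ) : replacePar t (fun _ => none) = t := by
  induction t with
  | var x => rfl
  | func f ts ih => simp [replacePar, ih]

@[simp] theorem replaceAt_nil (t v : L.Term ℕ) : replaceAt t [] v = v :=
  replacePar_of_nil (by simp)

theorem replaceAt_func {n : ℕ} (f : L.Functions n) (ts : Fin n → L.Term ℕ) (i : Fin n) (p : Pos)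
    (v : L.Term ℕ) : replaceAt (.func f ts) (i.val :: p) v =
      .func f (Function.update ts i (replaceAt (ts i) p v)) := by
  rw [replaceAt, replacePar_func (by simp)]
  congr 1
  funext j
  by_cases h : j = i
  · subst h
    simp [replaceAt]
  · have h' : j.val ≠ i.val := fun e => h (Fin.ext e)
    simp [h, h', replacePar_none]

@[simp] theorem replaceOn_empty (t : L.Term ℕ) (c : Pos → L.Term ℕ) : replaceOn t ∅ c = t := by
  simp [replaceOn, replacePar_none]

theorem replaceOn_singleton (t : L.Term ℕ) (p : Pos) (c : Pos → L.Term ℕ) :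
    replaceOn t {p} c = replaceAt t p (c p) := by
  rw [replaceOn, replaceAt]
  congr 1
  funext q
  by_cases h : q = p <;> simp [h]

theorem subst_relabel (t : L.Term ℕ) (π : ℕ → ℕ) (σ : ℕ → L.Term ℕ) :
    (t.relabel π).subst σ = t.subst (σ ∘ π) := by
  induction t with
  | var x => rfl
  | func f ts ih => simp [Term.relabel, Term.subst, ih]

theorem subtermAt_relabel (t : L.Term ℕ) (π : ℕ → ℕ) (p : Pos) :
    subtermAt (t.relabel π) p = (subtermAt t p).map (Term.relabel π) := by
  induction t generalizing p with
  | var x => cases p <;> simp [Term.relabel]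
  | func f ts ih =>
    cases p with
    | nil => simp
    | cons i p =>
      simp only [Term.relabel, subtermAt_func_cons]
      split_ifs with h
      · exact ih _ _
      · rfl

theorem isVar_relabel {t : L.Term ℕ} {π : ℕ → ℕ} (h : IsVar t) : IsVar (t.relabel π) := by
  obtain ⟨x, rfl⟩ := h
  exact ⟨π x, rfl⟩

/-- The hypothesis keeps the replaced positions inside `t`. Without it, a position below a variable
of `t` could become a position of the instance and be replaced only there. -/
theorem replacePar_subst (t : L.Term ℕ) (g : Pos → Option (L.Term ℕ)) (σ : ℕ → L.Term ℕ)
    (h : ∀ p, (g p).isSome → (subtermAt t p).isSome) :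
    (replacePar t g).subst σ = replacePar (t.subst σ) fun p => (g p).map fun v => v.subst σ := by
  induction t generalizing g with
  | var x =>
    cases hg : g [] with
    | some v => rw [replacePar_of_nil hg, replacePar_of_nil (v := v.subst σ) (by simp [hg])]
    | none =>
      have : (fun p => (g p).map fun v => v.subst σ) = fun _ => none := by
        funext p
        cases p with
        | nil => simp [hg]
        | cons i p =>
          cases hp : g (i :: p) with
          | none => rfl
          | some v => simpa using h (i :: p) (by simp [hp])
      rw [this, replacePar_none]
      simp [replacePar, hg]
  | func f ts ih =>
    cases hg : g [] with
    | some v => rw [replacePar_of_nil hg, replacePar_of_nil (v := v.subst σ) (by simp [hg])]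
    | none =>
      rw [replacePar_func hg, Term.subst, Term.subst, replacePar_func (by simp [hg])]
      congr 1
      funext i
      refine ih i _ fun p hp => ?_
      simpa [subtermAt_func_fin] using h (i.val :: p) hp

theorem replaceAt_subst {t w : L.Term ℕ} {p : Pos} (h : subtermAt t p = some w) (v : L.Term ℕ)
    (σ : ℕ → L.Term ℕ) : (replaceAt t p v).subst σ = replaceAt (t.subst σ) p (v.subst σ) := by
  rw [replaceAt, replacePar_subst, replaceAt]
  · congr 1
    funext q
    by_cases hq : q = p <;> simp [hq]
  · intro q hq
    by_cases hqp : q = p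
    · simp [hqp, h]
    · simp [hqp] at hq

theorem replaceOn_subst {t : L.Term ℕ} {U : Finset Pos} (h : ∀ p ∈ U, (subtermAt t p).isSome)
    (c : Pos → L.Term ℕ) (σ : ℕ → L.Term ℕ) :
    (replaceOn t U c).subst σ = replaceOn (t.subst σ) U fun p => (c p).subst σ := by
  rw [replaceOn, replacePar_subst, replaceOn]
  · congr 1
    funext q
    by_cases hq : q ∈ U <;> simp [hq]
  · intro q hq
    by_cases hqp : q ∈ U
    · exact h q hqp
    · simp [hqp] at hq

/-! ## Rewrite steps -/

variable {R R' Q : Set (Rule L)}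

/-- A contraction at the root. -/
def RootStep (R : Set (Rule L)) (s t : L.Term ℕ) : Prop :=
  ∃ ρ ∈ R, ∃ θ : ℕ → L.Term ℕ, s = ρ.lhs.subst θ ∧ t = ρ.rhs.subst θ

theorem RootStep.mono (h : R ⊆ R') {s t : L.Term ℕ} : RootStep R s t → RootStep R' s t :=
  fun ⟨ρ, hρ, H⟩ => ⟨ρ, h hρ, H⟩

theorem Step.root {ρ : Rule L} (hρ : ρ ∈ R) {θ : ℕ → L.Term ℕ} (hθ : IsSubst θ) :
    Step R (ρ.lhs.subst θ) (ρ.rhs.subst θ) :=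
  ⟨ρ, hρ, [], θ, hθ, by simp, by simp⟩

theorem Step.arg {n : ℕ} {f : L.Functions n} {ts : Fin n → L.Term ℕ} (i : Fin n) {t : L.Term ℕ}
    (h : Step R (ts i) t) : Step R (.func f ts) (.func f (Function.update ts i t)) := by
  obtain ⟨ρ, hρ, p, θ, hθ, h₁, rfl⟩ := h
  exact ⟨ρ, hρ, i.val :: p, θ, hθ, by rw [subtermAt_func_fin, h₁], by rw [replaceAt_func]⟩

theorem Step.mono (h : R ⊆ R') {s t : L.Term ℕ} : Step R s t → Step R' s t :=
  fun ⟨ρ, hρ, H⟩ => ⟨ρ, h hρ, H⟩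

theorem Steps.mono (h : R ⊆ R') {s t : L.Term ℕ} : Steps R s t → Steps R' s t :=
  fun hst => Relation.ReflTransGen.mono (fun _ _ => Step.mono h) _ _ hst

theorem Steps.rfl {s : L.Term ℕ} : Steps R s s := Relation.ReflTransGen.refl

theorem Step.steps {s t : L.Term ℕ} (h : Step R s t) : Steps R s t := Relation.ReflTransGen.single h

theorem Step.cases {s t : L.Term ℕ} (h : Step R s t) :
    RootStep R s t ∨ ∃ (n : ℕ) (f : L.Functions n) (ts : Fin n → L.Term ℕ) (i : Fin n)
      (t' : L.Term ℕ), s = .func f ts ∧ Step R (ts i) t' ∧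
        t = .func f (Function.update ts i t') := by
  obtain ⟨ρ, hρ, p, θ, hθ, h₁, rfl⟩ := h
  cases p with
  | nil =>
    rw [subtermAt_nil, Option.some.injEq] at h₁
    exact .inl ⟨ρ, hρ, θ, h₁, by simp⟩
  | cons i p =>
    cases s with
    | var x => simp at h₁
    | func f ts =>
      obtain ⟨j, rfl, hj⟩ := exists_of_subtermAt_func_cons h₁
      exact .inr ⟨_, f, ts, j, _, rfl, ⟨ρ, hρ, p, θ, hθ, hj, rfl⟩, replaceAt_func ..⟩

theorem Step.func_cases {n : ℕ} {f : L.Functions n} {ts : Fin n → L.Term ℕ} {t : L.Term ℕ}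
    (h : Step R (.func f ts) t) : RootStep R (.func f ts) t ∨
      ∃ i t', Step R (ts i) t' ∧ t = .func f (Function.update ts i t') := by
  obtain h | ⟨n', f', ts', i, t', e, h', rfl⟩ := h.cases
  · exact .inl h
  · cases e
    exact .inr ⟨i, t', h', rfl⟩

theorem Step.var_cases {x : ℕ} {t : L.Term ℕ} (h : Step R (.var x) t) :
    RootStep R (.var x) t := by
  obtain h | ⟨n', f', ts', i, t', e, -⟩ := h.cases
  · exact h
  · cases e

theorem Step.induct {motive : L.Term ℕ → L.Term ℕ → Prop}
    (root : ∀ s t, RootStep R s t → motive s t)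
    (arg : ∀ (n : ℕ) (f : L.Functions n) (ts : Fin n → L.Term ℕ) (i : Fin n) (t : L.Term ℕ),
      motive (ts i) t → motive (.func f ts) (.func f (Function.update ts i t)))
    {s t : L.Term ℕ} (h : Step R s t) : motive s t := by
  induction s generalizing t with
  | var x => exact root _ _ h.var_cases
  | func f ts ih =>
    obtain h | ⟨i, t', h', rfl⟩ := h.func_cases
    · exact root _ _ h
    · exact arg _ _ _ _ _ (ih i h')

theorem Steps.arg {n : ℕ} {f : L.Functions n} {ts : Fin n → L.Term ℕ} (i : Fin n) {t : L.Term ℕ}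
    (h : Steps R (ts i) t) : Steps R (.func f ts) (.func f (Function.update ts i t)) := by
  induction h with
  | refl => rw [Function.update_eq_self]; exact .refl
  | tail _ h₂ ih =>
    refine ih.tail ?_
    simpa using Step.arg (f := f) (ts := Function.update ts i _) i (by simpa using h₂)

/-- Rewriting is closed under contexts, so undoing contractions at the root undoes every step. -/
theorem reversible_of_rules
    (h : ∀ ρ ∈ R, ∀ θ : ℕ → L.Term ℕ, Steps R (ρ.rhs.subst θ) (ρ.lhs.subst θ)) : Reversible R := by
  intro s t hst
  refine Step.induct (motive := fun s t => Steps R t s) ?_ ?_ hst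
  · rintro s t ⟨ρ, hρ, θ, rfl, rfl⟩
    exact h ρ hρ θ
  · intro n f ts i t h
    simpa using Steps.arg (f := f) (ts := Function.update ts i t) i (t := ts i) (by simpa using h)

/-- The tool for all nonreachability claims: an invariant of single steps confines everything
reachable. -/
theorem Steps.closed {C : L.Term ℕ → Prop} (hC : ∀ s t, C s → Step R s t → C t) {s t : L.Term ℕ}
    (h : Steps R s t) (hs : C s) : C t := by
  induction h with
  | refl => exact hs
  | tail _ h₂ ih => exact hC _ _ ih h₂

/-! ## Termination -/

theorem noInfiniteChain_of_measure {α : Type*} {r : α → α → Prop} (μ : α → ℕ)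
    (h : ∀ a b, r a b → μ b < μ a) : NoInfiniteChain r := by
  rintro ⟨a, ha⟩
  have key : ∀ n, μ (a n) + n ≤ μ (a 0) := by
    intro n
    induction n with
    | zero => simp
    | succ n ih =>
      have := h _ _ (ha n)
      omega
  have := key (μ (a 0) + 1)
  omega

theorem terminatingRel_of_measure (μ : L.Term ℕ → ℕ) (hR : ∀ s t, Step R s t → μ t < μ s)
    (hQ : ∀ s t, Step Q s t → μ t ≤ μ s) : TerminatingRel R Q := by
  refine noInfiniteChain_of_measure μ ?_
  rintro a c ⟨b, h₁, h₂⟩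
  refine lt_of_le_of_lt ?_ (hR _ _ h₁)
  exact Steps.closed (C := fun t => μ t ≤ μ b) (fun s t hs h => (hQ _ _ h).trans hs) h₂ le_rfl

/-- Alternating between the two terms gives the chain. This keeps rules out of `S`, and, applied to
the composite relation, out of `P₀`; the two terms may coincide. -/
theorem not_noInfiniteChain_of_cycle {α : Type*} {r : α → α → Prop} {s t : α} (h₁ : r s t)
    (h₂ : r t s) : ¬ NoInfiniteChain r :=
  fun H => H ⟨fun n => if Even n then s else t, fun n => by
    by_cases hn : Even n <;> simp [hn, Nat.even_add_one, h₁, h₂]⟩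

theorem steps_empty {s t : L.Term ℕ} (h : Steps (∅ : Set (Rule L)) s t) : s = t :=
  Steps.closed (C := fun t => s = t) (fun _ _ _ ⟨_, h, _⟩ => h.elim) h rfl

theorem Terminating.rel_empty (h : Terminating R) : TerminatingRel R ∅ := by
  rintro ⟨a, ha⟩
  refine h ⟨a, fun n => ?_⟩
  obtain ⟨b, h₁, h₂⟩ := ha n
  rwa [← steps_empty h₂]

theorem TerminatingRel.terminating (h : TerminatingRel R Q) : Terminating R := by
  rintro ⟨a, ha⟩
  exact h ⟨a, fun n => ⟨_, ha n, .refl⟩⟩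

/-! ## Parallel steps -/

/-- A parallel step such that the contracta contain only variables from `X`. -/
def ParStepIn (R : Set (Rule L)) (X : Set ℕ) (s t : L.Term ℕ) : Prop :=
  ∃ V, ParStepAt R V s t ∧ varsAt V t ⊆ X

theorem parStepAt_empty (s : L.Term ℕ) : ParStepAt R ∅ s s :=
  ⟨by simp, fun _ => ⟨s, s⟩, fun _ => .var, by simp, by simp⟩

theorem ParStep.refl (s : L.Term ℕ) : ParStep R s s := ⟨∅, parStepAt_empty s⟩

theorem Step.parStep {s t : L.Term ℕ} (h : Step R s t) : ParStep R s t := by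
  obtain ⟨ρ, hρ, p, θ, hθ, h₁, rfl⟩ := h
  refine ⟨{p}, by simp, fun _ => ρ, fun _ => θ, ?_, ?_⟩
  · simp only [Finset.mem_singleton]
    rintro q rfl
    exact ⟨hρ, hθ, h₁⟩
  · rw [replaceOn_singleton]

theorem StepEq.parStep {s t : L.Term ℕ} (h : StepEq R s t) : ParStep R s t := by
  cases h with
  | refl => exact .refl s
  | single h => exact h.parStep

theorem ParStepAt.root_of_mem {V : Finset Pos} {s t : L.Term ℕ} (h : ParStepAt R V s t)
    (hV : [] ∈ V) : RootStep R s t := by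
  obtain ⟨-, ρ, θ, h₁, rfl⟩ := h
  obtain ⟨h₂, -, h₃⟩ := h₁ [] hV
  rw [subtermAt_nil, Option.some.injEq] at h₃
  exact ⟨ρ [], h₂, θ [], h₃, replacePar_of_nil (by simp [hV])⟩

theorem varFinset_subset_varsAt {V : Finset Pos} (hV : [] ∈ V) (t : L.Term ℕ) :
    (t.varFinset : Set ℕ) ⊆ varsAt V t :=
  fun _ hx => ⟨[], hV, t, by simp, hx⟩

theorem ParStepIn.mono {X : Set ℕ} (h : R ⊆ R') {s t : L.Term ℕ} :
    ParStepIn R X s t → ParStepIn R' X s t :=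
  fun ⟨V, ⟨h₁, ρ, θ, h₂, h₃⟩, hX⟩ =>
    ⟨V, ⟨h₁, ρ, θ, fun p hp => ⟨h (h₂ p hp).1, (h₂ p hp).2⟩, h₃⟩, hX⟩

/-- If the root is contracted, the whole result is a contractum, so all its variables lie in `X`.
Otherwise the contracted positions split by their first index into parallel steps of the arguments,
each inheriting the bound `X`. -/
theorem ParStepIn.func_cases {X : Set ℕ} {n : ℕ} {f : L.Functions n} {ts : Fin n → L.Term ℕ}
    {t : L.Term ℕ} (h : ParStepIn R X (.func f ts) t) :
    (RootStep R (.func f ts) t ∧ (t.varFinset : Set ℕ) ⊆ X) ∨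
      ∃ ts', t = .func f ts' ∧ ∀ i, ParStepIn R X (ts i) (ts' i) := by
  obtain ⟨V, h, hX⟩ := h
  by_cases hV : [] ∈ V
  · exact .inl ⟨h.root_of_mem hV, (varFinset_subset_varsAt hV t).trans hX⟩
  right
  obtain ⟨hpar, ρ, θ, h₁, rfl⟩ := h
  rw [replaceOn, replacePar_func (by simp [hV])] at hX ⊢
  refine ⟨_, rfl, fun i => ?_⟩
  -- The positions of `V` below argument `i`, with the leading index removed.
  let V' : Finset Pos := V.preimage (List.cons i.val) (List.cons_injective.injOn)
  have hV' : ∀ p, p ∈ V' ↔ i.val :: p ∈ V := by simp [V']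
  refine ⟨V', ⟨?_, fun p => ρ (i.val :: p), fun p => θ (i.val :: p), ?_, ?_⟩, ?_⟩
  · intro p hp q hq hpq
    have := hpar (show (i.val :: p) ∈ (V : Set Pos) by simpa [hV'] using hp)
      (show (i.val :: q) ∈ (V : Set Pos) by simpa [hV'] using hq) (by simpa using hpq)
    simpa [Parallel, List.cons_prefix_cons] using this
  · intro p hp
    obtain ⟨h₂, h₃, h₄⟩ := h₁ _ ((hV' p).1 hp)
    exact ⟨h₂, h₃, by rw [← h₄, subtermAt_func_fin]⟩
  · simp only [replaceOn, hV']
  · rintro x ⟨p, hp, u, hu, hx⟩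
    exact hX ⟨i.val :: p, (hV' p).1 hp, u, by rw [subtermAt_func_fin, hu], hx⟩

theorem ParStepIn.var_cases {X : Set ℕ} {x : ℕ} {t : L.Term ℕ} (h : ParStepIn R X (.var x) t) :
    RootStep R (.var x) t ∨ t = .var x := by
  obtain ⟨V, h, -⟩ := h
  by_cases hV : [] ∈ V
  · exact .inl (h.root_of_mem hV)
  obtain ⟨-, ρ, θ, h₁, rfl⟩ := h
  right
  have : V = ∅ := by
    refine Finset.eq_empty_of_forall_notMem fun p hp => ?_
    obtain ⟨-, -, h₂⟩ := h₁ p hp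
    cases p with
    | nil => exact hV hp
    | cons i p => simp at h₂
  simp [this]

/-! ## Critical pairs -/

/-- The pairs `⟨u, v⟩` that arise by overlapping a rule of `R` on a nonvariable position of a rule
of `Q`, with respect to arbitrary unifiers. -/
theorem overlap_of_mem_CP {u v : L.Term ℕ} (h : (u, v) ∈ CP R Q) :
    ∃ s c, RootStep R s c ∧ ∃ ρ ∈ Q, ∃ (p : Pos) (w : L.Term ℕ) (θ : ℕ → L.Term ℕ),
      subtermAt ρ.lhs p = some w ∧ ¬ IsVar w ∧ s = w.subst θ ∧
      u = replaceAt (ρ.lhs.subst θ) p c ∧ v = ρ.rhs.subst θ := by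
  obtain ⟨ρ₁, h₁, ρ₂, h₂, τ₁, τ₂, ⟨π₁, e₁, e₁'⟩, ⟨π₂, e₂, e₂'⟩, -, p, w, σ, hw, hv, -, hσ, hc⟩ := h
  rw [Prod.mk.injEq] at hc
  obtain ⟨rfl, rfl⟩ := hc
  have hu := hσ.2.1 (τ₁.lhs, w) rfl
  rw [e₂, subtermAt_relabel, Option.map_eq_some_iff] at hw
  obtain ⟨w', hw', rfl⟩ := hw
  rw [e₁, e₁', e₂, e₂'] at *
  simp only [subst_relabel] at hu
  refine ⟨w'.subst (σ ∘ π₂), ρ₁.rhs.subst (σ ∘ π₁), ⟨ρ₁, h₁, _, hu.symm, rfl⟩, ρ₂, h₂, p, w',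
    σ ∘ π₂, hw', fun h => hv (isVar_relabel h), rfl, ?_, by rw [subst_relabel]⟩
  rw [replaceAt_subst (w := w'.relabel π₂), subst_relabel, subst_relabel]
  rw [subtermAt_relabel, hw', Option.map_some]

/-- Composing the unifier with each renaming gives instances of the original rules, so the variants
and the disjointness of their variables disappear. The set `X` is dropped: it is not needed where
overlaps are classified. -/
theorem overlap_of_mem_PCPIn {u v : L.Term ℕ} {X : Set ℕ} (h : (u, v, X) ∈ PCPIn R Q) :
    ∃ ρ ∈ Q, ∃ (U : Finset Pos) (w c : Pos → L.Term ℕ) (θ : ℕ → L.Term ℕ), U.Nonempty ∧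
      [] ∉ U ∧
      (∀ p ∈ U, subtermAt ρ.lhs p = some (w p) ∧ ¬ IsVar (w p) ∧
        RootStep R ((w p).subst θ) (c p)) ∧
      u = replaceOn (ρ.lhs.subst θ) U c ∧ v = ρ.rhs.subst θ := by
  obtain ⟨ρ₀, h₀, τ₀, ⟨π₀, e₀, e₀'⟩, U, τ, w, σ, hU, hU', -, hτ, -, hσ, hc⟩ := h
  simp only [Prod.mk.injEq] at hc
  obtain ⟨rfl, rfl, -⟩ := hc
  have hpos : ∀ p ∈ U, (subtermAt τ₀.lhs p).isSome := fun p hp => by simp [(hτ p hp).2.2.1]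
  have hex : ∀ p, ∃ w', p ∈ U → subtermAt ρ₀.lhs p = some w' ∧ w p = w'.relabel π₀ := by
    intro p
    by_cases hp : p ∈ U
    · have := (hτ p hp).2.2.1
      rw [e₀, subtermAt_relabel, Option.map_eq_some_iff] at this
      obtain ⟨w', h₁, h₂⟩ := this
      exact ⟨w', fun _ => ⟨h₁, h₂.symm⟩⟩
    -- An arbitrary value, since `w'` matters only on `U`.
    · exact ⟨.var 0, fun h => absurd h hp⟩
  choose w' hw' using hex
  refine ⟨ρ₀, h₀, U, w', fun p => (τ p).rhs.subst σ, σ ∘ π₀, hU, hU', fun p hp => ?_, ?_, ?_⟩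
  · obtain ⟨⟨ρ, hρ, π, e, e'⟩, -, -, hv⟩ := hτ p hp
    obtain ⟨h₁, h₂⟩ := hw' p hp
    refine ⟨h₁, fun h => hv (h₂ ▸ isVar_relabel h), ρ, hρ, σ ∘ π, ?_,
      by simp only [e', subst_relabel]⟩
    have := hσ.2.1 _ ⟨p, hp, rfl⟩
    simp only [e, h₂, subst_relabel] at this
    exact this.symm
  · rw [replaceOn_subst hpos, e₀, subst_relabel]
  · rw [e₀', subst_relabel]

/-- A unifier that absorbs `σ` serves as its own factor `δ`. -/
theorem isMGU_of_absorbed {E : Set (L.Term ℕ × L.Term ℕ)} {σ : ℕ → L.Term ℕ} (hσ : IsSubst σ)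
    (hu : IsUnifier E σ) (h : ∀ τ, IsUnifier E τ → ∀ x, τ x = (σ x).subst τ) : IsMGU E σ :=
  ⟨hσ, hu, fun τ hτ hE => ⟨τ, hτ, h τ hE⟩⟩

theorem isVariant_refl (ρ : Rule L) : ρ.IsVariant ρ :=
  ⟨Equiv.refl ℕ, by simp, by simp⟩

/-! ## Relations between the criteria -/

theorem steps_split {s t : L.Term ℕ} (h : Steps R s t) :
    s = t ∨ Relation.Comp (Step R) (Steps (R ∪ ∅)) s t := by
  rw [Set.union_empty]
  obtain rfl | ⟨c, h₁, h₂⟩ := Relation.ReflTransGen.cases_head h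
  · exact .inl rfl
  · exact .inr ⟨c, h₁, h₂⟩

/-- An empty reduction from `v` gives the first alternative of the relative criterion; a nonempty
one exposes its first step, which the second alternative requires to be an `R`-step. -/
theorem comp_flip_split {r : L.Term ℕ → L.Term ℕ → Prop} {R' : Set (Rule L)} (hR : R ⊆ R')
    {u v : L.Term ℕ} (h : Relation.Comp (Steps R) (Relation.Comp r (flip (Steps R))) u v) :
    (Relation.Comp (Steps R') r ⊔ Relation.Comp (Steps R')
      (Relation.Comp r (Relation.Comp (flip (Steps R')) (flip (Step R))))) u v := by
  obtain ⟨a, h₁, b, h₂, h₃⟩ := h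
  obtain rfl | ⟨c, h₄, h₅⟩ := Relation.ReflTransGen.cases_head h₃
  · exact .inl ⟨a, h₁.mono hR, h₂⟩
  · exact .inr ⟨a, h₁.mono hR, b, h₂, c, Steps.mono hR h₅, h₄⟩

theorem LinearConditions.toRT {S P : Set (Rule L)} (h : LinearConditions S P) :
    LinearRTConditions S P ∅ where
  linear := h.linear
  reversible := h.reversible
  subset := Set.empty_subset _
  terminating := h.terminating.rel_empty
  cp_S_S := by simpa using h.cp_S_S
  cp_P_S := by
    intro c hc
    obtain ⟨a, h₁, b, h₂, h₃⟩ := h.cp_P_S c hc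
    have h₃' : flip (Steps (S ∪ ∅)) b c.2 := by simpa using h₃
    obtain h₁ | ⟨d, h₁, h₁'⟩ := steps_split h₁
    · exact .inl ⟨b, h₁ ▸ h₂, h₃'⟩
    · exact .inr ⟨d, h₁, a, h₁', b, h₂, h₃'⟩
  cp_S_P := fun c hc => comp_flip_split Set.subset_union_left (h.cp_S_P c hc)

theorem PCPConditions.toRT {S P : Set (Rule L)} (h : PCPConditions S P) :
    PCPRTConditions S P ∅ where
  leftLinear := h.leftLinear
  reversible := h.reversible
  subset := Set.empty_subset _
  terminating := h.terminating.rel_empty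
  cp_S_S := by simpa using h.cp_S_S
  pcp_P_S := by
    intro u v X hX
    obtain ⟨V, a, b, h₁, h₂, h₃, h₄⟩ := h.pcp_P_S u v X hX
    exact ⟨V, a, b, steps_split h₁, h₂, by simpa using h₃, h₄⟩
  cp_S_P := fun c hc => comp_flip_split Set.subset_union_left (h.cp_S_P c hc)

theorem LinearNoRT.linearRT {R : Set (Rule L)} (h : LinearNoRT L R) : LinearRT L R :=
  let ⟨S, P, h₁, h₂⟩ := h
  ⟨S, P, ∅, h₁, h₂.toRT⟩

theorem PCPNoRT.pcpRT {R : Set (Rule L)} (h : PCPNoRT L R) : PCPRT L R :=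
  let ⟨S, P, h₁, h₂⟩ := h
  ⟨S, P, ∅, h₁, h₂.toRT⟩

end Generic

end Rewriting

namespace Rewriting

/-! ### Root contractions under arbitrary substitutions. -/

section RootSteps

variable {L : FirstOrder.Language.{0, 0}} {R : Set (Rule L)}

theorem subst_congr_varFinset {t : L.Term ℕ} {σ τ : ℕ → L.Term ℕ}
    (h : ∀ x ∈ t.varFinset, σ x = τ x) : t.subst σ = t.subst τ := by
  induction t with
  | var x => exact h x (by simp [FirstOrder.Language.Term.varFinset])
  | func f ts ih =>
    simp only [FirstOrder.Language.Term.subst]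
    congr 1
    funext i
    refine ih i fun x hx => h x ?_
    simp only [FirstOrder.Language.Term.varFinset, Finset.mem_biUnion]
    exact ⟨i, by simp, hx⟩

/-- Only the values of `θ` on the variables of the rule matter, so it may be made the identity
elsewhere, which gives it finite domain. -/
theorem RootStep.step {s t : L.Term ℕ} (h : RootStep R s t) : Step R s t := by
  obtain ⟨ρ, hρ, θ, rfl, rfl⟩ := h
  have key : ∀ x ∈ ρ.vars, θ x = if x ∈ ρ.vars then θ x else .var x := fun x hx => by simp [hx]
  rw [subst_congr_varFinset fun x hx => key x (Finset.mem_union_left _ hx),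
    subst_congr_varFinset fun x hx => key x (Finset.mem_union_right _ hx)]
  refine Step.root hρ ((ρ.vars.finite_toSet).subset fun x hx => ?_)
  by_contra hx'
  simp only [Finset.mem_coe] at hx'
  simp [hx'] at hx

theorem rootStep_of_mem {ρ : Rule L} (hρ : ρ ∈ R) (θ : ℕ → L.Term ℕ) :
    RootStep R (ρ.lhs.subst θ) (ρ.rhs.subst θ) := ⟨ρ, hρ, θ, rfl, rfl⟩

@[simp] theorem isVar_var (n : ℕ) : IsVar (.var n : L.Term ℕ) := ⟨n, rfl⟩

@[simp] theorem subst_var_eq (n : ℕ) (θ : ℕ → L.Term ℕ) :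
    (FirstOrder.Language.Term.var n : L.Term ℕ).subst θ = θ n := rfl

@[simp] theorem relabel_var_eq (n : ℕ) (π : ℕ → ℕ) :
    (FirstOrder.Language.Term.var n : L.Term ℕ).relabel π = .var (π n) := rfl

@[simp] theorem varFinset_var_eq (n : ℕ) :
    (FirstOrder.Language.Term.var n : L.Term ℕ).varFinset = {n} := rfl

@[simp] theorem subtermAt_var_eq (n : ℕ) (p : Pos) (w : L.Term ℕ) :
    subtermAt (.var n : L.Term ℕ) p = some w ↔ p = [] ∧ w = .var n := by
  cases p <;> simp [eq_comm]

@[simp] theorem var_eq_var (m n : ℕ) :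
    (FirstOrder.Language.Term.var m : L.Term ℕ) = .var n ↔ m = n :=
  ⟨fun h => by cases h; rfl, fun h => h ▸ rfl⟩

/-- A substitution given by its values at the first three variables. -/
def assign (a b c : L.Term ℕ) : ℕ → L.Term ℕ
  | 0 => a
  | 1 => b
  | 2 => c
  | n => .var n

@[simp] theorem assign_zero (a b c : L.Term ℕ) : assign a b c 0 = a := rfl
@[simp] theorem assign_one (a b c : L.Term ℕ) : assign a b c 1 = b := rfl
@[simp] theorem assign_two (a b c : L.Term ℕ) : assign a b c 2 = c := rfl

end RootSteps

namespace Arith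

open FirstOrder.Language (Term)

/-! ## Terms over the arithmetical signature -/

theorem func_zero (ts : Fin 0 → arith.Term ℕ) :
    Term.func (L := arith) ArithFn.zero ts = O := by
  rw [O]; congr 1; exact Subsingleton.elim _ _

theorem func_succ (ts : Fin 1 → arith.Term ℕ) :
    Term.func (L := arith) ArithFn.succ ts = s (ts 0) := by
  rw [s]; congr 1; funext i; fin_cases i; rfl

theorem func_dbl (ts : Fin 1 → arith.Term ℕ) :
    Term.func (L := arith) ArithFn.dbl ts = dbl (ts 0) := by
  rw [dbl]; congr 1; funext i; fin_cases i; rfl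

theorem func_plus (ts : Fin 2 → arith.Term ℕ) :
    Term.func (L := arith) ArithFn.plus ts = plus (ts 0) (ts 1) := by
  rw [plus]; congr 1; funext i; fin_cases i <;> rfl

variable (a b c d : arith.Term ℕ) (n : ℕ)

@[simp] theorem plus_inj : plus a b = plus c d ↔ a = c ∧ b = d := by
  refine ⟨fun h => ?_, fun ⟨h, h'⟩ => h ▸ h' ▸ rfl⟩
  have h := func_inj (L := arith) h
  exact ⟨congrFun h 0, congrFun h 1⟩

@[simp] theorem s_inj : s a = s b ↔ a = b := by
  refine ⟨fun h => ?_, fun h => h ▸ rfl⟩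
  exact congrFun (func_inj (L := arith) h) 0

@[simp] theorem dbl_inj : dbl a = dbl b ↔ a = b := by
  refine ⟨fun h => ?_, fun h => h ▸ rfl⟩
  exact congrFun (func_inj (L := arith) h) 0

@[simp] theorem plus_ne_s : plus a b ≠ s c := by rintro ⟨⟩
@[simp] theorem s_ne_plus : s c ≠ plus a b := by rintro ⟨⟩
@[simp] theorem plus_ne_dbl : plus a b ≠ dbl c := by rintro ⟨⟩
@[simp] theorem dbl_ne_plus : dbl c ≠ plus a b := by rintro ⟨⟩
@[simp] theorem plus_ne_O : plus a b ≠ O := by rintro ⟨⟩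
@[simp] theorem O_ne_plus : O ≠ plus a b := by rintro ⟨⟩
@[simp] theorem s_ne_dbl : s a ≠ dbl b := by rintro ⟨⟩
@[simp] theorem dbl_ne_s : dbl a ≠ s b := by rintro ⟨⟩
@[simp] theorem s_ne_O : s a ≠ O := by rintro ⟨⟩
@[simp] theorem O_ne_s : O ≠ s a := by rintro ⟨⟩
@[simp] theorem dbl_ne_O : dbl a ≠ O := by rintro ⟨⟩
@[simp] theorem O_ne_dbl : O ≠ dbl a := by rintro ⟨⟩
@[simp] theorem var_ne_plus : Term.var n ≠ plus a b := by rintro ⟨⟩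
@[simp] theorem var_ne_s : Term.var n ≠ s a := by rintro ⟨⟩
@[simp] theorem var_ne_dbl : Term.var n ≠ dbl a := by rintro ⟨⟩
@[simp] theorem var_ne_O : Term.var n ≠ O := by rintro ⟨⟩
@[simp] theorem plus_ne_var : plus a b ≠ Term.var n := by rintro ⟨⟩
@[simp] theorem s_ne_var : s a ≠ Term.var n := by rintro ⟨⟩
@[simp] theorem dbl_ne_var : dbl a ≠ Term.var n := by rintro ⟨⟩
@[simp] theorem O_ne_var : O ≠ Term.var n := by rintro ⟨⟩

@[simp] theorem not_isVar_plus : ¬ IsVar (plus a b) := by rintro ⟨_, ⟨⟩⟩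
@[simp] theorem not_isVar_s : ¬ IsVar (s a) := by rintro ⟨_, ⟨⟩⟩
@[simp] theorem not_isVar_dbl : ¬ IsVar (dbl a) := by rintro ⟨_, ⟨⟩⟩
@[simp] theorem not_isVar_O : ¬ IsVar O := by rintro ⟨_, ⟨⟩⟩
@[simp] theorem isVar_x : IsVar x := ⟨0, rfl⟩
@[simp] theorem isVar_y : IsVar y := ⟨1, rfl⟩
@[simp] theorem isVar_z : IsVar z := ⟨2, rfl⟩

variable (θ : ℕ → arith.Term ℕ) (π : ℕ → ℕ)

@[simp] theorem subst_plus : (plus a b).subst θ = plus (a.subst θ) (b.subst θ) := func_plus _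
@[simp] theorem subst_s : (s a).subst θ = s (a.subst θ) := func_succ _
@[simp] theorem subst_dbl : (dbl a).subst θ = dbl (a.subst θ) := func_dbl _
@[simp] theorem subst_O : O.subst θ = O := func_zero _
@[simp] theorem subst_x : x.subst θ = θ 0 := rfl
@[simp] theorem subst_y : y.subst θ = θ 1 := rfl
@[simp] theorem subst_z : z.subst θ = θ 2 := rfl

@[simp] theorem relabel_plus : (plus a b).relabel π = plus (a.relabel π) (b.relabel π) :=
  func_plus _
@[simp] theorem relabel_s : (s a).relabel π = s (a.relabel π) := func_succ _
@[simp] theorem relabel_dbl : (dbl a).relabel π = dbl (a.relabel π) := func_dbl _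
@[simp] theorem relabel_O : O.relabel π = O := func_zero _
@[simp] theorem relabel_x : x.relabel π = .var (π 0) := rfl
@[simp] theorem relabel_y : y.relabel π = .var (π 1) := rfl
@[simp] theorem relabel_z : z.relabel π = .var (π 2) := rfl

@[simp] theorem varFinset_plus : (plus a b).varFinset = a.varFinset ∪ b.varFinset := by
  ext n; simp [plus, Term.varFinset, Fin.exists_fin_two]
@[simp] theorem varFinset_s : (s a).varFinset = a.varFinset := by
  ext n; simp [s, Term.varFinset]
@[simp] theorem varFinset_dbl : (dbl a).varFinset = a.varFinset := by
  ext n; simp [dbl, Term.varFinset]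
@[simp] theorem varFinset_O : O.varFinset = ∅ := by
  ext n; simp [O, Term.varFinset]
@[simp] theorem varFinset_x : x.varFinset = {0} := rfl
@[simp] theorem varFinset_y : y.varFinset = {1} := rfl
@[simp] theorem varFinset_z : z.varFinset = {2} := rfl

variable (p : Pos) (w : arith.Term ℕ)

theorem subtermAt_plus_zero : subtermAt (plus a b) (0 :: p) = subtermAt a p :=
  subtermAt_func_fin (L := arith) ArithFn.plus ![a, b] 0 p
theorem subtermAt_plus_one : subtermAt (plus a b) (1 :: p) = subtermAt b p :=
  subtermAt_func_fin (L := arith) ArithFn.plus ![a, b] 1 p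
theorem subtermAt_plus_add_two (i : ℕ) : subtermAt (plus a b) ((i + 2) :: p) = none :=
  dif_neg (by omega)
theorem subtermAt_s_zero : subtermAt (s a) (0 :: p) = subtermAt a p :=
  subtermAt_func_fin (L := arith) ArithFn.succ ![a] 0 p
theorem subtermAt_s_add_one (i : ℕ) : subtermAt (s a) ((i + 1) :: p) = none :=
  dif_neg (by omega)
theorem subtermAt_dbl_zero : subtermAt (dbl a) (0 :: p) = subtermAt a p :=
  subtermAt_func_fin (L := arith) ArithFn.dbl ![a] 0 p
theorem subtermAt_dbl_add_one (i : ℕ) : subtermAt (dbl a) ((i + 1) :: p) = none :=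
  dif_neg (by omega)
theorem subtermAt_O_cons (i : ℕ) : subtermAt O (i :: p) = none :=
  dif_neg (by omega)

@[simp] theorem subtermAt_plus : subtermAt (plus a b) p = some w ↔
    (p = [] ∧ w = plus a b) ∨ (∃ q, p = 0 :: q ∧ subtermAt a q = some w) ∨
      ∃ q, p = 1 :: q ∧ subtermAt b q = some w := by
  match p with
  | [] => simpa using eq_comm
  | 0 :: p => simp [subtermAt_plus_zero]
  | 1 :: p => simp [subtermAt_plus_one]
  | (i + 2) :: p => simp [subtermAt_plus_add_two]

@[simp] theorem subtermAt_s : subtermAt (s a) p = some w ↔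
    (p = [] ∧ w = s a) ∨ ∃ q, p = 0 :: q ∧ subtermAt a q = some w := by
  match p with
  | [] => simpa using eq_comm
  | 0 :: p => simp [subtermAt_s_zero]
  | (i + 1) :: p => simp [subtermAt_s_add_one]

@[simp] theorem subtermAt_dbl : subtermAt (dbl a) p = some w ↔
    (p = [] ∧ w = dbl a) ∨ ∃ q, p = 0 :: q ∧ subtermAt a q = some w := by
  match p with
  | [] => simpa using eq_comm
  | 0 :: p => simp [subtermAt_dbl_zero]
  | (i + 1) :: p => simp [subtermAt_dbl_add_one]

@[simp] theorem subtermAt_O : subtermAt O p = some w ↔ p = [] ∧ w = O := by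
  cases p with
  | nil => simp [eq_comm]
  | cons i p => simp [subtermAt_O_cons]

@[simp] theorem subtermAt_x : subtermAt x p = some w ↔ p = [] ∧ w = x := subtermAt_var_eq ..
@[simp] theorem subtermAt_y : subtermAt y p = some w ↔ p = [] ∧ w = y := subtermAt_var_eq ..
@[simp] theorem subtermAt_z : subtermAt z p = some w ↔ p = [] ∧ w = z := subtermAt_var_eq ..

@[simp] theorem replaceAt_plus_left :
    replaceAt (plus a b) (0 :: p) w = plus (replaceAt a p w) b := by
  exact (replaceAt_func (L := arith) ArithFn.plus ![a, b] 0 p w).trans (func_plus _)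

@[simp] theorem replaceAt_plus_right :
    replaceAt (plus a b) (1 :: p) w = plus a (replaceAt b p w) := by
  exact (replaceAt_func (L := arith) ArithFn.plus ![a, b] 1 p w).trans (func_plus _)

/-! ## Rewriting arithmetical terms -/

section Steps

variable {R : Set (Rule arith)} {a a' b b' t : arith.Term ℕ}

theorem step_plus_left (h : Step R a a') : Step R (plus a b) (plus a' b) := by
  have := Step.arg (f := (ArithFn.plus : arith.Functions 2)) (ts := ![a, b]) 0 h
  rwa [func_plus (Function.update _ _ _)] at this

theorem step_plus_right (h : Step R b b') : Step R (plus a b) (plus a b') := by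
  have := Step.arg (f := (ArithFn.plus : arith.Functions 2)) (ts := ![a, b]) 1 h
  rwa [func_plus (Function.update _ _ _)] at this

theorem step_s (h : Step R a a') : Step R (s a) (s a') := by
  have := Step.arg (f := (ArithFn.succ : arith.Functions 1)) (ts := ![a]) 0 h
  rwa [func_succ (Function.update _ _ _)] at this

theorem steps_plus (h : Steps R a a') (h' : Steps R b b') : Steps R (plus a b) (plus a' b') :=
  (Relation.ReflTransGen.lift (fun t => plus t b) (fun _ _ => step_plus_left) _ _ h).trans
    (Relation.ReflTransGen.lift (fun t => plus a' t) (fun _ _ => step_plus_right) _ _ h')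

theorem steps_s (h : Steps R a a') : Steps R (s a) (s a') :=
  Relation.ReflTransGen.lift s (fun _ _ => step_s) _ _ h

theorem step_plus_cases (h : Step R (plus a b) t) : RootStep R (plus a b) t ∨
    (∃ a', Step R a a' ∧ t = plus a' b) ∨ ∃ b', Step R b b' ∧ t = plus a b' := by
  obtain h | ⟨i, t', h', rfl⟩ := Step.func_cases h
  · exact .inl h
  · right
    rw [func_plus]
    fin_cases i
    · exact .inl ⟨t', h', rfl⟩
    · exact .inr ⟨t', h', rfl⟩

theorem step_s_cases (h : Step R (s a) t) : RootStep R (s a) t ∨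
    ∃ a', Step R a a' ∧ t = s a' := by
  obtain h | ⟨i, t', h', rfl⟩ := Step.func_cases h
  · exact .inl h
  · right
    rw [func_succ]
    fin_cases i
    exact ⟨t', h', rfl⟩

theorem step_induct {motive : arith.Term ℕ → arith.Term ℕ → Prop}
    (root : ∀ a b, RootStep R a b → motive a b)
    (succ : ∀ a a', motive a a' → motive (s a) (s a'))
    (double : ∀ a a', motive a a' → motive (dbl a) (dbl a'))
    (left : ∀ a a' b, motive a a' → motive (plus a b) (plus a' b))
    (right : ∀ a b b', motive b b' → motive (plus a b) (plus a b'))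
    (h : Step R a t) : motive a t := by
  refine Step.induct root (fun n f ts i t h => ?_) h
  cases f with
  | zero => exact i.elim0
  | succ =>
    fin_cases i
    rw [func_succ, func_succ]
    exact succ _ _ h
  | dbl =>
    fin_cases i
    rw [func_dbl, func_dbl]
    exact double _ _ h
  | plus =>
    fin_cases i
    · rw [func_plus, func_plus]
      exact left _ _ _ h
    · rw [func_plus, func_plus]
      exact right _ _ _ h

theorem step_add₁ (h : add₁ ∈ R) (b : arith.Term ℕ) : Step R (plus O b) b := by
  simpa [add₁] using (rootStep_of_mem h (assign O b O)).step

theorem step_add₂ (h : add₂ ∈ R) (a b : arith.Term ℕ) :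
    Step R (plus (s a) b) (s (plus a b)) := by
  simpa [add₂] using (rootStep_of_mem h (assign a b O)).step

theorem step_add₃ (h : add₃ ∈ R) (a : arith.Term ℕ) : Step R (plus a O) a := by
  simpa [add₃] using (rootStep_of_mem h (assign a O O)).step

theorem step_add₄ (h : add₄ ∈ R) (a b : arith.Term ℕ) :
    Step R (plus a (s b)) (s (plus a b)) := by
  simpa [add₄] using (rootStep_of_mem h (assign a b O)).step

theorem step_add₅ (h : add₅ ∈ R) (a b : arith.Term ℕ) :
    Step R (plus a (s b)) (plus (s a) b) := by
  simpa [add₅] using (rootStep_of_mem h (assign a b O)).step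

theorem step_commR (h : commR ∈ R) (a b : arith.Term ℕ) : Step R (plus a b) (plus b a) := by
  simpa [commR] using (rootStep_of_mem h (assign a b O)).step

theorem step_assocR (h : assocR ∈ R) (a b c : arith.Term ℕ) :
    Step R (plus (plus a b) c) (plus a (plus b c)) := by
  simpa [assocR] using (rootStep_of_mem h (assign a b c)).step

theorem step_double (h : double ∈ R) (a : arith.Term ℕ) : Step R (dbl a) (plus a a) := by
  simpa [double] using (rootStep_of_mem h (assign a O O)).step

theorem step_ss₁ (h : ss₁ ∈ R) (a : arith.Term ℕ) : Step R (s a) (s (s a)) := by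
  simpa [ss₁] using (rootStep_of_mem h (assign a O O)).step

theorem step_ss₂ (h : ss₂ ∈ R) (a : arith.Term ℕ) : Step R (s (s a)) (s a) := by
  simpa [ss₂] using (rootStep_of_mem h (assign a O O)).step

end Steps

/-! ## Termination of addition and doubling -/

/-- A weight that decreases in every step with the rules for addition, doubling, and `ss₂`. -/
def weight : arith.Term ℕ → ℕ
  | .var _ => 0
  | .func ArithFn.zero _ => 0
  | .func ArithFn.succ ts => weight (ts 0) + 1
  | .func ArithFn.dbl ts => 5 * weight (ts 0) + 2
  | .func ArithFn.plus ts => 2 * weight (ts 0) + 3 * weight (ts 1) + 1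

@[simp] theorem weight_O : weight O = 0 := rfl
@[simp] theorem weight_s : weight (s a) = weight a + 1 := rfl
@[simp] theorem weight_dbl : weight (dbl a) = 5 * weight a + 2 := rfl
@[simp] theorem weight_plus : weight (plus a b) = 2 * weight a + 3 * weight b + 1 := rfl

variable {R : Set (Rule arith)}

/-- Every symbol is interpreted by a strictly increasing linear polynomial. The unequal coefficients
of `plus` make `add₅` decrease, and `5 * n + 2` just exceeds the weight `5 * n + 1` of a doubled
argument. -/
theorem weight_lt (hR : R ⊆ {add₁, add₂, add₃, add₄, add₅, double, ss₂}) {a b : arith.Term ℕ}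
    (h : Step R a b) : weight b < weight a := by
  refine step_induct (motive := fun a b => weight b < weight a) ?_ ?_ ?_ ?_ ?_ h
  · rintro a b ⟨ρ, hρ, θ, rfl, rfl⟩
    rcases hR hρ with rfl | rfl | rfl | rfl | rfl | rfl | rfl <;>
      simp [add₁, add₂, add₃, add₄, add₅, double, ss₂] <;> omega
  all_goals
    intros
    simp only [weight_s, weight_dbl, weight_plus]
    omega

end Arith

end Rewriting

namespace Rewriting

/-! ### Joinability up to one reversible step. -/

section Joins

variable {L : FirstOrder.Language.{0, 0}} {R S P : Set (Rule L)}

theorem step_sym_symm {u v : L.Term ℕ} (h : Step (sym R) u v) : Step (sym R) v u := by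
  refine Step.induct (motive := fun u v => Step (sym R) v u) ?_ ?_ h
  · rintro u v ⟨ρ, hρ, θ, rfl, rfl⟩
    refine RootStep.step ⟨ρ.inv, ?_, θ, rfl, rfl⟩
    obtain h | ⟨τ, hτ, rfl⟩ := hρ
    · exact .inr ⟨ρ, h, rfl⟩
    · exact .inl hτ
  · intro n f ts i t h
    simpa using Step.arg (f := f) (ts := Function.update ts i t) i (t := ts i) (by simpa using h)

theorem stepEq_sym_symm {u v : L.Term ℕ} (h : StepEq (sym R) u v) : StepEq (sym R) v u := by
  cases h with
  | refl => exact .refl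
  | single h => exact .single (step_sym_symm h)

/-- Joinability by `S` up to one step with `P` or its inverse. -/
def JoinMod (S P : Set (Rule L)) (u v : L.Term ℕ) : Prop :=
  ∃ a b, Steps S u a ∧ Steps S v b ∧ StepEq (sym P) a b

theorem JoinMod.symm {u v : L.Term ℕ} (h : JoinMod S P u v) : JoinMod S P v u :=
  let ⟨a, b, h₁, h₂, h₃⟩ := h
  ⟨b, a, h₂, h₁, stepEq_sym_symm h₃⟩

theorem JoinMod.of_steps {u v a b : L.Term ℕ} (h₁ : Steps S u a) (h₂ : Steps S v b)
    (h : Step (sym P) a b) : JoinMod S P u v :=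
  ⟨a, b, h₁, h₂, .single h⟩

theorem JoinMod.of_common {u v a : L.Term ℕ} (h₁ : Steps S u a) (h₂ : Steps S v a) :
    JoinMod S P u v :=
  ⟨a, a, h₁, h₂, .refl⟩

theorem JoinMod.left {u v : L.Term ℕ} (h : JoinMod S P u v) : Relation.Comp (Steps S)
    (Relation.Comp (flip (StepEq (sym P))) (flip (Steps S))) u v :=
  let ⟨a, b, h₁, h₂, h₃⟩ := h
  ⟨a, h₁, b, stepEq_sym_symm h₃, h₂⟩

theorem JoinMod.right {u v : L.Term ℕ} (h : JoinMod S P u v) : Relation.Comp (Steps S)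
    (Relation.Comp (StepEq (sym P)) (flip (Steps S))) u v :=
  let ⟨a, b, h₁, h₂, h₃⟩ := h
  ⟨a, h₁, b, h₃, h₂⟩

theorem JoinMod.left_par {u v : L.Term ℕ} (h : JoinMod S P u v) : Relation.Comp (Steps S)
    (Relation.Comp (flip (ParStep (sym P))) (flip (Steps S))) u v :=
  let ⟨a, b, h₁, h₂, h₃⟩ := h
  ⟨a, h₁, b, (stepEq_sym_symm h₃).parStep, h₂⟩

theorem JoinMod.right_par {u v : L.Term ℕ} (h : JoinMod S P u v) : Relation.Comp (Steps S)
    (Relation.Comp (ParStep (sym P)) (flip (Steps S))) u v :=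
  let ⟨a, b, h₁, h₂, h₃⟩ := h
  ⟨a, h₁, b, h₃.parStep, h₂⟩

end Joins

namespace Arith

/-! ## Systems of rules for addition, modulo associativity and commutativity -/

/-- This covers the part `S` of all five arithmetical systems. One of `add₄` and `add₅` suffices,
because `add₅` followed by `add₂` has the effect of `add₄`. -/
structure IsAddition (S : Set (Rule arith)) : Prop where
  subset : S ⊆ {add₁, add₂, add₃, add₄, add₅, double}
  add₁ : add₁ ∈ S
  add₂ : add₂ ∈ S
  add₃ : add₃ ∈ S
  add₄_or_add₅ : add₄ ∈ S ∨ add₅ ∈ S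

structure IsAC (P : Set (Rule arith)) : Prop where
  subset : P ⊆ {commR, assocR, ss₁, ss₂}
  comm : commR ∈ P
  assoc : assocR ∈ P
  ss : ss₁ ∈ P ↔ ss₂ ∈ P

variable {S P P₀ : Set (Rule arith)} {a b c d t u v : arith.Term ℕ}

namespace IsAddition

variable (hS : IsAddition S)
include hS

theorem steps₁ (h : Steps S a b) : Steps S (plus O a) b :=
  .head (step_add₁ hS.add₁ a) h

theorem steps₂ (h : Steps S (s (plus a b)) c) : Steps S (plus (s a) b) c :=
  .head (step_add₂ hS.add₂ a b) h

theorem steps₃ (h : Steps S a b) : Steps S (plus a O) b :=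
  .head (step_add₃ hS.add₃ a) h

theorem steps₄ (h : Steps S (s (plus a b)) c) : Steps S (plus a (s b)) c := by
  obtain h' | h' := hS.add₄_or_add₅
  · exact .head (step_add₄ h' a b) h
  · exact .head (step_add₅ h' a b) (hS.steps₂ h)

/-- The fourth case treats `add₄` and `add₅` uniformly, by recording only that the contractum
reduces to `s (plus a b)`. -/
theorem rootStep_cases (h : RootStep S t c) :
    (∃ b, t = plus O b ∧ c = b) ∨
    (∃ a b, t = plus (s a) b ∧ c = s (plus a b)) ∨
    (∃ a, t = plus a O ∧ c = a) ∨
    (∃ a b, t = plus a (s b) ∧ Steps S c (s (plus a b))) ∨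
    ∃ a, t = dbl a ∧ c = plus a a := by
  obtain ⟨ρ, hρ, θ, rfl, rfl⟩ := h
  rcases hS.subset hρ with rfl | rfl | rfl | rfl | rfl | rfl
  · exact .inl ⟨θ 1, by simp [Arith.add₁], by simp [Arith.add₁]⟩
  · exact .inr (.inl ⟨θ 0, θ 1, by simp [Arith.add₂], by simp [Arith.add₂]⟩)
  · exact .inr (.inr (.inl ⟨θ 0, by simp [Arith.add₃], by simp [Arith.add₃]⟩))
  · refine .inr (.inr (.inr (.inl ⟨θ 0, θ 1, by simp [Arith.add₄], ?_⟩)))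
    simpa [Arith.add₄] using Steps.rfl
  · refine .inr (.inr (.inr (.inl ⟨θ 0, θ 1, by simp [Arith.add₅], ?_⟩)))
    simpa [Arith.add₅] using hS.steps₂ .refl
  · exact .inr (.inr (.inr (.inr ⟨θ 0, by simp [double], by simp [double]⟩)))

end IsAddition

namespace IsAC

variable (hP : IsAC P)
include hP

theorem step_comm (a b : arith.Term ℕ) : Step (sym P) (plus a b) (plus b a) :=
  step_commR (.inl hP.comm) a b

theorem step_assoc (a b c : arith.Term ℕ) :
    Step (sym P) (plus (plus a b) c) (plus a (plus b c)) :=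
  step_assocR (.inl hP.assoc) a b c

/-- The two `ss` rules are inverse to each other, so symmetrization adds nothing to them. -/
theorem mem_sym_cases {ρ : Rule arith} (h : ρ ∈ sym P) :
    ρ = commR ∨ ρ = commR.inv ∨ ρ = assocR ∨ ρ = assocR.inv ∨
      (ρ = ss₁ ∧ ss₁ ∈ P) ∨ (ρ = ss₂ ∧ ss₁ ∈ P) := by
  have h₁ : ss₁.inv = ss₂ := rfl
  have h₂ : ss₂.inv = ss₁ := rfl
  obtain h | ⟨ρ, h, rfl⟩ := h <;> rcases hP.subset h with rfl | rfl | rfl | rfl <;>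
    simp_all [hP.ss]

theorem rootStep_cases (h : RootStep (sym P) t d) :
    (∃ a b, t = plus a b ∧ d = plus b a) ∨
    (∃ a b c, t = plus (plus a b) c ∧ d = plus a (plus b c)) ∨
    (∃ a b c, t = plus a (plus b c) ∧ d = plus (plus a b) c) ∨
    (∃ a, t = s a ∧ d = s (s a) ∧ ss₁ ∈ P) ∨
    ∃ a, t = s (s a) ∧ d = s a ∧ ss₁ ∈ P := by
  obtain ⟨ρ, hρ, θ, rfl, rfl⟩ := h
  rcases hP.mem_sym_cases hρ with rfl | rfl | rfl | rfl | ⟨rfl, h⟩ | ⟨rfl, h⟩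
  · exact .inl ⟨θ 0, θ 1, by simp [commR], by simp [commR]⟩
  · exact .inl ⟨θ 1, θ 0, by simp [commR, Rule.inv], by simp [commR, Rule.inv]⟩
  · exact .inr (.inl ⟨θ 0, θ 1, θ 2, by simp [assocR], by simp [assocR]⟩)
  · exact .inr (.inr (.inl ⟨θ 0, θ 1, θ 2, by simp [assocR, Rule.inv],
      by simp [assocR, Rule.inv]⟩))
  · exact .inr (.inr (.inr (.inl ⟨θ 0, by simp [ss₁], by simp [ss₁], h⟩)))
  · exact .inr (.inr (.inr (.inr ⟨θ 0, by simp [ss₂], by simp [ss₂], h⟩)))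

theorem reversible : Reversible P := by
  have comm := fun a b => step_commR hP.comm a b
  refine reversible_of_rules fun ρ hρ θ => ?_
  rcases hP.subset hρ with rfl | rfl | rfl | rfl
  · simpa [commR] using (comm _ _).steps
  · simp only [assocR, subst_plus, subst_x, subst_y, subst_z]
    -- Associativity is undone cyclically: `x+(y+z) → (y+z)+x → y+(z+x) → (z+x)+y → z+(x+y) →
    -- (x+y)+z`.
    exact ((((comm _ _).steps.tail (step_assocR hP.assoc _ _ _)).tail (comm _ _)).tail
      (step_assocR hP.assoc _ _ _)).tail (comm _ _)
  · simpa [ss₁] using (step_ss₂ (hP.ss.1 hρ) _).steps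
  · simpa [ss₂] using (step_ss₁ (hP.ss.2 hρ) _).steps

end IsAC

/-! ### Overlaps between the addition rules and the reversible rules. -/

section Overlaps

variable (hS : IsAddition S) (hP : IsAC P)
include hS

/-- Two addition rules at the same root remove a `O` or move an `s` outwards on different sides;
applying the other rule to each result gives a common reduct. -/
theorem join_root_S_S (h₁ : RootStep S t u) (h₂ : RootStep S t v) : JoinMod S P u v := by
  rcases hS.rootStep_cases h₁ with ⟨b, rfl, rfl⟩ | ⟨a, b, rfl, rfl⟩ | ⟨a, rfl, rfl⟩ |
    ⟨a, b, rfl, hc⟩ | ⟨a, rfl, rfl⟩ <;>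
  rcases hS.rootStep_cases h₂ with ⟨b', e, rfl⟩ | ⟨a', b', e, rfl⟩ | ⟨a', e, rfl⟩ |
    ⟨a', b', e, hc'⟩ | ⟨a', e, rfl⟩ <;> simp at e
  · subst e
    exact .of_common .rfl .rfl
  · obtain ⟨rfl, rfl⟩ := e
    exact .of_common .rfl .rfl
  · obtain ⟨rfl, rfl⟩ := e
    exact .of_common .rfl (hc'.trans (steps_s (hS.steps₁ .rfl)))
  · obtain ⟨rfl, rfl⟩ := e
    exact .of_common .rfl .rfl
  · obtain ⟨rfl, rfl⟩ := e
    exact .of_common (steps_s (hS.steps₃ .rfl)) .rfl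
  · obtain ⟨rfl, rfl⟩ := e
    exact .of_common (steps_s (hS.steps₄ .rfl)) (hc'.trans (steps_s (hS.steps₂ .rfl)))
  · obtain ⟨rfl, rfl⟩ := e
    exact .of_common .rfl .rfl
  · obtain ⟨rfl, rfl⟩ := e
    exact .of_common .rfl (steps_s (hS.steps₃ .rfl))
  · subst e
    exact .of_common .rfl .rfl
  · obtain ⟨rfl, rfl⟩ := e
    exact .of_common (hc.trans (steps_s (hS.steps₁ .rfl))) .rfl
  · obtain ⟨rfl, rfl⟩ := e
    exact .of_common (hc.trans (steps_s (hS.steps₂ .rfl))) (steps_s (hS.steps₄ .rfl))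
  · obtain ⟨rfl, rfl⟩ := e
    exact .of_common hc hc'
  · subst e
    exact .of_common .rfl .rfl

include hP

/-- Commuting or reassociating a sum moves the `O` or the `s` to another place, from which the
addition rules still remove it or move it to the root. After an `s` has reached the root on both
sides, the same reversible rule relates the sums below it. -/
theorem join_root_S_P (h₁ : RootStep S t u) (h₂ : RootStep (sym P) t v) : JoinMod S P u v := by
  rcases hP.rootStep_cases h₂ with ⟨a', b', rfl, rfl⟩ | ⟨a', b', c', rfl, rfl⟩ |
    ⟨a', b', c', rfl, rfl⟩ | ⟨a', rfl, rfl, hss⟩ | ⟨a', rfl, rfl, hss⟩ <;>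
  rcases hS.rootStep_cases h₁ with ⟨b, e, rfl⟩ | ⟨a, b, e, rfl⟩ | ⟨a, e, rfl⟩ |
    ⟨a, b, e, hc⟩ | ⟨a, e, rfl⟩ <;> simp at e <;> obtain ⟨rfl, rfl⟩ := e
  · exact .of_common .rfl (hS.steps₃ .rfl)
  · exact .of_steps .rfl (hS.steps₄ .rfl) (step_s (hP.step_comm _ _))
  · exact .of_common .rfl (hS.steps₁ .rfl)
  · exact .of_steps hc (hS.steps₂ .rfl) (step_s (hP.step_comm _ _))
  · exact .of_common .rfl (steps_plus .rfl (hS.steps₃ .rfl))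
  · exact .of_steps hc ((steps_plus .rfl (hS.steps₄ .rfl)).trans (hS.steps₄ .rfl))
      (step_s (hP.step_assoc _ _ _))
  · exact .of_common .rfl (steps_plus (hS.steps₁ .rfl) .rfl)
  · exact .of_steps .rfl ((steps_plus (hS.steps₂ .rfl) .rfl).trans (hS.steps₂ .rfl))
      (step_s (step_sym_symm (hP.step_assoc _ _ _)))

/-- The addition redex is the inner sum of the left-hand side of associativity; the reassociated
term can remove the same `O` or extract the same `s`. -/
theorem join_inner_assoc (h : RootStep S (plus a b) c) :
    JoinMod S P (plus c d) (plus a (plus b d)) := by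
  rcases hS.rootStep_cases h with ⟨b, e, rfl⟩ | ⟨a, b, e, rfl⟩ | ⟨a, e, rfl⟩ |
    ⟨a, b, e, hc⟩ | ⟨a, e, rfl⟩ <;> simp at e <;> obtain ⟨rfl, rfl⟩ := e
  · exact .of_common .rfl (hS.steps₁ .rfl)
  · exact .of_steps (hS.steps₂ .rfl) (hS.steps₂ .rfl) (step_s (hP.step_assoc _ _ _))
  · exact .of_common .rfl (steps_plus .rfl (hS.steps₁ .rfl))
  · exact .of_steps ((steps_plus hc .rfl).trans (hS.steps₂ .rfl))
      ((steps_plus .rfl (hS.steps₂ .rfl)).trans (hS.steps₄ .rfl)) (step_s (hP.step_assoc _ _ _))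

theorem join_inner_assoc_inv (h : RootStep S (plus b d) c) :
    JoinMod S P (plus a c) (plus (plus a b) d) := by
  rcases hS.rootStep_cases h with ⟨b, e, rfl⟩ | ⟨a, b, e, rfl⟩ | ⟨a, e, rfl⟩ |
    ⟨a, b, e, hc⟩ | ⟨a, e, rfl⟩ <;> simp at e <;> obtain ⟨rfl, rfl⟩ := e
  · exact .of_common .rfl (steps_plus (hS.steps₃ .rfl) .rfl)
  · exact .of_steps (hS.steps₄ .rfl) ((steps_plus (hS.steps₄ .rfl) .rfl).trans (hS.steps₂ .rfl))
      (step_s (step_sym_symm (hP.step_assoc _ _ _)))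
  · exact .of_common .rfl (hS.steps₃ .rfl)
  · exact .of_steps ((steps_plus .rfl hc).trans (hS.steps₄ .rfl)) (hS.steps₄ .rfl)
      (step_s (step_sym_symm (hP.step_assoc _ _ _)))

/-- Besides the root, the only nonvariable positions are the inner sum of associativity or of its
inverse, and the inner `s` of `ss₂`, where no rule of `S` applies. -/
theorem joinMod_of_mem_CP_S_P (h : (u, v) ∈ CP S (sym P)) : JoinMod S P u v := by
  obtain ⟨t, c, hc, ρ, hρ, p, w, θ, hw, hv, rfl, rfl, rfl⟩ := overlap_of_mem_CP h
  by_cases hp : p = []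
  · subst hp
    rw [subtermAt_nil, Option.some.injEq] at hw
    subst hw
    rw [replaceAt_nil]
    exact join_root_S_P hS hP hc ⟨ρ, hρ, θ, rfl, rfl⟩
  rcases hP.mem_sym_cases hρ with rfl | rfl | rfl | rfl | ⟨rfl, -⟩ | ⟨rfl, -⟩
  · simp only [commR, subtermAt_plus, subtermAt_x, subtermAt_y] at hw
    rcases hw with ⟨rfl, rfl⟩ | ⟨q, rfl, rfl, rfl⟩ | ⟨q, rfl, rfl, rfl⟩ <;> simp at hv hp
  · simp only [commR, Rule.inv, subtermAt_plus, subtermAt_x, subtermAt_y] at hw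
    rcases hw with ⟨rfl, rfl⟩ | ⟨q, rfl, rfl, rfl⟩ | ⟨q, rfl, rfl, rfl⟩ <;> simp at hv hp
  · simp only [assocR, subtermAt_plus, subtermAt_x, subtermAt_y, subtermAt_z] at hw
    rcases hw with ⟨rfl, rfl⟩ | ⟨q, rfl, ⟨rfl, rfl⟩ | ⟨q, rfl, rfl, rfl⟩ | ⟨q, rfl, rfl, rfl⟩⟩ |
      ⟨q, rfl, rfl, rfl⟩ <;> simp at hv hp
    simp only [subst_plus] at hc
    simpa [assocR] using join_inner_assoc hS hP hc
  · simp only [assocR, Rule.inv, subtermAt_plus, subtermAt_x, subtermAt_y, subtermAt_z] at hw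
    rcases hw with ⟨rfl, rfl⟩ | ⟨q, rfl, rfl, rfl⟩ |
      ⟨q, rfl, ⟨rfl, rfl⟩ | ⟨q, rfl, rfl, rfl⟩ | ⟨q, rfl, rfl, rfl⟩⟩ <;> simp at hv hp
    simp only [subst_plus] at hc
    simpa [assocR, Rule.inv] using join_inner_assoc_inv hS hP hc
  · simp only [ss₁, subtermAt_s, subtermAt_x] at hw
    rcases hw with ⟨rfl, rfl⟩ | ⟨q, rfl, rfl, rfl⟩ <;> simp at hv hp
  · simp only [ss₂, subtermAt_s, subtermAt_x] at hw
    rcases hw with ⟨rfl, rfl⟩ | ⟨q, rfl, ⟨rfl, rfl⟩ | ⟨q, rfl, rfl, rfl⟩⟩ <;> simp at hv hp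
    simp only [subst_s] at hc
    rcases hS.rootStep_cases hc with ⟨b, e, rfl⟩ | ⟨a, b, e, rfl⟩ | ⟨a, e, rfl⟩ |
      ⟨a, b, e, hc⟩ | ⟨a, e, rfl⟩ <;> simp at e

omit hP

/-- The only proper nonvariable subterms of left-hand sides for addition at which a rule
can apply are the arguments `s x` of `+`. -/
theorem inner_position {ρ : Rule arith} (hρ : ρ ∈ S) {p : Pos} {w : arith.Term ℕ} (hp : p ≠ [])
    (hw : subtermAt ρ.lhs p = some w) (hv : ¬ IsVar w) (θ : ℕ → arith.Term ℕ) :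
    w.subst θ = O ∨
    (p = [0] ∧ ρ = Arith.add₂ ∧ ∃ a b, w.subst θ = s a ∧ ρ.lhs.subst θ = plus (s a) b ∧
      ρ.rhs.subst θ = s (plus a b)) ∨
    (p = [1] ∧ ρ ≠ Arith.add₂ ∧ ∃ a b, w.subst θ = s b ∧ ρ.lhs.subst θ = plus a (s b) ∧
      Steps S (ρ.rhs.subst θ) (s (plus a b))) := by
  rcases hS.subset hρ with rfl | rfl | rfl | rfl | rfl | rfl
  · simp only [Arith.add₁, subtermAt_plus, subtermAt_O, subtermAt_y] at hw
    rcases hw with ⟨rfl, rfl⟩ | ⟨q, rfl, rfl, rfl⟩ | ⟨q, rfl, rfl, rfl⟩ <;> simp at hv hp ⊢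
  · simp only [Arith.add₂, subtermAt_plus, subtermAt_s, subtermAt_x, subtermAt_y] at hw
    rcases hw with ⟨rfl, rfl⟩ | ⟨q, rfl, ⟨rfl, rfl⟩ | ⟨q, rfl, rfl, rfl⟩⟩ |
      ⟨q, rfl, rfl, rfl⟩ <;> simp at hv hp
    exact .inr (.inl ⟨rfl, rfl, θ 0, θ 1, by simp, by simp [Arith.add₂], by simp [Arith.add₂]⟩)
  · simp only [Arith.add₃, subtermAt_plus, subtermAt_O, subtermAt_x] at hw
    rcases hw with ⟨rfl, rfl⟩ | ⟨q, rfl, rfl, rfl⟩ | ⟨q, rfl, rfl, rfl⟩ <;> simp at hv hp ⊢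
  · simp only [Arith.add₄, subtermAt_plus, subtermAt_s, subtermAt_x, subtermAt_y] at hw
    rcases hw with ⟨rfl, rfl⟩ | ⟨q, rfl, rfl, rfl⟩ |
      ⟨q, rfl, ⟨rfl, rfl⟩ | ⟨q, rfl, rfl, rfl⟩⟩ <;> simp at hv hp
    refine .inr (.inr ⟨rfl, by simp [Arith.add₄, Arith.add₂, x], θ 0, θ 1, by simp,
      by simp [Arith.add₄], ?_⟩)
    simpa [Arith.add₄] using Steps.rfl
  · simp only [Arith.add₅, subtermAt_plus, subtermAt_s, subtermAt_x, subtermAt_y] at hw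
    rcases hw with ⟨rfl, rfl⟩ | ⟨q, rfl, rfl, rfl⟩ |
      ⟨q, rfl, ⟨rfl, rfl⟩ | ⟨q, rfl, rfl, rfl⟩⟩ <;> simp at hv hp
    refine .inr (.inr ⟨rfl, by simp [Arith.add₅, Arith.add₂], θ 0, θ 1, by simp,
      by simp [Arith.add₅], ?_⟩)
    simpa [Arith.add₅] using hS.steps₂ .rfl
  · simp only [double, subtermAt_dbl, subtermAt_x] at hw
    rcases hw with ⟨rfl, rfl⟩ | ⟨q, rfl, rfl, rfl⟩ <;> simp at hv hp

theorem joinMod_of_mem_CP_S_S (h : (u, v) ∈ CP S S) : JoinMod S P u v := by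
  obtain ⟨t, c, hc, ρ, hρ, p, w, θ, hw, hv, rfl, rfl, rfl⟩ := overlap_of_mem_CP h
  by_cases hp : p = []
  · subst hp
    rw [subtermAt_nil, Option.some.injEq] at hw
    subst hw
    rw [replaceAt_nil]
    exact join_root_S_S hS hc ⟨ρ, hρ, θ, rfl, rfl⟩
  rcases inner_position hS hρ hp hw hv θ with e | ⟨-, -, a, b, e, -⟩ | ⟨-, -, a, b, e, -⟩ <;>
    rw [e] at hc <;> rcases hS.rootStep_cases hc with ⟨b, e, rfl⟩ | ⟨a, b, e, rfl⟩ | ⟨a, e, rfl⟩ |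
      ⟨a, b, e, hc⟩ | ⟨a, e, rfl⟩ <;> simp at e

include hP

/-- The possible inner overlaps of the reversible rules on the rules for addition. -/
theorem inner_overlap {ρ : Rule arith} (hρ : ρ ∈ S) {p : Pos} {w : arith.Term ℕ} (hp : p ≠ [])
    (hw : subtermAt ρ.lhs p = some w) (hv : ¬ IsVar w) {θ : ℕ → arith.Term ℕ}
    (hc : RootStep (sym P) (w.subst θ) c) : ss₁ ∈ P ∧
    ((p = [0] ∧ ρ = Arith.add₂ ∧ ∃ a b, ρ.lhs.subst θ = plus (s a) b ∧ ρ.rhs.subst θ = s (plus a b) ∧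
        (c = s (s a) ∨ ∃ d, a = s d ∧ c = a)) ∨
      (p = [1] ∧ ρ ≠ Arith.add₂ ∧ ∃ a b, ρ.lhs.subst θ = plus a (s b) ∧
        Steps S (ρ.rhs.subst θ) (s (plus a b)) ∧ (c = s (s b) ∨ ∃ d, b = s d ∧ c = b))) := by
  rcases inner_position hS hρ hp hw hv θ with
    e | ⟨rfl, hρ', a, b, e, h₁, h₂⟩ | ⟨rfl, hρ', a, b, e, h₁, h₂⟩ <;>
    rw [e] at hc <;> rcases hP.rootStep_cases hc with ⟨a', b', e', rfl⟩ | ⟨a', b', c', e', rfl⟩ |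
      ⟨a', b', c', e', rfl⟩ | ⟨a', e', rfl, hss⟩ | ⟨a', e', rfl, hss⟩ <;> simp at e' <;>
    subst e'
  · exact ⟨hss, .inl ⟨rfl, hρ', _, b, h₁, h₂, .inl rfl⟩⟩
  · exact ⟨hss, .inl ⟨rfl, hρ', _, b, h₁, h₂, .inr ⟨_, rfl, rfl⟩⟩⟩
  · exact ⟨hss, .inr ⟨rfl, hρ', a, _, h₁, h₂, .inl rfl⟩⟩
  · exact ⟨hss, .inr ⟨rfl, hρ', a, _, h₁, h₂, .inr ⟨_, rfl, rfl⟩⟩⟩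

/-- Root overlaps are mirror images of those of `S` on `sym P`. Inner overlaps change the number of
`s` in an argument by one; after all of them have moved outwards, one `ss` step remains. -/
theorem joinMod_of_mem_CP_P_S (h : (u, v) ∈ CP (sym P) S) : JoinMod S P u v := by
  obtain ⟨t, c, hc, ρ, hρ, p, w, θ, hw, hv, rfl, rfl, rfl⟩ := overlap_of_mem_CP h
  by_cases hp : p = []
  · subst hp
    rw [subtermAt_nil, Option.some.injEq] at hw
    subst hw
    rw [replaceAt_nil]
    exact (join_root_S_P hS hP ⟨ρ, hρ, θ, rfl, rfl⟩ hc).symm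
  obtain ⟨hss, ⟨rfl, -, a, b, e₁, e₂, h⟩ | ⟨rfl, -, a, b, e₁, e₂, h⟩⟩ :=
    inner_overlap hS hP hρ hp hw hv hc
  · rw [e₁, e₂, replaceAt_plus_left, replaceAt_nil]
    rcases h with rfl | ⟨d, rfl, rfl⟩
    · exact .of_steps ((hS.steps₂ (steps_s (hS.steps₂ .rfl)))) .rfl
        (step_sym_symm (step_ss₁ (.inl hss) _))
    · exact .of_steps (hS.steps₂ .rfl) (steps_s (hS.steps₂ .rfl)) (step_ss₁ (.inl hss) _)
  · rw [e₁, replaceAt_plus_right, replaceAt_nil]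
    rcases h with rfl | ⟨d, rfl, rfl⟩
    · exact .of_steps ((hS.steps₄ (steps_s (hS.steps₄ .rfl)))) e₂
        (step_sym_symm (step_ss₁ (.inl hss) _))
    · exact .of_steps (hS.steps₄ .rfl) (e₂.trans (steps_s (hS.steps₄ .rfl)))
        (step_ss₁ (.inl hss) _)

/-- Inner parallel critical pairs have a single overlap, with `ss₁` or `ss₂`. -/
theorem single_overlap_of_mem_PCPIn {X : Set ℕ} (h : (u, v, X) ∈ PCPIn (sym P) S) :
    ss₁ ∈ P ∧ ((∃ a b c, u = plus c b ∧ v = s (plus a b) ∧ (c = s (s a) ∨ ∃ d, a = s d ∧ c = a)) ∨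
      ∃ a b c, u = plus a c ∧ Steps S v (s (plus a b)) ∧ (c = s (s b) ∨ ∃ d, b = s d ∧ c = b)) := by
  obtain ⟨ρ, hρ, U, w, c, θ, ⟨p, hp⟩, hU, hw, rfl, rfl⟩ := overlap_of_mem_PCPIn h
  have hne : ∀ q ∈ U, q ≠ [] := fun q hq e => hU (e ▸ hq)
  have key := fun q (hq : q ∈ U) =>
    inner_overlap hS hP hρ (hne q hq) (hw q hq).1 (hw q hq).2.1 (hw q hq).2.2
  -- Two distinct positions would force the same rule both to be `add₂` and not to be it.
  have hUp : U = {p} := by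
    refine Finset.eq_singleton_iff_unique_mem.2 ⟨hp, fun q hq => ?_⟩
    obtain ⟨-, ⟨rfl, h₁, -⟩ | ⟨rfl, h₁, -⟩⟩ := key p hp <;>
      obtain ⟨-, ⟨rfl, h₂, -⟩ | ⟨rfl, h₂, -⟩⟩ := key q hq
    · rfl
    · exact absurd h₁ h₂
    · exact absurd h₂ h₁
    · rfl
  subst hUp
  rw [replaceOn_singleton]
  obtain ⟨hss, ⟨rfl, -, a, b, e₁, e₂, h⟩ | ⟨rfl, -, a, b, e₁, e₂, h⟩⟩ :=
    key p hp
  · rw [e₁, replaceAt_plus_left, replaceAt_nil]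
    exact ⟨hss, .inl ⟨a, b, _, rfl, e₂, h⟩⟩
  · rw [e₁, replaceAt_plus_right, replaceAt_nil]
    exact ⟨hss, .inr ⟨a, b, _, rfl, e₂, h⟩⟩

end Overlaps

/-! ## The criteria that apply -/

section Criteria

variable (hS : IsAddition S) (hP : IsAC P)
include hS

theorem IsAddition.terminating : Terminating S := by
  refine noInfiniteChain_of_measure weight fun a b h => weight_lt (R := S) ?_ h
  refine hS.subset.trans ?_
  rintro ρ (rfl | rfl | rfl | rfl | rfl | rfl) <;> simp

/-- Only `ss₂` can be added here: the weight decreases under it, whereas `ss₁` increases it. -/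
theorem IsAddition.terminatingRel : TerminatingRel S {ss₂} := by
  refine terminatingRel_of_measure weight (fun a b h => weight_lt (R := S) ?_ h)
    fun a b h => (weight_lt (R := {ss₂}) ?_ h).le
  · refine hS.subset.trans ?_
    rintro ρ (rfl | rfl | rfl | rfl | rfl | rfl) <;> simp
  · rintro ρ rfl
    simp

theorem IsAddition.leftLinear : LeftLinear S := by
  intro ρ hρ n p q hp hq
  rcases hS.subset hρ with rfl | rfl | rfl | rfl | rfl | rfl <;>
    simp [Arith.add₁, Arith.add₂, Arith.add₃, Arith.add₄, Arith.add₅, double, x, y] at hp hq <;>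
    aesop

theorem IsAddition.linear (hd : double ∉ S) : Linear S := by
  refine fun ρ hρ => ⟨hS.leftLinear ρ hρ, ?_⟩
  intro n p q hp hq
  rcases hS.subset hρ with rfl | rfl | rfl | rfl | rfl | rfl
  on_goal 6 => exact absurd hρ hd
  all_goals
    simp [Arith.add₁, Arith.add₂, Arith.add₃, Arith.add₄, Arith.add₅, x, y] at hp hq
    aesop

include hP

theorem linearConditions (hd : double ∉ S) : LinearConditions S P where
  linear := hS.linear hd
  reversible := hP.reversible
  terminating := hS.terminating
  cp_S_S := fun _ h => (joinMod_of_mem_CP_S_S hS h).left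
  cp_P_S := fun _ h => (joinMod_of_mem_CP_P_S hS hP h).left
  cp_S_P := fun _ h => (joinMod_of_mem_CP_S_P hS hP h).right

theorem pcpConditions (hss : ss₁ ∉ P) : PCPConditions S P where
  leftLinear := hS.leftLinear
  reversible := hP.reversible
  terminating := hS.terminating
  cp_S_S := fun _ h => (joinMod_of_mem_CP_S_S hS h).left_par
  pcp_P_S := fun _ _ _ h => absurd (single_overlap_of_mem_PCPIn hS hP h).1 hss
  cp_S_P := fun _ h => (joinMod_of_mem_CP_S_P hS hP h).right_par

/-- The `ss` step that closes an inner overlap would contract a sum containing variables outside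
`X`. It is replaced by the relative step `ss₂`, which is subject to no such restriction. -/
theorem pcpRTConditions (hss : ss₂ ∈ P) : PCPRTConditions S P {ss₂} where
  leftLinear := hS.leftLinear
  reversible := hP.reversible
  subset := by
    rintro ρ rfl
    exact .inl hss
  terminating := hS.terminatingRel
  cp_S_S := fun _ h =>
    let ⟨a, h₁, b, h₂, h₃⟩ := (joinMod_of_mem_CP_S_S hS h).left_par
    ⟨a, h₁.mono Set.subset_union_left, b, h₂, Steps.mono Set.subset_union_left h₃⟩
  pcp_P_S := by
    intro u v X h
    have collapse : ∀ a, Step (S ∪ {ss₂}) (s (s a)) (s a) := step_ss₂ (.inr rfl)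
    have lift : ∀ {a b}, Steps S a b → Steps (S ∪ {ss₂}) a b := Steps.mono Set.subset_union_left
    -- With a common reduct the parallel step is empty and the variable condition is vacuous. It
    -- remains to begin the reduction of `u` with a genuine `S`-step, after which `ss₂` is
    -- available.
    suffices ∃ a, Relation.Comp (Step S) (Steps (S ∪ {ss₂})) u a ∧ Steps (S ∪ {ss₂}) v a by
      obtain ⟨a, h₁, h₂⟩ := this
      exact ⟨∅, a, a, .inr h₁, parStepAt_empty a, h₂, by simp [varsAt]⟩
    have nontrivial : ∀ {u a c}, Steps S u c → u ≠ c → Steps (S ∪ {ss₂}) c a →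
        Relation.Comp (Step S) (Steps (S ∪ {ss₂})) u a := by
      intro u a c h₁ hne h₂
      obtain e | ⟨d, h₃, h₄⟩ := Relation.ReflTransGen.cases_head h₁
      · exact absurd e hne
      · exact ⟨d, h₃, (lift h₄).trans h₂⟩
    obtain ⟨-, ⟨a, b, c, rfl, rfl, rfl | ⟨d, rfl, rfl⟩⟩ | ⟨a, b, c, rfl, hv, rfl | ⟨d, rfl, rfl⟩⟩⟩ :=
      single_overlap_of_mem_PCPIn hS hP h
    · exact ⟨s (plus a b), nontrivial (c := s (s (plus a b))) (hS.steps₂ (steps_s (hS.steps₂ .rfl)))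
        (by simp) (collapse _).steps, .rfl⟩
    · exact ⟨s (plus d b), nontrivial (c := s (plus d b)) (hS.steps₂ .rfl) (by simp) .rfl,
        (lift (steps_s (hS.steps₂ .rfl))).trans (collapse _).steps⟩
    · exact ⟨s (plus a b), nontrivial (c := s (s (plus a b))) (hS.steps₄ (steps_s (hS.steps₄ .rfl)))
        (by simp) (collapse _).steps, lift hv⟩
    · exact ⟨s (plus a d), nontrivial (c := s (plus a d)) (hS.steps₄ .rfl) (by simp) .rfl,
        (lift (hv.trans (steps_s (hS.steps₄ .rfl)))).trans (collapse _).steps⟩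
  cp_S_P := fun _ h => comp_flip_split Set.subset_union_left
    (joinMod_of_mem_CP_S_P hS hP h).right_par

end Criteria

theorem not_isVariant_of_isAddition_of_isAC {ρ τ : Rule arith} (hS : IsAddition S) (hP : IsAC P)
    (hρ : ρ ∈ S) (hτ : τ ∈ P) : ¬ ρ.IsVariant τ := by
  rintro ⟨π, h, -⟩
  rcases hS.subset hρ with rfl | rfl | rfl | rfl | rfl | rfl <;>
    rcases hP.subset hτ with rfl | rfl | rfl | rfl <;>
    simp [Arith.add₁, Arith.add₂, Arith.add₃, Arith.add₄, Arith.add₅, double, commR, assocR, ss₁,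
      ss₂, x, y, z] at h

theorem isAddition_R₃ : IsAddition {add₁, add₂, add₃, add₄} :=
  ⟨by rintro ρ (rfl | rfl | rfl | rfl) <;> simp, by simp, by simp, by simp, by simp⟩

theorem isAddition_R₄ : IsAddition {add₁, add₂, add₃, add₄, double} :=
  ⟨by rintro ρ (rfl | rfl | rfl | rfl | rfl) <;> simp, by simp, by simp, by simp, by simp⟩

theorem isAddition_R₆ : IsAddition {add₁, add₂, add₃, add₅, double} :=
  ⟨by rintro ρ (rfl | rfl | rfl | rfl | rfl) <;> simp, by simp, by simp, by simp, by simp⟩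

theorem isAC_R₃ : IsAC {commR, assocR} :=
  ⟨by rintro ρ (rfl | rfl) <;> simp, by simp, by simp,
    by simp [ss₁, ss₂, commR, assocR]⟩

theorem isAC_R₅ : IsAC {commR, assocR, ss₁, ss₂} :=
  ⟨by rintro ρ (rfl | rfl | rfl | rfl) <;> simp, by simp, by simp, by simp⟩

theorem double_notMem : double ∉ ({add₁, add₂, add₃, add₄} : Set (Rule arith)) := by
  simp [double, add₁, add₂, add₃, add₄]

theorem ss₁_notMem : ss₁ ∉ ({commR, assocR} : Set (Rule arith)) := by
  simp [ss₁, commR, assocR]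

theorem isPartition (hS : IsAddition S) (hP : IsAC P) {R : Set (Rule arith)} (h : S ∪ P = R) :
    IsPartition R S P :=
  ⟨h, fun _ hρ _ hτ => not_isVariant_of_isAddition_of_isAC hS hP hρ hτ⟩

theorem linearNoRT_R₃ : LinearNoRT _ R₃ :=
  ⟨_, _, isPartition isAddition_R₃ isAC_R₃ (by ext; simp [R₃]; tauto),
    linearConditions isAddition_R₃ isAC_R₃ double_notMem⟩

theorem pcpNoRT_R₃ : PCPNoRT _ R₃ :=
  ⟨_, _, isPartition isAddition_R₃ isAC_R₃ (by ext; simp [R₃]; tauto),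
    pcpConditions isAddition_R₃ isAC_R₃ ss₁_notMem⟩

theorem pcpNoRT_R₄ : PCPNoRT _ R₄ :=
  ⟨_, _, isPartition isAddition_R₄ isAC_R₃ (by ext; simp [R₃, R₄]; tauto),
    pcpConditions isAddition_R₄ isAC_R₃ ss₁_notMem⟩

theorem linearNoRT_R₅ : LinearNoRT _ R₅ :=
  ⟨_, _, isPartition isAddition_R₃ isAC_R₅ (by ext; simp [R₃, R₅]; tauto),
    linearConditions isAddition_R₃ isAC_R₅ double_notMem⟩

theorem pcpRT_R₅ : PCPRT _ R₅ :=
  ⟨_, _, _, isPartition isAddition_R₃ isAC_R₅ (by ext; simp [R₃, R₅]; tauto),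
    pcpRTConditions isAddition_R₃ isAC_R₅ (by simp)⟩

theorem pcpNoRT_R₆ : PCPNoRT _ R₆ :=
  ⟨_, _, isPartition isAddition_R₆ isAC_R₃ (by ext; simp [R₆]; tauto),
    pcpConditions isAddition_R₆ isAC_R₃ ss₁_notMem⟩

theorem pcpRT_R₇ : PCPRT _ R₇ :=
  ⟨_, _, _, isPartition isAddition_R₄ isAC_R₅ (by ext; simp [R₃, R₄, R₅, R₇]; tauto),
    pcpRTConditions isAddition_R₄ isAC_R₅ (by simp)⟩


end Arith

end Rewriting

namespace Rewriting

/-! ### Membership in the two parts of a partition. -/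

section Partitions

variable {L : FirstOrder.Language.{0, 0}} {R S P : Set (Rule L)}

theorem IsPartition.subset_left (h : IsPartition R S P) : S ⊆ R := h.1 ▸ Set.subset_union_left

theorem IsPartition.subset_right (h : IsPartition R S P) : P ⊆ R := h.1 ▸ Set.subset_union_right

theorem IsPartition.mem_right (h : IsPartition R S P) {ρ : Rule L} (hρ : ρ ∈ R) (hS : ρ ∉ S) :
    ρ ∈ P := by
  rw [← h.1] at hρ
  exact hρ.resolve_left hS

theorem IsPartition.mem_left (h : IsPartition R S P) {ρ : Rule L} (hρ : ρ ∈ R) (hP : ρ ∉ P) :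
    ρ ∈ S := by
  rw [← h.1] at hρ
  exact hρ.resolve_right hP

theorem IsPartition.notMem_left (h : IsPartition R S P) {ρ : Rule L} (hP : ρ ∈ P) : ρ ∉ S :=
  fun hS => h.2 ρ hS ρ hP (isVariant_refl ρ)

end Partitions

/-! ### Failure of criteria for the arithmetical systems. -/

namespace Arith

open FirstOrder.Language (Term)

variable {R S P : Set (Rule arith)} {a b t : arith.Term ℕ} {X : Set ℕ}

theorem parStepIn_plus_cases (hst : ParStepIn R X (plus a b) t) :
    (RootStep R (plus a b) t ∧ (t.varFinset : Set ℕ) ⊆ X) ∨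
      ∃ a' b', t = plus a' b' ∧ ParStepIn R X a a' ∧ ParStepIn R X b b' := by
  obtain h | ⟨ts, rfl, h⟩ := ParStepIn.func_cases hst
  · exact .inl h
  · exact .inr ⟨ts 0, ts 1, func_plus _, h 0, h 1⟩

theorem parStepIn_s_cases (hst : ParStepIn R X (s a) t) :
    (RootStep R (s a) t ∧ (t.varFinset : Set ℕ) ⊆ X) ∨ ∃ a', t = s a' ∧ ParStepIn R X a a' := by
  obtain h | ⟨ts, rfl, h⟩ := ParStepIn.func_cases hst
  · exact .inl h
  · exact .inr ⟨ts 0, func_succ _, h 0⟩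

/-- All the rules of the arithmetical examples. -/
def allRules : Set (Rule arith) :=
  {add₁, add₂, add₃, add₄, add₅, commR, assocR, double, ss₁, ss₂}

theorem not_step_var (hR : R ⊆ allRules) {n : ℕ} : ¬ Step R (.var n) t := by
  intro h
  obtain ⟨ρ, hρ, θ, h, -⟩ := h.var_cases
  rcases hR hρ with rfl | rfl | rfl | rfl | rfl | rfl | rfl | rfl | rfl | rfl <;>
    simp [add₁, add₂, add₃, add₄, add₅, double, commR, assocR, ss₁, ss₂] at h

theorem step_plus_x_x (hR : R ⊆ allRules) (hst : Step R (plus x x) t) : t = plus x x := by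
  obtain ⟨ρ, hρ, θ, h, rfl⟩ | ⟨a, h, -⟩ | ⟨a, h, -⟩ := step_plus_cases hst
  · rcases hR hρ with rfl | rfl | rfl | rfl | rfl | rfl | rfl | rfl | rfl | rfl <;>
      simp [add₁, add₂, add₃, add₄, add₅, double, commR, assocR, ss₁, ss₂, x, y] at h ⊢
    exact ⟨h.2.symm, h.1.symm⟩
  · exact absurd h (not_step_var hR)
  · exact absurd h (not_step_var hR)

/-- `double` has a nonlinear right-hand side, so it would have to be reversible; but from `x + x`
the only possible step is commutation, which returns the same term. -/
theorem not_linearRT (hR : R ⊆ allRules) (hd : double ∈ R) : ¬ LinearRT _ R := by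
  rintro ⟨S, P, P₀, hSP, h⟩
  by_cases hdS : double ∈ S
  · have := (h.linear double hdS).2 0 [0] [1] (by simp [double, x]) (by simp [double, x])
    simp at this
  · have hdP := hSP.mem_right hd hdS
    have hback := h.reversible _ _ (step_double hdP x)
    have : dbl x = plus x x :=
      Steps.closed (C := fun t => t = plus x x)
        (fun s t hs h => step_plus_x_x (hSP.subset_right.trans hR) (hs ▸ h)) hback rfl
    simp at this

theorem step_of_root_s (hR : R ⊆ allRules) (hst : Step R (s a) t) : ∃ b, t = s b := by
  obtain ⟨ρ, hρ, θ, h, rfl⟩ | ⟨a', h, rfl⟩ := step_s_cases hst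
  · rcases hR hρ with rfl | rfl | rfl | rfl | rfl | rfl | rfl | rfl | rfl | rfl <;>
      simp [add₁, add₂, add₃, add₄, add₅, double, commR, assocR, ss₁, ss₂] at h ⊢
  · exact ⟨_, rfl⟩

/-- Of all the rules only `ss₂` can reduce two leading `s` to one. So `ss₁` in a reversible part
needs `ss₂` beside it. -/
theorem step_of_root_ss (hR : R ⊆ allRules) (h₂ : ss₂ ∉ R) (hst : Step R (s (s a)) t) :
    ∃ b, t = s (s b) := by
  obtain ⟨ρ, hρ, θ, h, rfl⟩ | ⟨a', h, rfl⟩ := step_s_cases hst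
  · rcases hR hρ with rfl | rfl | rfl | rfl | rfl | rfl | rfl | rfl | rfl | rfl
    on_goal 10 => exact absurd hρ h₂
    all_goals simp [add₁, add₂, add₃, add₄, add₅, double, commR, assocR, ss₁] at h ⊢
  · obtain ⟨b, hb⟩ := step_of_root_s hR h
    exact ⟨b, hb ▸ rfl⟩

/-- The overlap of `ss₁` on the argument `s x` of `add₂`. -/
theorem mem_PCPIn_ss₁_add₂ (h₁ : ss₁ ∈ R) (h₂ : add₂ ∈ S) :
    ∃ X ⊆ {0}, (plus (s (s x)) y, s (plus x y), X) ∈ PCPIn R S := by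
  -- The variant of `ss₁` uses variable `2`, disjoint from those of `add₂`; the unifier sends it to
  -- `x`.
  refine ⟨varsAt {[0]} (plus (s x) y), ?_, add₂, h₂, add₂, isVariant_refl _, {[0]},
    fun _ => ⟨s (.var 2), s (s (.var 2))⟩, fun _ => s x, fun n => if n = 2 then x else .var n,
    by simp, by simp, by simp, ?_, ?_, ?_, ?_⟩
  · rintro n ⟨p, hp, u, hu, hn⟩
    simp only [Finset.mem_singleton] at hp
    subst hp
    simp at hu
    subst hu
    simpa using hn
  · intro p hp
    simp only [Finset.mem_singleton] at hp
    subst hp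
    refine ⟨⟨ss₁, h₁, Equiv.swap 0 2, by simp [ss₁], by simp [ss₁]⟩, ?_, by simp [add₂], by simp⟩
    simp [Rule.vars, add₂]
  · simp
  · refine isMGU_of_absorbed ?_ ?_ ?_
    · refine (Set.finite_singleton 2).subset fun n hn => ?_
      by_contra h
      simp only [Set.mem_singleton_iff] at h
      simp [h] at hn
    · rintro e ⟨p, hp, rfl⟩
      simp [x]
    · intro τ hτ n
      have := hτ _ ⟨[0], by simp, rfl⟩
      simp only [subst_s, s_inj, subst_var_eq, subst_x] at this
      by_cases hn : n = 2
      · simp [hn, this]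
      · simp [hn]
  · rw [replaceOn_singleton]
    simp [add₂, x, y]

/-- Termination excludes `ss₁` and `commR` from `S`; reversibility then demands `ss₂ ∈ P` and
forbids `add₂ ∈ P`, because a leading `s` is never lost. In the pair from `ss₁` on `add₂`, the right
side `s (plus x y)` is `S`-normal, while every reduct of the left side has one more `s`. No parallel
step that leaves `y` untouched creates that `s`. -/
theorem not_pcpNoRT (hR : R ⊆ {add₁, add₂, add₃, add₄, commR, assocR, double, ss₁, ss₂})
    (h₁ : ss₁ ∈ R) (h₂ : add₂ ∈ R) : ¬ PCPNoRT _ R := by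
  rintro ⟨S, P, hSP, h⟩
  have hR' : R ⊆ allRules := hR.trans (by
    rintro ρ (rfl | rfl | rfl | rfl | rfl | rfl | rfl | rfl | rfl) <;> simp [allRules])
  have hP' := hSP.subset_right.trans hR'
  have hS₁ : ss₁ ∉ S := fun hS => h.terminating
    ⟨fun n => s^[n] (s x), fun n => by
      induction n with
      | zero => exact step_ss₁ hS x
      | succ n ih =>
        simp only [Function.iterate_succ_apply'] at ih ⊢
        exact step_s ih⟩
  have hSC : commR ∉ S := fun hS =>
    not_noInfiniteChain_of_cycle (step_commR hS x y) (step_commR hS y x) h.terminating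
  have hP₁ := hSP.mem_right h₁ hS₁
  have hP₂ : ss₂ ∈ P := by
    by_contra hP₂
    obtain ⟨b, hb⟩ := Steps.closed (C := fun t => ∃ b, t = s (s b))
      (fun _ _ ⟨_, hs⟩ h => step_of_root_ss hP' hP₂ (hs ▸ h))
      (h.reversible _ _ (step_ss₁ hP₁ x)) ⟨_, rfl⟩
    simp [x] at hb
  have hS₂ : add₂ ∈ S := by
    refine hSP.mem_left h₂ fun hP => ?_
    obtain ⟨b, hb⟩ := Steps.closed (C := fun t => ∃ b, t = s b)
      (fun _ _ ⟨_, hs⟩ h => step_of_root_s hP' (hs ▸ h))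
      (h.reversible _ _ (step_add₂ hP x y)) ⟨_, rfl⟩
    simp at hb
  have hS : S ⊆ {add₁, add₂, add₃, add₄, assocR, double} := by
    intro ρ hρ
    rcases hR (hSP.subset_left hρ) with rfl | rfl | rfl | rfl | rfl | rfl | rfl | rfl | rfl
    on_goal 5 => exact absurd hρ hSC
    on_goal 7 => exact absurd hρ hS₁
    on_goal 7 => exact absurd hρ (hSP.notMem_left hP₂)
    all_goals simp
  have noVar : ∀ {n t}, ¬ Step S (.var n) t := not_step_var (hSP.subset_left.trans hR')
  have plus_s_y : ∀ {a t}, Step S (plus (s a) y) t → t = s (plus a y) ∨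
      ∃ a', Step S (s a) a' ∧ t = plus a' y := by
    intro a t hst
    obtain ⟨ρ, hρ, θ, h, rfl⟩ | h | ⟨a, h, -⟩ := step_plus_cases hst
    · rcases hS hρ with rfl | rfl | rfl | rfl | rfl | rfl <;>
        simp [add₁, add₂, add₃, add₄, assocR, double, y] at h ⊢
      exact ⟨h.1.symm, h.2.symm⟩
    · exact .inr h
    · exact absurd h noVar
  have s_cases : ∀ {a t}, Step S (s a) t → ∃ a', Step S a a' ∧ t = s a' := by
    intro a t hst
    obtain ⟨ρ, hρ, θ, h, rfl⟩ | h := step_s_cases hst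
    · rcases hS hρ with rfl | rfl | rfl | rfl | rfl | rfl <;>
        simp [add₁, add₂, add₃, add₄, assocR, double] at h
    · exact h
  have noStep : ∀ {t}, ¬ Step S (plus x y) t := by
    intro t hst
    obtain ⟨ρ, hρ, θ, h, rfl⟩ | ⟨a, h, -⟩ | ⟨a, h, -⟩ := step_plus_cases hst
    · rcases hS hρ with rfl | rfl | rfl | rfl | rfl | rfl <;>
        simp [add₁, add₂, add₃, add₄, assocR, double, x, y] at h
    · exact noVar h
    · exact noVar h
  obtain ⟨X, hX, hmem⟩ := mem_PCPIn_ss₁_add₂ (R := sym P) (.inl hP₁) hS₂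
  obtain ⟨V, a, b, hua, hba, hvb, hV⟩ := h.pcp_P_S _ _ _ hmem
  have hb : b = s (plus x y) := by
    refine Steps.closed (C := fun t => t = s (plus x y)) (fun t t' ht h => ?_) hvb rfl
    subst ht
    obtain ⟨_, h, -⟩ := s_cases h
    exact absurd h noStep
  subst hb
  have ha : a = plus (s (s x)) y ∨ a = s (plus (s x) y) ∨ a = s (s (plus x y)) := by
    refine Steps.closed (C := fun t => t = plus (s (s x)) y ∨ t = s (plus (s x) y) ∨
      t = s (s (plus x y))) (fun t t' ht h => ?_) hua (.inl rfl)
    rcases ht with rfl | rfl | rfl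
    · obtain e | ⟨_, h₁, -⟩ := plus_s_y h
      · exact .inr (.inl e)
      · obtain ⟨_, h₂, -⟩ := s_cases h₁
        obtain ⟨_, h₃, -⟩ := s_cases h₂
        exact absurd h₃ noVar
    · obtain ⟨_, h₁, rfl⟩ := s_cases h
      obtain rfl | ⟨_, h₂, -⟩ := plus_s_y h₁
      · exact .inr (.inr rfl)
      · obtain ⟨_, h₃, -⟩ := s_cases h₂
        exact absurd h₃ noVar
    · obtain ⟨_, h₁, -⟩ := s_cases h
      obtain ⟨_, h₂, -⟩ := s_cases h₁
      exact absurd h₂ noStep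
  -- Only `x` may occur in contracta. Contracting the root or the sum would produce one containing
  -- `y`, so only a contraction at a variable is left.
  have hstep : ParStepIn (sym P) {0} (s (plus x y)) a := ⟨V, hba, hV.trans hX⟩
  obtain ⟨-, h⟩ | ⟨a₁, rfl, hstep₁⟩ := parStepIn_s_cases hstep
  · have : 1 ∈ a.varFinset := by rcases ha with rfl | rfl | rfl <;> simp
    simpa using h this
  obtain ⟨-, h⟩ | ⟨c, d, rfl, hstep₂, -⟩ := parStepIn_plus_cases hstep₁
  · have : 1 ∈ a₁.varFinset := by
      simp only [s_ne_plus, s_inj, false_or] at ha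
      rcases ha with rfl | rfl <;> simp
    simpa using h this
  simp at ha
  obtain ⟨rfl, -⟩ := ha
  obtain ⟨ρ, hρ, θ, h, h'⟩ | h := ParStepIn.var_cases hstep₂
  -- The inverses of `add₁` and `add₃` do rewrite a variable, but to a sum and never to `s x`.
  · obtain hρ | ⟨ρ, hρ, rfl⟩ := hρ <;>
      rcases hP' hρ with rfl | rfl | rfl | rfl | rfl | rfl | rfl | rfl | rfl | rfl <;>
      simp [add₁, add₂, add₃, add₄, add₅, double, commR, assocR, ss₁, ss₂, Rule.inv] at h h'
  · simp at h

theorem isTRS (hR : R ⊆ allRules) : IsTRS R := by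
  refine ⟨Set.Finite.subset (by simp [allRules]) hR, fun ρ hρ => ?_⟩
  rcases hR hρ with rfl | rfl | rfl | rfl | rfl | rfl | rfl | rfl | rfl | rfl <;>
    simp [Rule.IsRewriteRule, add₁, add₂, add₃, add₄, add₅, double, commR, assocR, ss₁, ss₂] <;>
    grind

end Arith

end Rewriting

namespace Rewriting

namespace Loop

open FirstOrder.Language (Term)

/-! ## Terms over `f`, `g`, `h` -/

theorem func_f (ts : Fin 2 → loop.Term ℕ) :
    Term.func (L := loop) LoopFn.f ts = f (ts 0) (ts 1) := by
  rw [f]; congr 1; funext i; fin_cases i <;> rfl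

theorem func_g (ts : Fin 1 → loop.Term ℕ) :
    Term.func (L := loop) LoopFn.g ts = g (ts 0) := by
  rw [g]; congr 1; funext i; fin_cases i; rfl

theorem func_h (ts : Fin 1 → loop.Term ℕ) :
    Term.func (L := loop) LoopFn.h ts = h (ts 0) := by
  rw [h]; congr 1; funext i; fin_cases i; rfl

section Terms

variable (a b c d : loop.Term ℕ) (n : ℕ)

@[simp] theorem f_inj : f a b = f c d ↔ a = c ∧ b = d := by
  refine ⟨fun e => ?_, fun ⟨e, e'⟩ => e ▸ e' ▸ rfl⟩
  have e := func_inj (L := loop) e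
  exact ⟨congrFun e 0, congrFun e 1⟩

@[simp] theorem g_inj : g a = g b ↔ a = b :=
  ⟨fun e => congrFun (func_inj (L := loop) e) 0, fun e => e ▸ rfl⟩

@[simp] theorem h_inj : h a = h b ↔ a = b :=
  ⟨fun e => congrFun (func_inj (L := loop) e) 0, fun e => e ▸ rfl⟩

@[simp] theorem f_ne_g : f a b ≠ g c := by rintro ⟨⟩
@[simp] theorem g_ne_f : g c ≠ f a b := by rintro ⟨⟩
@[simp] theorem f_ne_h : f a b ≠ h c := by rintro ⟨⟩
@[simp] theorem h_ne_f : h c ≠ f a b := by rintro ⟨⟩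
@[simp] theorem g_ne_h : g a ≠ h b := by rintro ⟨⟩
@[simp] theorem h_ne_g : h a ≠ g b := by rintro ⟨⟩
@[simp] theorem var_ne_f : Term.var n ≠ f a b := by rintro ⟨⟩
@[simp] theorem var_ne_g : Term.var n ≠ g a := by rintro ⟨⟩
@[simp] theorem var_ne_h : Term.var n ≠ h a := by rintro ⟨⟩
@[simp] theorem f_ne_var : f a b ≠ Term.var n := by rintro ⟨⟩
@[simp] theorem g_ne_var : g a ≠ Term.var n := by rintro ⟨⟩
@[simp] theorem h_ne_var : h a ≠ Term.var n := by rintro ⟨⟩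

@[simp] theorem not_isVar_f : ¬ IsVar (f a b) := by rintro ⟨_, ⟨⟩⟩
@[simp] theorem not_isVar_g : ¬ IsVar (g a) := by rintro ⟨_, ⟨⟩⟩
@[simp] theorem not_isVar_h : ¬ IsVar (h a) := by rintro ⟨_, ⟨⟩⟩
@[simp] theorem isVar_x : IsVar x := ⟨0, rfl⟩
@[simp] theorem isVar_y : IsVar y := ⟨1, rfl⟩

variable (θ : ℕ → loop.Term ℕ) (π : ℕ → ℕ)

@[simp] theorem subst_f : (f a b).subst θ = f (a.subst θ) (b.subst θ) := func_f _
@[simp] theorem subst_g : (g a).subst θ = g (a.subst θ) := func_g _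
@[simp] theorem subst_h : (h a).subst θ = h (a.subst θ) := func_h _
@[simp] theorem subst_x : x.subst θ = θ 0 := rfl
@[simp] theorem subst_y : y.subst θ = θ 1 := rfl

@[simp] theorem relabel_f : (f a b).relabel π = f (a.relabel π) (b.relabel π) := func_f _
@[simp] theorem relabel_g : (g a).relabel π = g (a.relabel π) := func_g _
@[simp] theorem relabel_h : (h a).relabel π = h (a.relabel π) := func_h _
@[simp] theorem relabel_x : x.relabel π = .var (π 0) := rfl
@[simp] theorem relabel_y : y.relabel π = .var (π 1) := rfl

@[simp] theorem varFinset_f : (f a b).varFinset = a.varFinset ∪ b.varFinset := by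
  ext n; simp [f, Term.varFinset, Fin.exists_fin_two]
@[simp] theorem varFinset_g : (g a).varFinset = a.varFinset := by
  ext n; simp [g, Term.varFinset]
@[simp] theorem varFinset_h : (h a).varFinset = a.varFinset := by
  ext n; simp [h, Term.varFinset]
@[simp] theorem varFinset_x : x.varFinset = {0} := rfl
@[simp] theorem varFinset_y : y.varFinset = {1} := rfl

variable (p : Pos) (w : loop.Term ℕ)

theorem subtermAt_f_zero : subtermAt (f a b) (0 :: p) = subtermAt a p :=
  subtermAt_func_fin (L := loop) LoopFn.f ![a, b] 0 p
theorem subtermAt_f_one : subtermAt (f a b) (1 :: p) = subtermAt b p :=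
  subtermAt_func_fin (L := loop) LoopFn.f ![a, b] 1 p
theorem subtermAt_f_add_two (i : ℕ) : subtermAt (f a b) ((i + 2) :: p) = none :=
  dif_neg (by omega)
theorem subtermAt_g_zero : subtermAt (g a) (0 :: p) = subtermAt a p :=
  subtermAt_func_fin (L := loop) LoopFn.g ![a] 0 p
theorem subtermAt_g_add_one (i : ℕ) : subtermAt (g a) ((i + 1) :: p) = none :=
  dif_neg (by omega)
theorem subtermAt_h_zero : subtermAt (h a) (0 :: p) = subtermAt a p :=
  subtermAt_func_fin (L := loop) LoopFn.h ![a] 0 p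
theorem subtermAt_h_add_one (i : ℕ) : subtermAt (h a) ((i + 1) :: p) = none :=
  dif_neg (by omega)

@[simp] theorem subtermAt_f : subtermAt (f a b) p = some w ↔
    (p = [] ∧ w = f a b) ∨ (∃ q, p = 0 :: q ∧ subtermAt a q = some w) ∨
      ∃ q, p = 1 :: q ∧ subtermAt b q = some w := by
  match p with
  | [] => simpa using eq_comm
  | 0 :: p => simp [subtermAt_f_zero]
  | 1 :: p => simp [subtermAt_f_one]
  | (i + 2) :: p => simp [subtermAt_f_add_two]

@[simp] theorem subtermAt_g : subtermAt (g a) p = some w ↔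
    (p = [] ∧ w = g a) ∨ ∃ q, p = 0 :: q ∧ subtermAt a q = some w := by
  match p with
  | [] => simpa using eq_comm
  | 0 :: p => simp [subtermAt_g_zero]
  | (i + 1) :: p => simp [subtermAt_g_add_one]

@[simp] theorem subtermAt_h : subtermAt (h a) p = some w ↔
    (p = [] ∧ w = h a) ∨ ∃ q, p = 0 :: q ∧ subtermAt a q = some w := by
  match p with
  | [] => simpa using eq_comm
  | 0 :: p => simp [subtermAt_h_zero]
  | (i + 1) :: p => simp [subtermAt_h_add_one]

@[simp] theorem subtermAt_x : subtermAt x p = some w ↔ p = [] ∧ w = x := subtermAt_var_eq ..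
@[simp] theorem subtermAt_y : subtermAt y p = some w ↔ p = [] ∧ w = y := subtermAt_var_eq ..

@[simp] theorem replaceAt_f_left :
    replaceAt (f a b) (0 :: p) w = f (replaceAt a p w) b := by
  exact (replaceAt_func (L := loop) LoopFn.f ![a, b] 0 p w).trans (func_f _)

@[simp] theorem replaceAt_f_right :
    replaceAt (f a b) (1 :: p) w = f a (replaceAt b p w) := by
  exact (replaceAt_func (L := loop) LoopFn.f ![a, b] 1 p w).trans (func_f _)

theorem replaceOn_f_both (u : Pos → loop.Term ℕ) :
    replaceOn (f a b) {[0], [1]} u = f (u [0]) (u [1]) := by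
  refine (replacePar_func (L := loop) (f := LoopFn.f) (ts := ![a, b]) (by simp)).trans ?_
  rw [func_f, replacePar_of_nil (v := u [0]) (by simp), replacePar_of_nil (v := u [1]) (by simp)]

end Terms

/-! ## Rewriting -/

section Steps

variable {R : Set (Rule loop)} {a a' b b' t : loop.Term ℕ} {X : Set ℕ}

theorem step_f_left (hst : Step R a a') : Step R (f a b) (f a' b) := by
  have := Step.arg (f := (LoopFn.f : loop.Functions 2)) (ts := ![a, b]) 0 hst
  rwa [func_f (Function.update _ _ _)] at this

theorem step_f_right (hst : Step R b b') : Step R (f a b) (f a b') := by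
  have := Step.arg (f := (LoopFn.f : loop.Functions 2)) (ts := ![a, b]) 1 hst
  rwa [func_f (Function.update _ _ _)] at this

theorem step_f_cases (hst : Step R (f a b) t) : RootStep R (f a b) t ∨
    (∃ a', Step R a a' ∧ t = f a' b) ∨ ∃ b', Step R b b' ∧ t = f a b' := by
  obtain hst | ⟨i, t', hst', rfl⟩ := Step.func_cases hst
  · exact .inl hst
  · right
    rw [func_f]
    fin_cases i
    · exact .inl ⟨t', hst', rfl⟩
    · exact .inr ⟨t', hst', rfl⟩

theorem step_g_cases (hst : Step R (g a) t) : RootStep R (g a) t ∨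
    ∃ a', Step R a a' ∧ t = g a' := by
  obtain hst | ⟨i, t', hst', rfl⟩ := Step.func_cases hst
  · exact .inl hst
  · right
    rw [func_g]
    fin_cases i
    exact ⟨t', hst', rfl⟩

theorem step_h_cases (hst : Step R (h a) t) : RootStep R (h a) t ∨
    ∃ a', Step R a a' ∧ t = h a' := by
  obtain hst | ⟨i, t', hst', rfl⟩ := Step.func_cases hst
  · exact .inl hst
  · right
    rw [func_h]
    fin_cases i
    exact ⟨t', hst', rfl⟩

theorem parStepIn_f_cases (hst : ParStepIn R X (f a b) t) :
    (RootStep R (f a b) t ∧ (t.varFinset : Set ℕ) ⊆ X) ∨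
      ∃ a' b', t = f a' b' ∧ ParStepIn R X a a' ∧ ParStepIn R X b b' := by
  obtain hst | ⟨ts, rfl, hst'⟩ := ParStepIn.func_cases hst
  · exact .inl hst
  · exact .inr ⟨ts 0, ts 1, func_f _, hst' 0, hst' 1⟩

theorem parStepIn_g_cases (hst : ParStepIn R X (g a) t) :
    (RootStep R (g a) t ∧ (t.varFinset : Set ℕ) ⊆ X) ∨ ∃ a', t = g a' := by
  obtain hst | ⟨ts, rfl, -⟩ := ParStepIn.func_cases hst
  · exact .inl hst
  · exact .inr ⟨ts 0, func_g _⟩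

theorem parStepIn_h_cases (hst : ParStepIn R X (h a) t) :
    (RootStep R (h a) t ∧ (t.varFinset : Set ℕ) ⊆ X) ∨ ∃ a', t = h a' := by
  obtain hst | ⟨ts, rfl, -⟩ := ParStepIn.func_cases hst
  · exact .inl hst
  · exact .inr ⟨ts 0, func_h _⟩

theorem step_induct {motive : loop.Term ℕ → loop.Term ℕ → Prop}
    (root : ∀ a b, RootStep R a b → motive a b)
    (arg_g : ∀ a a', motive a a' → motive (g a) (g a'))
    (arg_h : ∀ a a', motive a a' → motive (h a) (h a'))
    (left : ∀ a a' b, motive a a' → motive (f a b) (f a' b))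
    (right : ∀ a b b', motive b b' → motive (f a b) (f a b'))
    (hst : Step R a t) : motive a t := by
  refine Step.induct root (fun n k ts i t ih => ?_) hst
  cases k with
  | f =>
    fin_cases i
    · rw [func_f, func_f]
      exact left _ _ _ ih
    · rw [func_f, func_f]
      exact right _ _ _ ih
  | g =>
    fin_cases i
    rw [func_g, func_g]
    exact arg_g _ _ ih
  | h =>
    fin_cases i
    rw [func_h, func_h]
    exact arg_h _ _ ih

end Steps

/-! ## The rules -/

def ruleGG : Rule loop := ⟨f (g x) (g y), f (g x) (h y)⟩
def ruleHG : Rule loop := ⟨f (h x) (g y), f (g x) (g y)⟩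
def ruleGH : Rule loop := ⟨f (g x) (h y), f x y⟩
def ruleHH : Rule loop := ⟨f (h x) (h y), f y x⟩
def swapR : Rule loop := ⟨f x y, f y x⟩
def ghR : Rule loop := ⟨g x, h x⟩
def hgR : Rule loop := ⟨h x, g x⟩

theorem R₈_eq : R₈ = {ruleGG, ruleHG, ruleGH, ruleHH, swapR, ghR, hgR} := rfl

theorem ghR_inv : ghR.inv = hgR := rfl
theorem hgR_inv : hgR.inv = ghR := rfl

section RuleSteps

variable {R : Set (Rule loop)}

theorem step_ruleGG (hR : ruleGG ∈ R) (a b : loop.Term ℕ) :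
    Step R (f (g a) (g b)) (f (g a) (h b)) := by
  simpa [ruleGG] using (rootStep_of_mem hR (assign a b b)).step

theorem step_ruleHG (hR : ruleHG ∈ R) (a b : loop.Term ℕ) :
    Step R (f (h a) (g b)) (f (g a) (g b)) := by
  simpa [ruleHG] using (rootStep_of_mem hR (assign a b b)).step

theorem step_ruleGH (hR : ruleGH ∈ R) (a b : loop.Term ℕ) :
    Step R (f (g a) (h b)) (f a b) := by
  simpa [ruleGH] using (rootStep_of_mem hR (assign a b b)).step

theorem step_ruleHH (hR : ruleHH ∈ R) (a b : loop.Term ℕ) :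
    Step R (f (h a) (h b)) (f b a) := by
  simpa [ruleHH] using (rootStep_of_mem hR (assign a b b)).step

theorem step_swapR (hR : swapR ∈ R) (a b : loop.Term ℕ) : Step R (f a b) (f b a) := by
  simpa [swapR] using (rootStep_of_mem hR (assign a b b)).step

theorem step_swapR_inv (hR : swapR.inv ∈ R) (a b : loop.Term ℕ) : Step R (f a b) (f b a) := by
  simpa [swapR, Rule.inv] using (rootStep_of_mem hR (assign b a b)).step

theorem step_ghR (hR : ghR ∈ R) (a : loop.Term ℕ) : Step R (g a) (h a) := by
  simpa [ghR] using (rootStep_of_mem hR (assign a a a)).step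

theorem step_hgR (hR : hgR ∈ R) (a : loop.Term ℕ) : Step R (h a) (g a) := by
  simpa [hgR] using (rootStep_of_mem hR (assign a a a)).step

end RuleSteps

/-! ## The criterion for linear systems applies -/

section Positive

def reducing : Set (Rule loop) := {ruleGG, ruleHG, ruleGH, ruleHH}

def reverting : Set (Rule loop) := {swapR, ghR, hgR}

def isLeftH : loop.Term ℕ → ℕ
  | .func LoopFn.h _ => 1
  | _ => 0

def isRightG : loop.Term ℕ → ℕ
  | .func LoopFn.g _ => 1
  | _ => 0

/-- A weight that decreases in every step with `reducing`. -/
def weight : loop.Term ℕ → ℕ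
  | .var _ => 0
  | .func LoopFn.f ts => weight (ts 0) + weight (ts 1) + isLeftH (ts 0) + isRightG (ts 1)
  | .func LoopFn.g ts => weight (ts 0) + 3
  | .func LoopFn.h ts => weight (ts 0) + 3

variable {a b c t u v : loop.Term ℕ}

@[simp] theorem isLeftH_f : isLeftH (f a b) = 0 := rfl
@[simp] theorem isLeftH_g : isLeftH (g a) = 0 := rfl
@[simp] theorem isLeftH_h : isLeftH (h a) = 1 := rfl
@[simp] theorem isRightG_f : isRightG (f a b) = 0 := rfl
@[simp] theorem isRightG_g : isRightG (g a) = 1 := rfl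
@[simp] theorem isRightG_h : isRightG (h a) = 0 := rfl
@[simp] theorem weight_f :
    weight (f a b) = weight a + weight b + isLeftH a + isRightG b := rfl
@[simp] theorem weight_g : weight (g a) = weight a + 3 := rfl
@[simp] theorem weight_h : weight (h a) = weight a + 3 := rfl

theorem isLeftH_le (t : loop.Term ℕ) : isLeftH t ≤ 1 := by
  unfold isLeftH; split <;> simp

theorem isRightG_le (t : loop.Term ℕ) : isRightG t ≤ 1 := by
  unfold isRightG; split <;> simp

/-- `weight` charges an `h` on the left and a `g` on the right of `f`. `ruleGG` and `ruleHG` each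
remove a charge; the other rules drop two unary symbols, saving `6` and creating charges of at most
`2`. The two extra inequalities in the induction ensure that a step inside an argument creates no
charge above it. -/
theorem terminating_reducing : Terminating reducing := by
  refine noInfiniteChain_of_measure weight fun a b hst => And.left (?_ : weight b < weight a ∧
    isLeftH b ≤ isLeftH a ∧ isRightG b ≤ isRightG a)
  refine step_induct (motive := fun a b => weight b < weight a ∧ isLeftH b ≤ isLeftH a ∧
    isRightG b ≤ isRightG a) ?_ ?_ ?_ ?_ ?_ hst
  · rintro a b ⟨ρ, hρ, θ, rfl, rfl⟩
    have h₀ := isLeftH_le (θ 0)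
    have h₁ := isLeftH_le (θ 1)
    have h₂ := isRightG_le (θ 0)
    have h₃ := isRightG_le (θ 1)
    rcases hρ with rfl | rfl | rfl | rfl <;> simp [ruleGG, ruleHG, ruleGH, ruleHH] <;> omega
  all_goals
    intros
    simp
    omega

/-- `t` is `g a` or `h a`. -/
def IsGH (t a : loop.Term ℕ) : Prop := t = g a ∨ t = h a

theorem IsGH.unique (h₁ : IsGH t a) (h₂ : IsGH t b) : a = b := by
  obtain rfl | rfl := h₁ <;> obtain e | e := h₂ <;> simp at e <;> exact e

/-- `t` reduces to `f a b` up to the order of the arguments. -/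
def ReducesTo (t a b : loop.Term ℕ) : Prop :=
  Steps reducing t (f a b) ∨ Steps reducing t (f b a)

theorem ReducesTo.swap (ht : ReducesTo t a b) : ReducesTo t b a := Or.symm ht

theorem reducesTo_self (a b : loop.Term ℕ) : ReducesTo (f a b) a b := .inl .rfl

/-- The reductions chain: `ruleHG` leads to `ruleGG`, which leads to `ruleGH`. Only `ruleHH`
reverses the order of the arguments. -/
theorem reducesTo_f {t₁ t₂ : loop.Term ℕ} (h₁ : IsGH t₁ a) (h₂ : IsGH t₂ b) :
    ReducesTo (f t₁ t₂) a b := by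
  have gh : Steps reducing (f (g a) (h b)) (f a b) :=
    (step_ruleGH (by simp [reducing]) a b).steps
  have gg : Steps reducing (f (g a) (g b)) (f a b) :=
    .head (step_ruleGG (by simp [reducing]) a b) gh
  obtain rfl | rfl := h₁ <;> obtain rfl | rfl := h₂
  · exact .inl gg
  · exact .inl gh
  · exact .inl (.head (step_ruleHG (by simp [reducing]) a b) gg)
  · exact .inr (step_ruleHH (by simp [reducing]) a b).steps

theorem ReducesTo.joinMod (hu : ReducesTo u a b) (hv : ReducesTo v a b) :
    JoinMod reducing reverting u v := by
  have swap := fun a b => step_swapR (R := sym reverting) (.inl (by simp [reverting])) a b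
  obtain hu | hu := hu <;> obtain hv | hv := hv
  · exact .of_common hu hv
  · exact .of_steps hu hv (swap _ _)
  · exact .of_steps hu hv (swap _ _)
  · exact .of_common hu hv

/-- All four rules share one shape: arguments headed by `g` or `h`, a result that reduces to the
stripped `f`, and just these two arguments as inner overlap positions. -/
theorem lhs_reducing {ρ : Rule loop} (hρ : ρ ∈ reducing) (θ : ℕ → loop.Term ℕ) :
    ∃ t₁ t₂, ρ.lhs.subst θ = f t₁ t₂ ∧ IsGH t₁ (θ 0) ∧ IsGH t₂ (θ 1) ∧
      ReducesTo (ρ.rhs.subst θ) (θ 0) (θ 1) ∧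
      ∀ p w, p ≠ [] → subtermAt ρ.lhs p = some w → ¬ IsVar w →
        (p = [0] ∧ w.subst θ = t₁) ∨ (p = [1] ∧ w.subst θ = t₂) := by
  have inner : ∀ (k l : loop.Term ℕ → loop.Term ℕ), (k = g ∨ k = h) → (l = g ∨ l = h) →
      ∀ p w, p ≠ [] → subtermAt (f (k x) (l y)) p = some w → ¬ IsVar w →
        (p = [0] ∧ w.subst θ = k (θ 0)) ∨ (p = [1] ∧ w.subst θ = l (θ 1)) := by
    intro k l hk hl p w hp hw hv
    obtain rfl | rfl := hk <;> obtain rfl | rfl := hl <;>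
      simp only [subtermAt_f, subtermAt_g, subtermAt_h, subtermAt_x, subtermAt_y] at hw <;>
      rcases hw with ⟨rfl, rfl⟩ | ⟨q, rfl, ⟨rfl, rfl⟩ | ⟨q, rfl, rfl, rfl⟩⟩ |
        ⟨q, rfl, ⟨rfl, rfl⟩ | ⟨q, rfl, rfl, rfl⟩⟩ <;> simp at hv hp ⊢
  rcases hρ with rfl | rfl | rfl | rfl
  · refine ⟨g (θ 0), g (θ 1), by simp [ruleGG], .inl rfl, .inl rfl, ?_,
      inner g g (.inl rfl) (.inl rfl)⟩
    simpa [ruleGG] using reducesTo_f (.inl rfl) (.inr rfl)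
  · refine ⟨h (θ 0), g (θ 1), by simp [ruleHG], .inr rfl, .inl rfl, ?_,
      inner h g (.inr rfl) (.inl rfl)⟩
    simpa [ruleHG] using reducesTo_f (.inl rfl) (.inl rfl)
  · refine ⟨g (θ 0), h (θ 1), by simp [ruleGH], .inl rfl, .inr rfl, ?_,
      inner g h (.inl rfl) (.inr rfl)⟩
    simpa [ruleGH] using reducesTo_self (θ 0) (θ 1)
  · refine ⟨h (θ 0), h (θ 1), by simp [ruleHH], .inr rfl, .inr rfl, ?_,
      inner h h (.inr rfl) (.inr rfl)⟩
    simpa [ruleHH] using (reducesTo_self (θ 1) (θ 0)).swap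

theorem rootStep_reducing (hst : RootStep reducing t c) :
    ∃ t₁ t₂ a b, t = f t₁ t₂ ∧ IsGH t₁ a ∧ IsGH t₂ b ∧ ReducesTo c a b := by
  obtain ⟨ρ, hρ, θ, rfl, rfl⟩ := hst
  obtain ⟨t₁, t₂, e, h₁, h₂, h₃, -⟩ := lhs_reducing hρ θ
  exact ⟨t₁, t₂, _, _, e, h₁, h₂, h₃⟩

theorem not_rootStep_reducing (ht : IsGH t a) : ¬ RootStep reducing t c := by
  intro hst
  obtain ⟨t₁, t₂, a, b, rfl, -⟩ := rootStep_reducing hst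
  obtain e | e := ht <;> simp at e

theorem mem_sym_reverting {ρ : Rule loop} (hρ : ρ ∈ sym reverting) :
    ρ = swapR ∨ ρ = swapR.inv ∨ ρ = ghR ∨ ρ = hgR := by
  obtain (rfl | rfl | rfl) | ⟨ρ, rfl | rfl | rfl, rfl⟩ := hρ <;> simp [ghR_inv, hgR_inv]

theorem rootStep_reverting (hst : RootStep (sym reverting) t c) :
    (∃ a b, t = f a b ∧ c = f b a) ∨ ∃ a, IsGH t a ∧ IsGH c a := by
  obtain ⟨ρ, hρ, θ, rfl, rfl⟩ := hst
  rcases mem_sym_reverting hρ with rfl | rfl | rfl | rfl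
  · exact .inl ⟨θ 0, θ 1, by simp [swapR], by simp [swapR]⟩
  · exact .inl ⟨θ 1, θ 0, by simp [swapR, Rule.inv], by simp [swapR, Rule.inv]⟩
  · exact .inr ⟨θ 0, .inl (by simp [ghR]), .inr (by simp [ghR])⟩
  · exact .inr ⟨θ 0, .inr (by simp [hgR]), .inl (by simp [hgR])⟩

theorem joinMod_root (hu : RootStep reducing t u) (hv : RootStep (sym reverting) t v) :
    JoinMod reducing reverting u v := by
  obtain ⟨t₁, t₂, a, b, rfl, h₁, h₂, hu⟩ := rootStep_reducing hu
  obtain ⟨a', b', e, rfl⟩ | ⟨a', e | e, -⟩ := rootStep_reverting hv <;> simp at e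
  obtain ⟨rfl, rfl⟩ := e
  exact hu.joinMod (reducesTo_f h₂ h₁).swap

theorem linearConditions : LinearConditions reducing reverting where
  linear := by
    rintro ρ (rfl | rfl | rfl | rfl) <;> constructor <;> intro n p q hp hq <;>
      simp [ruleGG, ruleHG, ruleGH, ruleHH, x, y] at hp hq <;> aesop
  reversible := by
    refine reversible_of_rules fun ρ hρ θ => ?_
    obtain rfl | rfl | rfl := hρ
    · simpa [swapR] using (step_swapR (by simp [reverting]) _ _).steps
    · simpa [ghR] using (step_hgR (by simp [reverting]) _).steps
    · simpa [hgR] using (step_ghR (by simp [reverting]) _).steps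
  terminating := terminating_reducing
  cp_S_S := by
    rintro ⟨u, v⟩ hmem
    obtain ⟨t, c, hc, ρ, hρ, p, w, θ, hw, hv, rfl, rfl, rfl⟩ := overlap_of_mem_CP hmem
    obtain ⟨t₁, t₂, e, h₁, h₂, h₃, hp⟩ := lhs_reducing hρ θ
    by_cases hp₀ : p = []
    · subst hp₀
      rw [subtermAt_nil, Option.some.injEq] at hw
      subst hw
      rw [replaceAt_nil]
      rw [e] at hc
      obtain ⟨t₁', t₂', a, b, e', h₁', h₂', hu⟩ := rootStep_reducing hc
      rw [f_inj] at e'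
      obtain ⟨rfl, rfl⟩ := e'
      rw [h₁.unique h₁', h₂.unique h₂'] at h₃
      exact (hu.joinMod h₃).left
    · obtain ⟨-, e⟩ | ⟨-, e⟩ := hp p w hp₀ hw hv
      · exact absurd (e ▸ hc) (not_rootStep_reducing h₁)
      · exact absurd (e ▸ hc) (not_rootStep_reducing h₂)
  cp_P_S := by
    rintro ⟨u, v⟩ hmem
    obtain ⟨t, c, hc, ρ, hρ, p, w, θ, hw, hv, rfl, rfl, rfl⟩ := overlap_of_mem_CP hmem
    by_cases hp₀ : p = []
    · subst hp₀
      rw [subtermAt_nil, Option.some.injEq] at hw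
      subst hw
      rw [replaceAt_nil]
      exact (joinMod_root ⟨ρ, hρ, θ, rfl, rfl⟩ hc).symm.left
    · obtain ⟨t₁, t₂, e, h₁, h₂, h₃, hp⟩ := lhs_reducing hρ θ
      -- A reversible root step at an argument only exchanges `g` and `h`, so the stripped pair is
      -- unchanged and both sides reduce to the same `f` up to order.
      have key : ∀ {t a}, IsGH t a → RootStep (sym reverting) t c → IsGH c a := by
        intro t a ht hst
        obtain ⟨_, _, rfl, -⟩ | ⟨a', ht', hc'⟩ := rootStep_reverting hst
        · obtain e | e := ht <;> simp at e
        · rwa [ht.unique ht']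
      rw [e]
      obtain ⟨rfl, rfl⟩ | ⟨rfl, rfl⟩ := hp p w hp₀ hw hv
      · rw [replaceAt_f_left, replaceAt_nil]
        exact ((reducesTo_f (key h₁ hc) h₂).joinMod h₃).left
      · rw [replaceAt_f_right, replaceAt_nil]
        exact ((reducesTo_f h₁ (key h₂ hc)).joinMod h₃).left
  cp_S_P := by
    rintro ⟨u, v⟩ hmem
    obtain ⟨t, c, hc, ρ, hρ, p, w, θ, hw, hv, rfl, rfl, rfl⟩ := overlap_of_mem_CP hmem
    -- The left-hand sides in `sym reverting` have no proper nonvariable subterm.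
    have hp : p = [] := by
      by_contra hp
      rcases mem_sym_reverting hρ with rfl | rfl | rfl | rfl <;>
        simp only [swapR, ghR, hgR, Rule.inv, subtermAt_f, subtermAt_g, subtermAt_h, subtermAt_x,
          subtermAt_y] at hw
      · rcases hw with ⟨rfl, rfl⟩ | ⟨q, rfl, rfl, rfl⟩ | ⟨q, rfl, rfl, rfl⟩ <;> simp at hv hp
      · rcases hw with ⟨rfl, rfl⟩ | ⟨q, rfl, rfl, rfl⟩ | ⟨q, rfl, rfl, rfl⟩ <;> simp at hv hp
      · rcases hw with ⟨rfl, rfl⟩ | ⟨q, rfl, rfl, rfl⟩ <;> simp at hv hp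
      · rcases hw with ⟨rfl, rfl⟩ | ⟨q, rfl, rfl, rfl⟩ <;> simp at hv hp
    subst hp
    rw [subtermAt_nil, Option.some.injEq] at hw
    subst hw
    rw [replaceAt_nil]
    exact (joinMod_root hc ⟨ρ, hρ, θ, rfl, rfl⟩).right

theorem linearNoRT_R₈ : LinearNoRT _ R₈ := by
  refine ⟨reducing, reverting, ⟨?_, ?_⟩, linearConditions⟩
  · ext
    simp [R₈_eq, reducing, reverting]
    tauto
  · rintro ρ (rfl | rfl | rfl | rfl) τ (rfl | rfl | rfl) ⟨π, e, -⟩ <;>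
      simp [ruleGG, ruleHG, ruleGH, ruleHH, swapR, ghR, hgR, x, y] at e

theorem isTRS_R₈ : IsTRS R₈ := by
  refine ⟨by simp [R₈_eq], ?_⟩
  rw [R₈_eq]
  rintro ρ (rfl | rfl | rfl | rfl | rfl | rfl | rfl) <;>
    simp [Rule.IsRewriteRule, ruleGG, ruleHG, ruleGH, ruleHH, swapR, ghR, hgR] <;> grind

end Positive

end Loop

end Rewriting

namespace Rewriting

namespace Loop

open FirstOrder.Language (Term)

/-! ## The criteria based on parallel critical pairs do not apply -/

section Negative

variable {R S P P₀ : Set (Rule loop)} {t u v : loop.Term ℕ} {X : Set ℕ}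

/-- The overlap of `k x → k' x` and `l y → l' y` on the arguments of `f`. -/
theorem mem_PCPIn_both {k k' l l' : loop.Term ℕ → loop.Term ℕ}
    (hk : k = g ∧ k' = h ∨ k = h ∧ k' = g) (hl : l = g ∧ l' = h ∨ l = h ∧ l' = g)
    (hkR : ⟨k x, k' x⟩ ∈ R) (hlR : ⟨l x, l' x⟩ ∈ R) {r : loop.Term ℕ}
    (hr : ∀ σ : ℕ → loop.Term ℕ, σ 0 = x → σ 1 = y → r.subst σ = r)
    (hr' : r.varFinset ⊆ {0, 1}) (hS : ⟨f (k x) (l y), r⟩ ∈ S) :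
    ∃ X, (f (k' x) (l' y), r, X) ∈ PCPIn R S := by
  let τ : Pos → Rule loop := fun p =>
    if p = [0] then ⟨k (.var 2), k' (.var 2)⟩ else ⟨l (.var 3), l' (.var 3)⟩
  -- The overlapping rules are renamed to variables `2` and `3`, which are identified with `x` and
  -- `y`.
  let σ : ℕ → loop.Term ℕ := fun n => if n = 2 then x else if n = 3 then y else .var n
  refine ⟨varsAt {[0], [1]} ((f (k x) (l y)).subst σ), _, hS, _, isVariant_refl _, {[0], [1]}, τ,
    fun p => if p = [0] then k x else l y, σ, by simp, by simp, ?_, ?_, ?_, ?_, ?_⟩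
  · simp [Set.Pairwise, Parallel]
  · simp only [Finset.mem_insert, Finset.mem_singleton]
    rintro p (rfl | rfl)
    · refine ⟨⟨_, hkR, Equiv.swap 0 2, ?_⟩, ?_, ?_, ?_⟩
      · obtain ⟨rfl, rfl⟩ | ⟨rfl, rfl⟩ := hk <;> simp [τ]
      · have := Finset.disjoint_of_subset_right hr' (show Disjoint {2} {0, 1} by decide)
        obtain ⟨rfl, rfl⟩ | ⟨rfl, rfl⟩ := hk <;> obtain ⟨rfl, rfl⟩ | ⟨rfl, rfl⟩ := hl <;>
          simpa [τ, Rule.vars] using this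
      · simp
      · obtain ⟨rfl, rfl⟩ | ⟨rfl, rfl⟩ := hk <;> simp
    · refine ⟨⟨_, hlR, Equiv.swap 0 3, ?_⟩, ?_, ?_, ?_⟩
      · obtain ⟨rfl, rfl⟩ | ⟨rfl, rfl⟩ := hl <;> simp [τ]
      · have := Finset.disjoint_of_subset_right hr' (show Disjoint {3} {0, 1} by decide)
        obtain ⟨rfl, rfl⟩ | ⟨rfl, rfl⟩ := hk <;> obtain ⟨rfl, rfl⟩ | ⟨rfl, rfl⟩ := hl <;>
          simpa [τ, Rule.vars] using this
      · simp
      · obtain ⟨rfl, rfl⟩ | ⟨rfl, rfl⟩ := hl <;> simp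
  · simp only [Finset.mem_insert, Finset.mem_singleton]
    rintro p (rfl | rfl) q (rfl | rfl) hpq <;>
      obtain ⟨rfl, rfl⟩ | ⟨rfl, rfl⟩ := hk <;> obtain ⟨rfl, rfl⟩ | ⟨rfl, rfl⟩ := hl <;>
      simp [τ, Rule.vars] at hpq ⊢
  · refine isMGU_of_absorbed ?_ ?_ ?_
    · refine (Set.toFinite {2, 3}).subset fun n hn => ?_
      by_contra hn'
      simp only [Set.mem_insert_iff, Set.mem_singleton_iff, not_or] at hn'
      simp [σ, hn'] at hn
    · rintro e ⟨p, hp, rfl⟩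
      simp only [Finset.mem_insert, Finset.mem_singleton] at hp
      obtain rfl | rfl := hp <;>
        obtain ⟨rfl, rfl⟩ | ⟨rfl, rfl⟩ := hk <;> obtain ⟨rfl, rfl⟩ | ⟨rfl, rfl⟩ := hl <;>
        simp [τ, σ, x, y]
    · intro δ hδ n
      have h₂ := hδ _ ⟨[0], by simp, rfl⟩
      have h₃ := hδ _ ⟨[1], by simp, rfl⟩
      have h₂ : δ 2 = δ 0 := by
        obtain ⟨rfl, rfl⟩ | ⟨rfl, rfl⟩ := hk <;> simpa [τ] using h₂
      have h₃ : δ 3 = δ 1 := by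
        obtain ⟨rfl, rfl⟩ | ⟨rfl, rfl⟩ := hl <;> simpa [τ] using h₃
      by_cases hn : n = 2
      · simp [σ, hn, h₂]
      · by_cases hn' : n = 3
        · simp [σ, hn', h₃]
        · simp [σ, hn, hn']
  · rw [replaceOn_f_both, hr _ (by simp [σ, x]) (by simp [σ, y])]
    obtain ⟨rfl, rfl⟩ | ⟨rfl, rfl⟩ := hk <;> obtain ⟨rfl, rfl⟩ | ⟨rfl, rfl⟩ := hl <;> simp [τ, σ]

/-- The overlap of `g x → h x` on the second argument of `ruleHG`. -/
theorem mem_PCPIn_ghR_ruleHG (h₁ : ghR ∈ R) (h₂ : ruleHG ∈ S) :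
    ∃ X ⊆ {1}, (f (h x) (h y), f (g x) (g y), X) ∈ PCPIn R S := by
  refine ⟨varsAt {[1]} (f (h x) (g y)), ?_, _, h₂, _, isVariant_refl _, {[1]},
    fun _ => ⟨g (.var 2), h (.var 2)⟩, fun _ => g y, fun n => if n = 2 then y else .var n,
    by simp, by simp, by simp, ?_, ?_, ?_, ?_⟩
  · rintro n ⟨p, hp, u, hu, hn⟩
    simp only [Finset.mem_singleton] at hp
    subst hp
    simp at hu
    subst hu
    simpa using hn
  · intro p hp
    simp only [Finset.mem_singleton] at hp
    subst hp
    refine ⟨⟨ghR, h₁, Equiv.swap 0 2, by simp [ghR], by simp [ghR]⟩, ?_, by simp [ruleHG], by simp⟩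
    simp [Rule.vars, ruleHG]
  · simp
  · refine isMGU_of_absorbed ?_ ?_ ?_
    · refine (Set.finite_singleton 2).subset fun n hn => ?_
      by_contra hn'
      simp only [Set.mem_singleton_iff] at hn'
      simp [hn'] at hn
    · rintro e ⟨p, hp, rfl⟩
      simp [y]
    · intro τ hτ n
      have := hτ _ ⟨[1], by simp, rfl⟩
      simp only [subst_g, g_inj, subst_var_eq, subst_y] at this
      by_cases hn : n = 2
      · simp [hn, this]
      · simp [hn]
  · rw [replaceOn_singleton]
    simp [ruleHG, x, y]

/-- The rules that do not contract or expand an `f` with variables as arguments, together with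
their inverses, and the contracting rules. -/
def boundedRules : Set (Rule loop) :=
  {ruleGG, ruleHG, ruleGH, ruleHH, swapR, ghR, hgR, ruleGG.inv, ruleHG.inv, swapR.inv}

theorem not_rootStep_var (hR : R ⊆ boundedRules) {n : ℕ} : ¬ RootStep R (.var n) t := by
  rintro ⟨ρ, hρ, θ, e, -⟩
  rcases hR hρ with rfl | rfl | rfl | rfl | rfl | rfl | rfl | rfl | rfl | rfl <;>
    simp [ruleGG, ruleHG, ruleGH, ruleHH, swapR, ghR, hgR, Rule.inv] at e

/-- The inverses of `ruleGH` and `ruleHH` are absent from `boundedRules`, so an `f` of variables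
cannot be expanded; only the swap matches it. -/
theorem rootStep_f_var (hR : R ⊆ boundedRules) {m n : ℕ}
    (hst : RootStep R (f (.var m) (.var n)) t) : t = f (.var n) (.var m) := by
  obtain ⟨ρ, hρ, θ, e, rfl⟩ := hst
  rcases hR hρ with rfl | rfl | rfl | rfl | rfl | rfl | rfl | rfl | rfl | rfl <;>
    simp [ruleGG, ruleHG, ruleGH, ruleHH, swapR, ghR, hgR, Rule.inv] at e ⊢
  all_goals exact ⟨e.2.symm, e.1.symm⟩

theorem step_f_var (hR : R ⊆ boundedRules) {m n : ℕ} (hst : Step R (f (.var m) (.var n)) t) :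
    t = f (.var n) (.var m) := by
  obtain hst | ⟨_, hst, -⟩ | ⟨_, hst, -⟩ := step_f_cases hst
  · exact rootStep_f_var hR hst
  · exact absurd hst.var_cases (not_rootStep_var hR)
  · exact absurd hst.var_cases (not_rootStep_var hR)

theorem steps_f_var (hR : R ⊆ boundedRules) {m n : ℕ} (hst : Steps R (f (.var m) (.var n)) t) :
    t = f (.var m) (.var n) ∨ t = f (.var n) (.var m) := by
  refine Steps.closed (C := fun t => t = f (.var m) (.var n) ∨ t = f (.var n) (.var m))
    (fun a b ha hab => ?_) hst (.inl rfl)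
  obtain rfl | rfl := ha
  · exact .inr (step_f_var hR hab)
  · exact .inl (step_f_var hR hab)

theorem parStepIn_var (hR : R ⊆ boundedRules) {n : ℕ} (hst : ParStepIn R X (.var n) t) :
    t = .var n :=
  hst.var_cases.resolve_left (not_rootStep_var hR)

theorem parStepIn_f_var (hR : R ⊆ boundedRules) {m n : ℕ}
    (hst : ParStepIn R X (f (.var m) (.var n)) t) :
    t = f (.var m) (.var n) ∨ t = f (.var n) (.var m) := by
  obtain ⟨hst, -⟩ | ⟨a, b, rfl, ha, hb⟩ := parStepIn_f_cases hst
  · exact .inr (rootStep_f_var hR hst)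
  · rw [parStepIn_var hR ha, parStepIn_var hR hb]
    exact .inl rfl

/-- Cycles and reversibility put `ghR` and `hgR` into `P`, and `ruleGH` and `ruleHH` into `S`. The
criterion itself then forces the remaining choices: `ruleHG` and `ruleGG` must lie in `S` to reduce
two doubly overlapped terms, and their presence makes every nonempty `P₀` violate relative
termination. Without `P₀`, the overlap of `ghR` on `ruleHG` cannot be closed. -/
theorem not_pcpRT_R₈ : ¬ PCPRT _ R₈ := by
  rintro ⟨S, P, P₀, hSP, hc⟩
  have hSR : ∀ {ρ}, ρ ∈ S → ρ ∈ R₈ := fun hρ => hSP.subset_left hρ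
  have hPR : ∀ {ρ}, ρ ∈ P → ρ ∈ R₈ := fun hρ => hSP.subset_right hρ
  rw [R₈_eq] at hSR hPR
  have hS₀ : S ⊆ boundedRules := by
    intro ρ hρ
    rcases hSR hρ with rfl | rfl | rfl | rfl | rfl | rfl | rfl <;> simp [boundedRules]
  have hP₀ : P ⊆ boundedRules := by
    intro ρ hρ
    rcases hPR hρ with rfl | rfl | rfl | rfl | rfl | rfl | rfl <;> simp [boundedRules]
  have hT := hc.terminating.terminating
  have swap_S : swapR ∉ S := fun hS =>
    not_noInfiniteChain_of_cycle (step_swapR hS x y) (step_swapR hS y x) hT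
  have gh_or_hg : ghR ∉ S ∨ hgR ∉ S := by
    by_contra! hS
    exact not_noInfiniteChain_of_cycle (step_ghR hS.1 x) (step_hgR hS.2 x) hT
  -- Only `hgR` can rewrite `h x`, so without it the step by `ghR` cannot be undone.
  have hg_of_gh : ghR ∈ P → hgR ∈ P := by
    intro hgh
    by_contra hhg
    have := Steps.closed (C := fun t => t = h x) (fun a b ha hab => ?_)
      (hc.reversible _ _ (step_ghR hgh x)) rfl
    · simp at this
    · subst ha
      obtain ⟨ρ, hρ, θ, e, rfl⟩ | ⟨_, hst, -⟩ := step_h_cases hab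
      · rcases hPR hρ with rfl | rfl | rfl | rfl | rfl | rfl | rfl
        on_goal 7 => exact absurd hρ hhg
        all_goals simp [ruleGG, ruleHG, ruleGH, ruleHH, swapR, ghR] at e
      · exact absurd hst.var_cases (not_rootStep_var hP₀)
  have gh_of_hg : hgR ∈ P → ghR ∈ P := by
    intro hhg
    by_contra hgh
    have := Steps.closed (C := fun t => t = g x) (fun a b ha hab => ?_)
      (hc.reversible _ _ (step_hgR hhg x)) rfl
    · simp at this
    · subst ha
      obtain ⟨ρ, hρ, θ, e, rfl⟩ | ⟨_, hst, -⟩ := step_g_cases hab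
      · rcases hPR hρ with rfl | rfl | rfl | rfl | rfl | rfl | rfl
        on_goal 6 => exact absurd hρ hgh
        all_goals simp [ruleGG, ruleHG, ruleGH, ruleHH, swapR, hgR] at e
      · exact absurd hst.var_cases (not_rootStep_var hP₀)
  have hP : ghR ∈ P ∧ hgR ∈ P := by
    obtain hS | hS := gh_or_hg
    · have := hSP.mem_right (by simp [R₈_eq]) hS
      exact ⟨this, hg_of_gh this⟩
    · have := hSP.mem_right (by simp [R₈_eq]) hS
      exact ⟨gh_of_hg this, this⟩
  have gh_S : ruleGH ∈ S := by
    refine hSP.mem_left (by simp [R₈_eq]) fun hmem => ?_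
    have := steps_f_var hP₀ (hc.reversible _ _ (step_ruleGH hmem x y))
    simp at this
  have hh_S : ruleHH ∈ S := by
    refine hSP.mem_left (by simp [R₈_eq]) fun hmem => ?_
    have := steps_f_var hP₀ (hc.reversible _ _ (step_ruleHH hmem x y))
    simp at this
  have hS : S ⊆ reducing := by
    intro ρ hρ
    rcases hSR hρ with rfl | rfl | rfl | rfl | rfl | rfl | rfl
    on_goal 5 => exact absurd hρ swap_S
    on_goal 5 => exact absurd hρ (hSP.notMem_left hP.1)
    on_goal 5 => exact absurd hρ (hSP.notMem_left hP.2)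
    all_goals simp [reducing]
  have hP' : P ⊆ {ruleGG, ruleHG, swapR, ghR, hgR} := by
    intro ρ hρ
    rcases hPR hρ with rfl | rfl | rfl | rfl | rfl | rfl | rfl
    on_goal 3 => exact absurd gh_S (hSP.notMem_left hρ)
    on_goal 3 => exact absurd hh_S (hSP.notMem_left hρ)
    all_goals simp
  have hsym : sym P ⊆ boundedRules := by
    rintro ρ (hρ | ⟨ρ, hρ, rfl⟩)
    · exact hP₀ hρ
    · rcases hP' hρ with rfl | rfl | rfl | rfl | rfl <;>
        simp [boundedRules, ghR_inv, hgR_inv]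
  have hSP₀ : S ∪ P₀ ⊆ boundedRules := Set.union_subset hS₀ (hc.subset.trans hsym)
  have arg_gh : ∀ {t a n}, IsGH t (.var n) → ¬ Step S t a := by
    intro t a n ht hst
    obtain rfl | rfl := ht
    · obtain hst | ⟨_, hst, -⟩ := step_g_cases hst
      · exact not_rootStep_reducing (.inl rfl) (hst.mono hS)
      · exact not_rootStep_var hS₀ hst.var_cases
    · obtain hst | ⟨_, hst, -⟩ := step_h_cases hst
      · exact not_rootStep_reducing (.inr rfl) (hst.mono hS)
      · exact not_rootStep_var hS₀ hst.var_cases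
  have step_root : ∀ {t₁ t₂ a}, IsGH t₁ x → IsGH t₂ y → Step S (f t₁ t₂) a →
      RootStep S (f t₁ t₂) a := by
    intro t₁ t₂ a h₁ h₂ hst
    obtain hst | ⟨_, hst, -⟩ | ⟨_, hst, -⟩ := step_f_cases hst
    · exact hst
    · exact absurd hst (arg_gh h₁)
    · exact absurd hst (arg_gh h₂)
  by_cases hHG : ruleHG ∈ S
  swap
  -- Without `ruleHG`, the peak `f (h x) (g y)` is `S`-normal, while `f x y` reaches nothing but
  -- itself and its swap, even with a parallel step.
  · obtain ⟨X, hX⟩ := mem_PCPIn_both (R := sym P) (S := S) (k := g) (k' := h) (l := h) (l' := g)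
      (r := f x y) (.inl ⟨rfl, rfl⟩) (.inr ⟨rfl, rfl⟩) (.inl hP.1) (.inl hP.2)
      (fun σ h₀ h₁ => by simp [h₀, h₁]) (by simp) gh_S
    obtain ⟨V, a, b, hua, hba, hvb, -⟩ := hc.pcp_P_S _ _ _ hX
    obtain rfl | ⟨d, hd, -⟩ := hua
    · obtain rfl | rfl := steps_f_var hSP₀ hvb <;>
        simpa using parStepIn_f_var hsym ⟨V, hba, Set.subset_univ _⟩
    · obtain ⟨ρ, hρ, θ, e, -⟩ := step_root (.inr rfl) (.inl rfl) hd
      rcases hS hρ with rfl | rfl | rfl | rfl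
      on_goal 2 => exact absurd hρ hHG
      all_goals simp [ruleGG, ruleGH, ruleHH] at e
  by_cases hGG : ruleGG ∈ S
  swap
  -- Without `ruleGG`, the same argument applies to `f (g x) (g y)` against `f y x`, from the
  -- overlap on `ruleHH`.
  · obtain ⟨X, hX⟩ := mem_PCPIn_both (R := sym P) (S := S) (k := h) (k' := g) (l := h) (l' := g)
      (r := f y x) (.inr ⟨rfl, rfl⟩) (.inr ⟨rfl, rfl⟩) (.inl hP.2) (.inl hP.2)
      (fun σ h₀ h₁ => by simp [h₀, h₁]) (by simp [Finset.pair_comm]) hh_S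
    obtain ⟨V, a, b, hua, hba, hvb, -⟩ := hc.pcp_P_S _ _ _ hX
    obtain rfl | ⟨d, hd, -⟩ := hua
    · obtain rfl | rfl := steps_f_var hSP₀ hvb <;>
        simpa using parStepIn_f_var hsym ⟨V, hba, Set.subset_univ _⟩
    · obtain ⟨ρ, hρ, θ, e, -⟩ := step_root (.inl rfl) (.inl rfl) hd
      rcases hS hρ with rfl | rfl | rfl | rfl
      on_goal 1 => exact absurd hρ hGG
      all_goals simp [ruleHG, ruleGH, ruleHH] at e
  -- The cycles: `ruleGG`, swap, `ruleHG` on `f (g x) (g x)`; `ruleHG` undone by `ghR` on the left;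
  -- `ruleGG` undone by `hgR` on the right.
  have hempty : P₀ = ∅ := by
    refine Set.eq_empty_of_forall_notMem fun ρ hρ => ?_
    have hGGs := step_ruleGG hGG x x
    have hHGs := step_ruleHG hHG x x
    have swap_loop : (∀ a b, Step P₀ (f a b) (f b a)) → False := fun hsw =>
      not_noInfiniteChain_of_cycle (r := Relation.Comp (Step S) (Steps P₀))
        ⟨_, hGGs, (hsw _ _).steps⟩ ⟨_, hHGs, .rfl⟩ hc.terminating
    have gh_loop : ghR ∉ P₀ := fun hgh =>
      not_noInfiniteChain_of_cycle (r := Relation.Comp (Step S) (Steps P₀))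
        ⟨_, hHGs, (step_f_left (step_ghR hgh x)).steps⟩
        ⟨_, hHGs, (step_f_left (step_ghR hgh x)).steps⟩ hc.terminating
    have hg_loop : hgR ∉ P₀ := fun hhg =>
      not_noInfiniteChain_of_cycle (r := Relation.Comp (Step S) (Steps P₀))
        ⟨_, hGGs, (step_f_right (step_hgR hhg x)).steps⟩
        ⟨_, hGGs, (step_f_right (step_hgR hhg x)).steps⟩ hc.terminating
    have hGGP : ruleGG ∉ P := fun hmem => hSP.notMem_left hmem hGG
    have hHGP : ruleHG ∉ P := fun hmem => hSP.notMem_left hmem hHG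
    obtain hρ' | ⟨ρ, hρ', rfl⟩ := hc.subset hρ <;>
      rcases hP' hρ' with rfl | rfl | rfl | rfl | rfl
    · exact hGGP hρ'
    · exact hHGP hρ'
    · exact swap_loop (step_swapR hρ)
    · exact gh_loop hρ
    · exact hg_loop hρ
    · exact hGGP hρ'
    · exact hHGP hρ'
    · exact swap_loop (step_swapR_inv hρ)
    · exact hg_loop hρ
    · exact gh_loop hρ
  subst hempty
  rw [Set.union_empty] at hSP₀
  obtain ⟨X, hX, hmem⟩ := mem_PCPIn_ghR_ruleHG (R := sym P) (.inl hP.1) hHG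
  obtain ⟨V, a, b, hua, hba, hvb, hV⟩ := hc.pcp_P_S _ _ _ hmem
  rw [Set.union_empty] at hua hvb
  have noStep : ∀ {m n t}, ¬ Step S (f (.var m) (.var n)) t := by
    intro m n t hst
    obtain hst | ⟨_, hst, -⟩ | ⟨_, hst, -⟩ := step_f_cases hst
    · obtain ⟨_, _, _, _, e, h₁ | h₁, -⟩ := rootStep_reducing (hst.mono hS) <;>
        subst h₁ <;> simp at e
    · exact not_rootStep_var hS₀ hst.var_cases
    · exact not_rootStep_var hS₀ hst.var_cases
  have ha : a = f (h x) (h y) ∨ a = f y x := by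
    obtain rfl | ⟨d, hd, hda⟩ := hua
    · exact .inl rfl
    · right
      obtain ⟨ρ, hρ, θ, e, rfl⟩ := step_root (.inr rfl) (.inr rfl) hd
      have hd' : ρ.rhs.subst θ = f y x := by
        rcases hS hρ with rfl | rfl | rfl | rfl <;>
          simp [ruleGG, ruleHG, ruleGH, ruleHH] at e ⊢
        exact ⟨e.2.symm, e.1.symm⟩
      rw [hd'] at hda
      exact Steps.closed (C := fun t => t = f y x)
        (fun s t hs hst => absurd (hs ▸ hst) noStep) hda rfl
  have hb : b = f (g x) (g y) ∨ b = f (g x) (h y) ∨ b = f x y := by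
    refine Steps.closed (C := fun t => t = f (g x) (g y) ∨ t = f (g x) (h y) ∨ t = f x y)
      (fun s t hs hst => ?_) hvb (.inl rfl)
    rcases hs with rfl | rfl | rfl
    · obtain ⟨ρ, hρ, θ, e, rfl⟩ := step_root (.inl rfl) (.inl rfl) hst
      rcases hS hρ with rfl | rfl | rfl | rfl <;>
        simp [ruleGG, ruleHG, ruleGH, ruleHH] at e ⊢
      exact .inl ⟨e.1.symm, e.2.symm⟩
    · obtain ⟨ρ, hρ, θ, e, rfl⟩ := step_root (.inl rfl) (.inr rfl) hst
      rcases hS hρ with rfl | rfl | rfl | rfl <;>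
        simp [ruleGG, ruleHG, ruleGH, ruleHH] at e ⊢
      simp [← e.1, ← e.2]
    · exact absurd hst noStep
  have hba : ParStepIn (sym P) {1} b a := ⟨V, hba, hV.trans hX⟩
  -- Contracta may contain only `y`. Both candidates for `a` contain `x`, so the root is not
  -- contracted; the argument of `a` that contains `x` cannot be a contractum either, and it differs
  -- in its head from the corresponding argument of every candidate for `b`.
  have hx : ∀ {t : loop.Term ℕ}, 0 ∈ t.varFinset → ¬ (t.varFinset : Set ℕ) ⊆ {1} :=
    fun h₀ hsub => by simpa using hsub h₀
  have g_to : ∀ {c d}, 0 ∈ d.varFinset → ParStepIn (sym P) {1} (g c) d → ∃ d', d = g d' :=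
    fun hd hst => (parStepIn_g_cases hst).resolve_left fun hst => hx hd hst.2
  have h_to : ∀ {c d}, 0 ∈ d.varFinset → ParStepIn (sym P) {1} (h c) d → ∃ d', d = h d' :=
    fun hd hst => (parStepIn_h_cases hst).resolve_left fun hst => hx hd hst.2
  obtain ⟨b₁, b₂, rfl, hb₁, hb₂⟩ : ∃ b₁ b₂, b = f b₁ b₂ ∧ (b₁ = g x ∨ b₁ = x) ∧
      (b₂ = g y ∨ b₂ = h y ∨ b₂ = y) := by
    rcases hb with rfl | rfl | rfl <;> exact ⟨_, _, rfl, by simp, by simp⟩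
  obtain ⟨-, hst⟩ | ⟨a₁, a₂, rfl, h₁, h₂⟩ := parStepIn_f_cases hba
  · exact hx (by rcases ha with rfl | rfl <;> simp) hst
  simp only [f_inj] at ha
  obtain ⟨rfl, rfl⟩ | ⟨rfl, rfl⟩ := ha
  · obtain rfl | rfl := hb₁
    · obtain ⟨_, e⟩ := g_to (by simp) h₁
      simp at e
    · have := parStepIn_var hsym h₁
      simp at this
  · rcases hb₂ with rfl | rfl | rfl
    · obtain ⟨_, e⟩ := g_to (by simp) h₂
      simp [x] at e
    · obtain ⟨_, e⟩ := h_to (by simp) h₂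
      simp [x] at e
    · have := parStepIn_var hsym h₂
      simp [x] at this

end Negative

end Loop

/-! ### Location of the six systems. -/

open Arith Loop in
theorem subset_allRules : R₃ ⊆ allRules ∧ R₄ ⊆ allRules ∧ R₅ ⊆ allRules ∧ R₆ ⊆ allRules ∧
    R₇ ⊆ allRules := by
  refine ⟨?_, ?_, ?_, ?_, ?_⟩ <;> intro ρ <;> simp [R₃, R₄, R₅, R₆, R₇, allRules] <;> tauto

open Arith Loop in
theorem locations :
    (IsTRS R₃ ∧ LinearNoRT _ R₃ ∧ LinearRT _ R₃ ∧ PCPNoRT _ R₃ ∧ PCPRT _ R₃) ∧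
    (IsTRS R₄ ∧ ¬ LinearNoRT _ R₄ ∧ ¬ LinearRT _ R₄ ∧ PCPNoRT _ R₄ ∧ PCPRT _ R₄) ∧
    (IsTRS R₅ ∧ LinearNoRT _ R₅ ∧ LinearRT _ R₅ ∧ ¬ PCPNoRT _ R₅ ∧ PCPRT _ R₅) ∧
    (IsTRS R₆ ∧ ¬ LinearNoRT _ R₆ ∧ ¬ LinearRT _ R₆ ∧ PCPNoRT _ R₆ ∧ PCPRT _ R₆) ∧
    (IsTRS R₇ ∧ ¬ LinearNoRT _ R₇ ∧ ¬ LinearRT _ R₇ ∧ ¬ PCPNoRT _ R₇ ∧ PCPRT _ R₇) ∧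
    (IsTRS R₈ ∧ LinearNoRT _ R₈ ∧ LinearRT _ R₈ ∧ ¬ PCPNoRT _ R₈ ∧ ¬ PCPRT _ R₈) := by
  obtain ⟨h₃, h₄, h₅, h₆, h₇⟩ := subset_allRules
  have n₄ := not_linearRT h₄ (by simp [R₄])
  have n₆ := not_linearRT h₆ (by simp [R₆])
  have n₇ := not_linearRT h₇ (by simp [R₇, R₄])
  have m₅ : ¬ PCPNoRT _ R₅ := not_pcpNoRT
    (by intro ρ; simp [R₃, R₅]; tauto) (by simp [R₅]) (by simp [R₃, R₅])
  have m₇ : ¬ PCPNoRT _ R₇ := not_pcpNoRT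
    (by intro ρ; simp [R₃, R₄, R₅, R₇]; tauto) (by simp [R₅, R₇]) (by simp [R₃, R₅, R₇])
  exact ⟨⟨Arith.isTRS h₃, linearNoRT_R₃, linearNoRT_R₃.linearRT, pcpNoRT_R₃, pcpNoRT_R₃.pcpRT⟩,
    ⟨Arith.isTRS h₄, fun h => n₄ h.linearRT, n₄, pcpNoRT_R₄, pcpNoRT_R₄.pcpRT⟩,
    ⟨Arith.isTRS h₅, linearNoRT_R₅, linearNoRT_R₅.linearRT, m₅, pcpRT_R₅⟩,
    ⟨Arith.isTRS h₆, fun h => n₆ h.linearRT, n₆, pcpNoRT_R₆, pcpNoRT_R₆.pcpRT⟩,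
    ⟨Arith.isTRS h₇, fun h => n₇ h.linearRT, n₇, m₇, pcpRT_R₇⟩,
    ⟨isTRS_R₈, linearNoRT_R₈, linearNoRT_R₈.linearRT, fun h => not_pcpRT_R₈ h.pcpRT, not_pcpRT_R₈⟩⟩

end Rewriting

theorem theorem3p19 :
    -- the four incomparability claims
    (Rewriting.Incomparable Rewriting.LinearNoRT Rewriting.PCPRT ∧
     Rewriting.Incomparable Rewriting.PCPNoRT Rewriting.LinearRT ∧
     Rewriting.Incomparable Rewriting.LinearRT Rewriting.PCPRT ∧
     Rewriting.Incomparable Rewriting.LinearNoRT Rewriting.PCPNoRT) ∧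
    -- the location of the example systems with respect to the four criteria
    (Rewriting.IsTRS Rewriting.R₃ ∧
      Rewriting.LinearNoRT _ Rewriting.R₃ ∧ Rewriting.LinearRT _ Rewriting.R₃ ∧
      Rewriting.PCPNoRT _ Rewriting.R₃ ∧ Rewriting.PCPRT _ Rewriting.R₃) ∧
    (Rewriting.IsTRS Rewriting.R₄ ∧
      ¬ Rewriting.LinearNoRT _ Rewriting.R₄ ∧ ¬ Rewriting.LinearRT _ Rewriting.R₄ ∧
      Rewriting.PCPNoRT _ Rewriting.R₄ ∧ Rewriting.PCPRT _ Rewriting.R₄) ∧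
    (Rewriting.IsTRS Rewriting.R₅ ∧
      Rewriting.LinearNoRT _ Rewriting.R₅ ∧ Rewriting.LinearRT _ Rewriting.R₅ ∧
      ¬ Rewriting.PCPNoRT _ Rewriting.R₅ ∧ Rewriting.PCPRT _ Rewriting.R₅) ∧
    (Rewriting.IsTRS Rewriting.R₆ ∧
      ¬ Rewriting.LinearNoRT _ Rewriting.R₆ ∧ ¬ Rewriting.LinearRT _ Rewriting.R₆ ∧
      Rewriting.PCPNoRT _ Rewriting.R₆ ∧ Rewriting.PCPRT _ Rewriting.R₆) ∧
    (Rewriting.IsTRS Rewriting.R₇ ∧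
      ¬ Rewriting.LinearNoRT _ Rewriting.R₇ ∧ ¬ Rewriting.LinearRT _ Rewriting.R₇ ∧
      ¬ Rewriting.PCPNoRT _ Rewriting.R₇ ∧ Rewriting.PCPRT _ Rewriting.R₇) ∧
    (Rewriting.IsTRS Rewriting.R₈ ∧
      Rewriting.LinearNoRT _ Rewriting.R₈ ∧ Rewriting.LinearRT _ Rewriting.R₈ ∧
      ¬ Rewriting.PCPNoRT _ Rewriting.R₈ ∧ ¬ Rewriting.PCPRT _ Rewriting.R₈) := by
  obtain ⟨l₃, l₄, l₅, l₆, l₇, l₈⟩ := Rewriting.locations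
  -- `R₈` separates the linear criteria from (PCP-RT), `R₄` separates both parallel criteria from
  -- the linear ones, and `R₅` separates the linear criteria from (PCP).
  exact ⟨⟨⟨⟨_, _, l₈.1, l₈.2.1, l₈.2.2.2.2⟩, ⟨_, _, l₄.1, l₄.2.2.2.2, l₄.2.1⟩⟩,
    ⟨⟨_, _, l₄.1, l₄.2.2.2.1, l₄.2.2.1⟩, ⟨_, _, l₅.1, l₅.2.2.1, l₅.2.2.2.1⟩⟩,
    ⟨⟨_, _, l₈.1, l₈.2.2.1, l₈.2.2.2.2⟩, ⟨_, _, l₄.1, l₄.2.2.2.2, l₄.2.2.1⟩⟩,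
    ⟨⟨_, _, l₅.1, l₅.2.1, l₅.2.2.2.1⟩, ⟨_, _, l₄.1, l₄.2.2.2.1, l₄.2.1⟩⟩⟩,
    l₃, l₄, l₅, l₆, l₇, l₈⟩
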